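/- Let $d\ge 3$ and let $B\subset\mathbb R^d$ be the ball of volume one centred at the origin. For $t>0$ let $V$ be a Poisson point process of intensity $t$ in $B$ (a Poisson($t$) number of independent uniform points of $B$), and let $L$ be a random two-dimensional linear plane, independent of $V$ and distributed according to the rotation invariant (Haar) probability measure on the set of all such planes. Let $x|_L$ denote the orthogonal projection of $x$ to $L$. Let $\delta_t>0$ $(t>0)$ be such that $\delta_t\to0$ and such that the finite limit $\ell=\lim_{t\to\infty}\frac1{t\delta_t^d}\in[0,\infty)$ exists. Let $G$ be the random geometric graph with vertex set $V$ in which distinct points at distance at most $\delta_t$ are joined by a segment, and let $G_L$ be its projection to $L$. With $[u,v]$ denoting the segment if $\|u-v\|\le\delta_t$ and the empty set otherwise, and $V^k_{\neq}$ the set of $k$-tuples of distinct points of $V$, put $$\overline{\rm cr}(G_L)=\frac18\sum_{(v_1,\dots,v_4)\in V^4_{\neq}}\mathbf 1\big([v_1,v_2]|_L\cap[v_3,v_4]|_L\neq\emptyset\big),\qquad {\rm stress}(G,G_L)=\frac12\sum_{(v_1,v_2)\in V^2_{\neq}}s_L(v_1,v_2),$$ where $s_L(u,v)=w(u,v)\big(\|u-v\|-\|u|_L-v|_L\|\big)^2$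 and the weight $w$ is a measurable symmetric function with $w(u,v)>0$ for $u\ne v$, which is invariant under linear isometries, $w(gu,gv)=w(u,v)$, and satisfies $\int_{B^2}s_L(u,v)^2\,du\,dv<\infty$ for every two-dimensional linear plane $L$ (so that the stress has a finite second moment). Then for every $t>0$ the crossing number $\overline{\rm cr}(G_L)$ and ${\rm stress}(G,G_L)$ are square integrable with respect to the joint law of $(L,V)$, and $$\mathrm{Corr}_{L,V}\big(\overline{\rm cr}(G_L),{\rm stress}(G,G_L)\big)>0 .$$ Moreover, the limit of this correlation as $t\to\infty$ exists, and for every two-dimensional linear plane $L$ $$\lim_{t\to\infty}\mathrm{Corr}_{L,V}\big(\overline{\rm cr}(G_L),{\rm stress}(G,G_L)\big)\ \ge\ \frac{\int_{B^2}\mathrm{vol}_{d-2}\big((v+L^\perp)\cap B\big)\,s_L(v,v_1)\,dv_1\,dv}{\Big(1+\frac{2\pi\kappa_d}{c_d}\,\ell\Big)^{1/2} I^{(3)}(B,L)^{1/2}\,S^{(2)}(B,L)^{1/2}}\ >\ 0,$$ so that the correlation does not vanish as $t\to\infty$. On the left $L$ is random; on the right $L$ is an arbitrary fixed plane (by rotation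 invariance the choice is immaterial). Here $\kappa_d$ is the volume of the unit ball $B_d$ of $\mathbb R^d$, $$I^{(3)}(B,L)=\int_{B|_L}\mathrm{vol}_{d-2}\big((x+L^\perp)\cap B\big)^3dx,\qquad S^{(2)}(B,L)=\int_{B^3}s_L(v,v_1)\,s_L(v,v_2)\,dv_1\,dv_2\,dv,$$ $$c_d=\int_{B_d}\int_{2B_2}\int_{B_d}\mathbf 1\big([0,x|_L]\cap(y+[0,z|_L])\neq\emptyset\big)\,dz\,dy\,dx,$$ where in the last formula $B_2$ is the unit disc of $L$ and the brackets denote full segments (by rotation invariance the choice of $L$ is immaterial here, too). -/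

import Mathlib

open MeasureTheory ProbabilityTheory Filter Topology
open scoped NNReal ENNReal

namespace RGG

noncomputable section

/-- The Euclidean space `ℝ^d`. -/
abbrev E (d : ℕ) : Type := EuclideanSpace ℝ (Fin d)

/-! ### Two-dimensional linear planes and the uniform random plane -/

/-- The set of two-dimensional linear planes `L` in `ℝ^d`. -/
structure Plane (d : ℕ) where
  toSubmodule : Submodule ℝ (E d)
  finrank_eq : Module.finrank ℝ toSubmodule = 2

/-- The orthogonal projection `x ↦ x|_L` onto the plane `L`, as a map of `ℝ^d` to itself. -/
def Plane.proj {d : ℕ} (L : Plane d) : E d →L[ℝ] E d := L.toSubmodule.starProjection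

/-- Planes carry the Borel structure obtained by identifying `L` with its projection operator
(the usual topology of the Grassmannian). -/
instance instMeasurableSpacePlane (d : ℕ) : MeasurableSpace (Plane d) :=
  MeasurableSpace.comap Plane.proj inferInstance

/-- The orthogonal group `O(d)`, as the group of orthogonal operators of `ℝ^d`. -/
abbrev OrthGroup (d : ℕ) : Type := unitary (E d →L[ℝ] E d)

instance instContinuousStarOperators (d : ℕ) : ContinuousStar (E d →L[ℝ] E d) :=
  ⟨(ContinuousLinearMap.adjoint (𝕜 := ℝ) (E := E d) (F := E d)).continuous⟩

instance instCompactSpaceOrthGroup (d : ℕ) : CompactSpace (OrthGroup d) := by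
  refine isCompact_iff_compactSpace (s := (unitary (E d →L[ℝ] E d) : Set (E d →L[ℝ] E d))).mp ?_
  refine Metric.isCompact_of_isClosed_isBounded (isClosed_unitary (R := E d →L[ℝ] E d)) ?_
  refine (Metric.isBounded_closedBall (x := (0 : E d →L[ℝ] E d)) (r := 1)).subset ?_
  intro U hU
  rw [mem_closedBall_zero_iff]
  refine ContinuousLinearMap.opNorm_le_bound _ zero_le_one fun x => ?_
  have h := (Unitary.linearIsometryEquiv (⟨U, hU⟩ : OrthGroup d)).norm_map x
  rw [one_mul]
  exact h.le

/-- The Haar probability measure on `O(d)`. -/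
def orthHaar (d : ℕ) : Measure (OrthGroup d) := Measure.haarMeasure ⊤

instance instIsProbabilityMeasureOrthHaar (d : ℕ) : IsProbabilityMeasure (orthHaar d) :=
  ⟨by
    have h := Measure.haarMeasure_self (K₀ := (⊤ : TopologicalSpace.PositiveCompacts (OrthGroup d)))
    simpa [orthHaar] using h⟩

/-- The coordinate plane spanned by the first two standard basis vectors. -/
def basePlane (d : ℕ) (hd : 2 ≤ d) : Plane d where
  toSubmodule := Submodule.span ℝ
    (Set.range fun i : Fin 2 => EuclideanSpace.basisFun (Fin d) ℝ (Fin.castLE hd i))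
  finrank_eq := by
    have h := ((EuclideanSpace.basisFun (Fin d) ℝ).orthonormal.comp (Fin.castLE hd)
      (Fin.castLE_injective hd)).linearIndependent
    have h2 := finrank_span_eq_card h
    simpa [Function.comp_def] using h2

/-- The image `U L` of a plane under an orthogonal map. -/
def Plane.rotate {d : ℕ} (L : Plane d) (U : OrthGroup d) : Plane d where
  toSubmodule := L.toSubmodule.map
    ((Unitary.linearIsometryEquiv U).toLinearEquiv : E d →ₗ[ℝ] E d)
  finrank_eq := by
    rw [LinearEquiv.finrank_map_eq]
    exact L.finrank_eq

theorem Plane.proj_rotate {d : ℕ} (L : Plane d) (U : OrthGroup d) :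
    (L.rotate U).proj = (U : E d →L[ℝ] E d) * L.proj * star (U : E d →L[ℝ] E d) := by
  ext1 x
  exact Submodule.starProjection_map_apply (Unitary.linearIsometryEquiv U) L.toSubmodule x

theorem Plane.measurable_rotate {d : ℕ} (L : Plane d) :
    Measurable fun U : OrthGroup d => L.rotate U := by
  refine measurable_comap_iff.mpr ?_
  have h : (Plane.proj ∘ fun U : OrthGroup d => L.rotate U) =
      fun U : OrthGroup d => (U : E d →L[ℝ] E d) * L.proj * star (U : E d →L[ℝ] E d) :=
    funext fun U => L.proj_rotate U
  rw [h]
  exact Continuous.measurable (by fun_prop)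

/-- The law of a uniform random plane: the rotation invariant (Haar) probability measure on the
set of planes, i.e. the law of `U L₀` for a Haar distributed `U ∈ O(d)`. -/
def uniformPlane (d : ℕ) (hd : 2 ≤ d) : Measure (Plane d) :=
  (orthHaar d).map fun U => (basePlane d hd).rotate U

instance instIsProbabilityMeasureUniformPlane (d : ℕ) (hd : 2 ≤ d) :
    IsProbabilityMeasure (uniformPlane d hd) :=
  Measure.isProbabilityMeasure_map (Plane.measurable_rotate _).aemeasurable

/-! ### The ball of unit volume and the Poisson point process in it -/

/-- The volume `κ_d` of the unit ball of `ℝ^d`. -/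
def kappa (d : ℕ) : ℝ := volume.real (Metric.ball (0 : E d) 1)

/-- The ball `B` in `ℝ^d` centred at the origin with volume one. -/
def unitVolBall (d : ℕ) : Set (E d) := Metric.closedBall 0 ((kappa d)⁻¹ ^ ((d : ℝ)⁻¹))

theorem kappa_pos (d : ℕ) : 0 < kappa d :=
  ENNReal.toReal_pos (Metric.measure_ball_pos volume _ one_pos).ne' measure_ball_lt_top.ne

theorem volume_unitVolBall (d : ℕ) (hd : d ≠ 0) : volume (unitVolBall d) = 1 := by
  have hk := kappa_pos d
  rw [unitVolBall, Measure.addHaar_closedBall _ _ (by positivity), finrank_euclideanSpace_fin,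
    Real.rpow_inv_natCast_pow (by positivity) hd, ← ENNReal.ofReal_toReal
      (a := volume (Metric.ball (0 : E d) 1)) measure_ball_lt_top.ne,
    ← ENNReal.ofReal_mul (by positivity)]
  change ENNReal.ofReal ((kappa d)⁻¹ * kappa d) = 1
  rw [inv_mul_cancel₀ hk.ne', ENNReal.ofReal_one]

/-- A sample of the Poisson process of intensity `t` in `W` (a set of volume one): a number `n`
together with a sequence of points of which the first `n` are used. The number is Poisson
distributed with parameter `t`, the points are independent of each other and of the number, and
uniformly distributed in `W`. -/
def poissonSample {d : ℕ} (W : Set (E d)) (t : ℝ) : Measure (ℕ × (ℕ → E d)) :=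
  (poissonMeasure t.toNNReal).prod
    (Measure.infinitePi fun _ : ℕ => (volume : Measure (E d)).restrict W)

/-- The vertices `v_1, …, v_n` of the random graph. -/
def vertices {d : ℕ} (ω : ℕ × (ℕ → E d)) : Fin ω.1 → E d := fun i => ω.2 i

/-! ### Crossing number and stress of the projected graph -/

/-- The edge `[u,v]`: the segment if the distance of `u` and `v` is at most `δ`, else empty. -/
def edge {d : ℕ} (δ : ℝ) (u v : E d) : Set (E d) := {z | dist u v ≤ δ ∧ z ∈ segment ℝ u v}

/-- The rectilinear crossing number of the projection onto `L` of the geometric graph with vertices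
`v` and distance parameter `δ`: `1/8` times the number of ordered 4-tuples of distinct vertices for
which the projected edges `[v₁,v₂]` and `[v₃,v₄]` meet. -/
def crossingNumber {d : ℕ} (δ : ℝ) (L : Plane d) {n : ℕ} (v : Fin n → E d) : ℝ :=
  open Classical in
  (1 / 8 : ℝ) * ∑ i : Fin 4 ↪ Fin n,
    if ((L.proj '' edge δ (v (i 0)) (v (i 1))) ∩
        (L.proj '' edge δ (v (i 2)) (v (i 3)))).Nonempty then 1 else 0

/-- The stress of a pair: `w(u,v) (d₀(u,v) - d_L(u,v))²`. -/
def pairStress {d : ℕ} (w : E d → E d → ℝ) (L : Plane d) (u v : E d) : ℝ :=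
  w u v * (dist u v - dist (L.proj u) (L.proj v)) ^ 2

/-- The stress of the projection onto `L`: half the sum of the stress of all ordered pairs of
distinct vertices. -/
def stress {d : ℕ} (w : E d → E d → ℝ) (L : Plane d) {n : ℕ} (v : Fin n → E d) : ℝ :=
  (1 / 2 : ℝ) * ∑ i : Fin 2 ↪ Fin n, pairStress w L (v (i 0)) (v (i 1))

/-- The correlation coefficient of two random variables. -/
def corr {Ω : Type*} [MeasurableSpace Ω] (X Y : Ω → ℝ) (P : Measure Ω) : ℝ :=
  covariance X Y P / (Real.sqrt (variance X P) * Real.sqrt (variance Y P))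

/-! ### The constants of the lower bound -/

/-- `vol_{d-2}((v + L^⊥) ∩ W)`, measured by the Lebesgue measure of the Euclidean space `L^⊥`. -/
def sectionVol {d : ℕ} (W : Set (E d)) (L : Plane d) (v : E d) : ℝ :=
  (volume : Measure (L.toSubmoduleᗮ)).real {y | v + (y : E d) ∈ W}

/-- `I^{(3)}(W,L) = ∫_{W|_L} vol_{d-2}((x + L^⊥) ∩ W)³ dx`, with Lebesgue measure on `L`. -/
def I3 {d : ℕ} (W : Set (E d)) (L : Plane d) : ℝ :=
  ∫ x in {x : L.toSubmodule | (x : E d) ∈ L.proj '' W}, sectionVol W L x ^ 3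

/-- `S^{(2)}(W,L)`. -/
def S2 {d : ℕ} (w : E d → E d → ℝ) (W : Set (E d)) (L : Plane d) : ℝ :=
  ∫ v in W, ∫ v₁ in W, ∫ v₂ in W, pairStress w L v v₁ * pairStress w L v v₂

/-- The integral in the numerator of the bound. -/
def sectionStress {d : ℕ} (w : E d → E d → ℝ) (W : Set (E d)) (L : Plane d) : ℝ :=
  ∫ v in W, ∫ v₁ in W, sectionVol W L v * pairStress w L v v₁

/-- The constant `c_d`, the integral over `(x, y, z) ∈ B_d × 2 B_2 × B_d` of the indicator of the
event that `[0, x|_L]` meets `y + [0, z|_L]`, where `B_d` is the unit ball of `ℝ^d` and `B_2` that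
of `L`. The value does not depend on the plane `L`. -/
def crossConst {d : ℕ} (L : Plane d) : ℝ :=
  ((volume : Measure (E d)).prod ((volume : Measure L.toSubmodule).prod
    (volume : Measure (E d)))).real
    {p | p.1 ∈ Metric.closedBall 0 1 ∧ p.2.1 ∈ Metric.closedBall 0 2 ∧
      p.2.2 ∈ Metric.closedBall 0 1 ∧
      (segment ℝ 0 (L.proj p.1) ∩
        segment ℝ (p.2.1 : E d) ((p.2.1 : E d) + L.proj p.2.2)).Nonempty}

/-- The lower bound for the correlation; `ℓ` stands for `lim 1 / (t δ_t^d)`. -/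
def corrBound {d : ℕ} (w : E d → E d → ℝ) (W : Set (E d)) (ℓ : ℝ) (L : Plane d) : ℝ :=
  sectionStress w W L /
    (Real.sqrt (1 + 2 * Real.pi * kappa d / crossConst L * ℓ) * Real.sqrt (I3 W L) *
      Real.sqrt (S2 w W L))

end

end RGG

namespace RGG

/-! ### Second moments of Poisson U-statistics -/

section Poisson

variable {X : Type*} [MeasurableSpace X]

/-! Both statistics are Poisson U-statistics with nonnegative kernels, and second moments of these
are combinatorial. A pair of index tuples has a pattern that records which points are shared; the
number of pairs with a given pattern is a falling factorial of the Poisson count, whose mean is a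
power of `t`. This gives `covariance_ustat`: the covariance is a sum over the nonempty patterns of
powers of `t` times overlap integrals. Every summand is nonnegative and a one-point summand is
positive (`covariance_pos`), so the correlation is positive for each `t`.

The random plane is harmless. Any two planes differ by a linear isometry, which preserves the ball,
the point process and the weight, so the joint law of the two statistics is that of an arbitrary
fixed plane (`map_stats_prod`).

For the asymptotics, a crossing near a vertex `v` is described by the two edge displacements `δ • x`
and `δ • z`, a planar offset `δ • y`, and an unscaled fibre coordinate `u` orthogonal to `L`. Only
`x, y, z` decide the crossing (`crossing_local`); integrating `u` produces the section volume. Thus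
a given edge is crossed with weight of order `δ ^ (d + 2)`, and a given vertex takes part in a
crossing with weight of order `δ ^ (2 * d + 2)`. In the variance of the crossing number, sharing one
point (16 patterns) contributes at order `t ^ 7 * δ ^ (4 * d + 4)`. Sharing a whole edge (8
patterns) contributes `1 / (t * δ ^ d)` times that order, which is where `ℓ` enters. All other
overlaps lose a further factor `δ ^ (d - 2)`, and this vanishes because `d ≥ 3`. In the covariance
with the stress and in the variance of the stress only one-point patterns survive (8 and 4 of them).

Write `c` and `q` for the integrals of the crossing profile and of its square, `I` and `S` for the
second moments of section volume and point stress, and `N` for their mixed moment. The limit is `8 c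
N / (√(16 c² I + 8 ℓ q I) √(4 S))`. The profile is at most `4 π κ_d`, hence `q ≤ 4 π κ_d c`
(`crossSq_le`, `maxProfile_eq`), and this single estimate turns the limit into the stated bound. -/

theorem lintegral_infinitePi_comp_injective {α β : Type*} (μ : Measure X) [IsProbabilityMeasure μ]
    {e : α → β} (he : Function.Injective e) {Φ : (α → X) → ℝ≥0∞} (hΦ : Measurable Φ) :
    ∫⁻ ω, Φ (fun a => ω (e a)) ∂(Measure.infinitePi fun _ : β => μ) =
      ∫⁻ u, Φ u ∂(Measure.infinitePi fun _ : α => μ) := by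
  rw [← Measure.map_infinitePi_infinitePi_of_inj (P := fun _ : β => μ) he,
    lintegral_map hΦ (by fun_prop)]

theorem lintegral_pi_comp_injective {α β : Type*} [Fintype α] [Fintype β] (μ : Measure X)
    [IsProbabilityMeasure μ]
    {e : α → β} (he : Function.Injective e) {Φ : (α → X) → ℝ≥0∞} (hΦ : Measurable Φ) :
    ∫⁻ ω, Φ (fun a => ω (e a)) ∂(Measure.pi fun _ : β => μ) =
      ∫⁻ u, Φ u ∂(Measure.pi fun _ : α => μ) := by
  rw [← Measure.infinitePi_eq_pi, ← Measure.infinitePi_eq_pi,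
    lintegral_infinitePi_comp_injective μ he hΦ]

theorem lintegral_pi_sum {α β : Type*} [Fintype α] [Fintype β] (μ : Measure X)
    [IsProbabilityMeasure μ] {Φ : (α ⊕ β → X) → ℝ≥0∞} (hΦ : Measurable Φ) :
    ∫⁻ z, Φ z ∂(Measure.pi fun _ : α ⊕ β => μ) =
      ∫⁻ x, ∫⁻ y, Φ (Sum.elim x y) ∂(Measure.pi fun _ : β => μ) ∂(Measure.pi fun _ : α => μ) := by
  have h := measurePreserving_sumPiEquivProdPi_symm (fun _ : α ⊕ β => μ)
  rw [← h.lintegral_comp hΦ, lintegral_prod]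
  · refine lintegral_congr fun x => lintegral_congr fun y => ?_
    congr 1
  · exact (hΦ.comp h.measurable).aemeasurable

/-! ### Overlap patterns of two index tuples -/

variable {ι κ : Type*}

theorem measurable_comp_index {R α : Type*} [MeasurableSpace R] {f : (ι → X) → R}
    (hf : Measurable f) (e : ι → α) : Measurable fun ω : α → X => f fun a => ω (e a) :=
  hf.comp (measurable_pi_lambda _ fun a => measurable_pi_apply (e a))

/-- Two tuples of points sharing the coordinates prescribed by the pattern `p`: the coordinate `b`
of the second tuple is the coordinate `a` of the first one if `p b = some a`. -/
def mix (p : κ → Option ι) (x : ι → X) (y : κ → X) : κ → X := fun b => (p b).elim (y b) x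

theorem measurable_mix (p : κ → Option ι) :
    Measurable fun z : (ι → X) × (κ → X) => mix p z.1 z.2 := by
  refine measurable_pi_lambda _ fun b => ?_
  unfold mix
  cases h : p b <;> simp <;> fun_prop

/-- The patterns in which no two coordinates of the second tuple are identified. -/
def IsPattern (p : κ → Option ι) : Prop := ∀ b b' a, p b = some a → p b' = some a → b = b'

instance [Fintype ι] [Fintype κ] [DecidableEq ι] [DecidableEq κ] (p : κ → Option ι) :
    Decidable (IsPattern p) := by unfold IsPattern; infer_instance

/-- The number of free coordinates of a pattern. -/
def free [Fintype κ] (p : κ → Option ι) : ℕ := (Finset.univ.filter fun b => (p b).isNone).card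

/-- The pattern of two tuples of indices. -/
noncomputable def pattern {α : Type*} (i : ι → α) (j : κ → α) : κ → Option ι :=
  fun b => Function.partialInv i (j b)

theorem pattern_eq_some {α : Type*} {i : ι → α} (hi : Function.Injective i) {j : κ → α} {b a} :
    pattern i j b = some a ↔ i a = j b :=
  hi.isPartialInv a (j b)

theorem pattern_eq_none {α : Type*} {i : ι → α} (hi : Function.Injective i) {j : κ → α} {b} :
    pattern i j b = none ↔ ∀ a, i a ≠ j b := by
  rw [Option.eq_none_iff_forall_ne_some]
  exact forall_congr' fun a => not_congr (pattern_eq_some hi)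

theorem isPattern_pattern {α : Type*} {i : ι → α} (hi : Function.Injective i) {j : κ → α}
    (hj : Function.Injective j) : IsPattern (pattern i j) := fun b b' a h h' => by
  rw [pattern_eq_some hi] at h h'
  exact hj (h.symm.trans h')

/-- Pairs of tuples of distinct indices with a given pattern. -/
noncomputable def patternEquiv {α : Type*} {p : κ → Option ι} (hp : IsPattern p) :
    {ij : (ι ↪ α) × (κ ↪ α) // pattern ij.1 ij.2 = p} ≃ (ι ⊕ {b // p b = none} ↪ α) where
  toFun ij := ⟨Sum.elim ij.1.1 (fun b => ij.1.2 b), by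
    refine Function.Injective.sumElim ij.1.1.injective
      (ij.1.2.injective.comp Subtype.val_injective) fun a b => ?_
    have h : pattern ij.1.1 ij.1.2 b = none := by rw [ij.2, b.2]
    exact (pattern_eq_none ij.1.1.injective).1 h a⟩
  invFun φ := ⟨(⟨fun a => φ (Sum.inl a), φ.injective.comp Sum.inl_injective⟩,
    ⟨fun b => if h : p b = none then φ (Sum.inr ⟨b, h⟩) else
      φ (Sum.inl ((p b).get (Option.isSome_iff_ne_none.2 h))), by
      intro b b' h
      by_cases hb : p b = none <;> by_cases hb' : p b' = none <;> simp [hb, hb'] at h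
      · exact h
      · obtain ⟨a, ha⟩ := Option.ne_none_iff_exists'.1 hb
        refine hp b b' a ha ?_
        rw [← Option.some_get (Option.isSome_iff_ne_none.2 hb'), ← h]
        simp [ha]⟩), by
    funext b
    have hi : Function.Injective fun a => φ (Sum.inl a) := φ.injective.comp Sum.inl_injective
    by_cases hb : p b = none
    · rw [hb]
      refine (pattern_eq_none hi).2 fun a => ?_
      change _ ≠ dite _ _ _
      simp [hb]
    · obtain ⟨a, ha⟩ := Option.ne_none_iff_exists'.1 hb
      rw [ha]
      refine (pattern_eq_some hi).2 ?_
      change _ = dite _ _ _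
      simp [ha]⟩
  left_inv ij := by
    obtain ⟨⟨i, j⟩, rfl⟩ := ij
    ext b
    · rfl
    · by_cases hb : pattern i j b = none
      · simp [hb]
      · simp only [hb, Function.Embedding.coeFn_mk, dite_false, Sum.elim_inl]
        exact (pattern_eq_some i.injective).1 (Option.some_get _).symm
  right_inv φ := by
    ext b
    rcases b with a | ⟨b, hb⟩
    · rfl
    · change dite _ _ _ = _
      simp [hb]

/-- Once the pattern is fixed, a pair of tuples amounts to one injection of the coordinates of the
first together with the free coordinates of the second. The count is therefore a falling factorial,
the form whose Poisson mean is a pure power. -/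
theorem card_pattern {α : Type*} [Fintype ι] [Fintype κ] [Fintype α] [DecidableEq ι]
    [DecidableEq κ] {p : κ → Option ι} (hp : IsPattern p) :
    Nat.card {ij : (ι ↪ α) × (κ ↪ α) // pattern ij.1 ij.2 = p} =
      (Fintype.card α).descFactorial (Fintype.card ι + free p) := by
  classical
  rw [Nat.card_congr (patternEquiv hp), Nat.card_eq_fintype_card, Fintype.card_embedding_eq,
    Fintype.card_sum, free, Fintype.card_subtype]
  congr 3
  ext b
  simp

/-- The mixed moment of `f` and `g` on tuples overlapping according to `p`. -/
noncomputable def overlap [Fintype ι] [Fintype κ] (μ : Measure X) (f : (ι → X) → ℝ≥0∞)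
    (g : (κ → X) → ℝ≥0∞) (p : κ → Option ι) : ℝ≥0∞ :=
  ∫⁻ x, ∫⁻ y, f x * g (mix p x y) ∂(Measure.pi fun _ => μ) ∂(Measure.pi fun _ => μ)

variable [Fintype ι] [Fintype κ] (μ : Measure X) [IsProbabilityMeasure μ]

/-- Coordinates of the second tuple that are not identified sit at indices outside the first, so
they are fresh independent points. The expectation thus depends on the indices only through their
pattern. -/
theorem lintegral_mul_eq_overlap {i : ι → ℕ} {j : κ → ℕ} (hi : Function.Injective i)
    (hj : Function.Injective j) {f : (ι → X) → ℝ≥0∞} {g : (κ → X) → ℝ≥0∞} (hf : Measurable f)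
    (hg : Measurable g) :
    ∫⁻ ω, f (fun a => ω (i a)) * g (fun b => ω (j b)) ∂(Measure.infinitePi fun _ : ℕ => μ) =
      overlap μ f g (pattern i j) := by
  classical
  set p := pattern i j with hp
  -- `overlap` integrates every coordinate of `y`, although `mix` reads only the free ones. The free
  -- ones go to their true index `j b`, the ignored ones to dummy variables in an extra copy of `κ`,
  -- which keeps `e` injective.
  let e : ι ⊕ κ → ℕ ⊕ κ :=
    Sum.elim (fun a => Sum.inl (i a)) fun b => if p b = none then Sum.inl (j b) else Sum.inr b
  have he : Function.Injective e := by
    refine Function.Injective.sumElim (Sum.inl_injective.comp hi) ?_ ?_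
    · intro b b' h
      by_cases hb : p b = none <;> by_cases hb' : p b' = none <;> simp [hb, hb'] at h
      · exact hj h
      · exact h
    · intro a b
      by_cases hb : p b = none
      · simpa [hb] using (pattern_eq_none hi).1 hb a
      · simp [hb]
  have h1 : Measurable fun ω : ℕ → X => f (fun a => ω (i a)) * g (fun b => ω (j b)) :=
    (measurable_comp_index hf _).mul (measurable_comp_index hg _)
  rw [← lintegral_infinitePi_comp_injective μ (Sum.inl_injective (β := κ)) h1]
  have h2 : Measurable fun z : ι ⊕ κ → X =>
      f (fun a => z (Sum.inl a)) * g (mix p (fun a => z (Sum.inl a)) fun b => z (Sum.inr b)) :=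
    (hf.comp (by fun_prop)).mul (hg.comp ((measurable_mix p).comp
      (f := fun z : ι ⊕ κ → X => (fun a => z (Sum.inl a), fun b => z (Sum.inr b))) (by fun_prop)))
  have h3 := lintegral_infinitePi_comp_injective μ he h2
  rw [Measure.infinitePi_eq_pi (ι := ι ⊕ κ), lintegral_pi_sum μ h2] at h3
  rw [overlap]
  simp only [Sum.elim_inl, Sum.elim_inr] at h3
  rw [← h3]
  refine lintegral_congr fun ω => ?_
  congr 2
  funext b
  unfold mix
  cases hb : p b with
  | none => simp [e, hb]
  | some a => simp [e, (pattern_eq_some hi).1 hb]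

/-- Terms with `n < m` vanish; for `n = k + m` the falling factorial cancels against `(k + m)!`,
leaving `r ^ m` times the Poisson weight of `k`. These weights sum to one. -/
theorem lintegral_descFactorial_poisson (r : ℝ≥0) (m : ℕ) :
    ∫⁻ n, (n.descFactorial m : ℝ≥0∞) ∂(poissonMeasure r) = (r : ℝ≥0∞) ^ m := by
  have h1 : ∀ F : ℕ → ℝ≥0∞, ∫⁻ n, F n ∂(poissonMeasure r) =
      ∑' n, ENNReal.ofReal (Real.exp (-r) * r ^ n / n.factorial) * F n := by
    intro F
    rw [poissonMeasure, lintegral_sum_measure]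
    simp [lintegral_smul_measure]
  have h0 : (1 : ℝ≥0∞) = ∑' n : ℕ, ENNReal.ofReal (Real.exp (-r) * r ^ n / n.factorial) := by
    have := h1 fun _ => 1
    simpa only [lintegral_const, measure_univ, mul_one] using this
  rw [h1, ← Summable.sum_add_tsum_nat_add' (k := m) ENNReal.summable, Finset.sum_eq_zero, zero_add]
  · rw [← mul_one ((r : ℝ≥0∞) ^ m), h0, ← ENNReal.tsum_mul_left]
    refine tsum_congr fun k => ?_
    have h2 : (k.factorial : ℝ) * (k + m).descFactorial m = (k + m).factorial := by
      have := Nat.factorial_mul_descFactorial (Nat.le_add_left m k)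
      rw [Nat.add_sub_cancel] at this
      exact_mod_cast this
    have h3 : ((r : ℝ≥0∞) ^ m) = ENNReal.ofReal ((r : ℝ) ^ m) := by
      rw [ENNReal.ofReal_pow r.coe_nonneg, ENNReal.ofReal_coe_nnreal]
    have h4 : (((k + m).descFactorial m : ℕ) : ℝ≥0∞) =
      ENNReal.ofReal ((k + m).descFactorial m : ℝ) := by simp
    rw [h3, h4, ← ENNReal.ofReal_mul (by positivity), ← ENNReal.ofReal_mul (by positivity)]
    congr 1
    rw [← h2]
    have h5 : (((k + m).descFactorial m : ℕ) : ℝ) ≠ 0 := by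
      have : 0 < (k + m).descFactorial m := Nat.descFactorial_pos.2 (Nat.le_add_left m k)
      exact_mod_cast this.ne'
    field_simp
    ring
  · intro n hn
    rw [Nat.descFactorial_of_lt (Finset.mem_range.1 hn)]
    simp

/-- The Poisson sample with intensity measure `r • μ`. -/
noncomputable def sample (r : ℝ≥0) : Measure (ℕ × (ℕ → X)) :=
  (poissonMeasure r).prod (Measure.infinitePi fun _ : ℕ => μ)

instance (r : ℝ≥0) : IsProbabilityMeasure (sample μ r) := by unfold sample; infer_instance

/-- The sum of `f` over tuples of distinct points of the sample. -/
noncomputable def ustat {R : Type*} [AddCommMonoid R] (f : (ι → X) → R)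
    (ω : ℕ × (ℕ → X)) : R :=
  ∑ i : ι ↪ Fin ω.1, f fun a => ω.2 (i a)

omit [MeasurableSpace X] in
theorem ustat_mk {R : Type*} [AddCommMonoid R] (f : (ι → X) → R) (n : ℕ) (ω : ℕ → X) :
    ustat f (n, ω) = ∑ i : ι ↪ Fin n, f fun a => ω (i a) := rfl

theorem measurable_ustat {R : Type*} [AddCommMonoid R] [MeasurableSpace R] [MeasurableAdd₂ R]
    {f : (ι → X) → R} (hf : Measurable f) : Measurable (ustat f) := by
  refine measurable_from_prod_countable_right fun n => ?_
  simp_rw [ustat_mk]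
  exact Finset.measurable_fun_sum _ fun (i : ι ↪ Fin n) _ => measurable_comp_index hf (fun a => (i a : ℕ))

theorem lintegral_ustat (r : ℝ≥0) {f : (ι → X) → ℝ≥0∞} (hf : Measurable f) :
    ∫⁻ ω, ustat f ω ∂(sample μ r) =
      (r : ℝ≥0∞) ^ Fintype.card ι * ∫⁻ x, f x ∂(Measure.pi fun _ => μ) := by
  rw [sample, lintegral_prod _ (measurable_ustat hf).aemeasurable]
  have h : ∀ n : ℕ, ∫⁻ ω, ustat f (n, ω) ∂(Measure.infinitePi fun _ : ℕ => μ) =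
      (n.descFactorial (Fintype.card ι) : ℝ≥0∞) * ∫⁻ x, f x ∂(Measure.pi fun _ => μ) := by
    intro n
    simp_rw [ustat_mk]
    rw [lintegral_finsetSum _ fun (i : ι ↪ Fin n) _ => measurable_comp_index hf (fun a => (i a : ℕ))]
    have h1 : ∀ i : ι ↪ Fin n, ∫⁻ ω : ℕ → X, f (fun a => ω (i a))
        ∂(Measure.infinitePi fun _ : ℕ => μ) = ∫⁻ x, f x ∂(Measure.pi fun _ => μ) := fun i => by
      rw [← Measure.infinitePi_eq_pi]
      exact lintegral_infinitePi_comp_injective μ (Fin.val_injective.comp i.injective) hf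
    rw [Finset.sum_congr rfl fun i _ => h1 i]
    simp [Fintype.card_embedding_eq]
  simp_rw [h]
  rw [lintegral_mul_const _ (by fun_prop), lintegral_descFactorial_poisson]

variable [DecidableEq ι] [DecidableEq κ]

/-- For fixed `n`, the product is a double sum over index tuples, grouped here by pattern: all pairs
in a group have the same expectation, and `card_pattern` counts them. Averaging over `n` replaces
each falling factorial by a power of `r`. -/
theorem lintegral_ustat_mul_ustat (r : ℝ≥0) {f : (ι → X) → ℝ≥0∞} {g : (κ → X) → ℝ≥0∞}
    (hf : Measurable f) (hg : Measurable g) :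
    ∫⁻ ω, ustat f ω * ustat g ω ∂(sample μ r) =
      ∑ p ∈ Finset.univ.filter (IsPattern (ι := ι) (κ := κ)),
        (r : ℝ≥0∞) ^ (Fintype.card ι + free p) * overlap μ f g p := by
  classical
  rw [sample, lintegral_prod (fun ω => ustat f ω * ustat g ω)
    ((measurable_ustat hf).mul (measurable_ustat hg)).aemeasurable]
  have h : ∀ n : ℕ, ∫⁻ ω, ustat f (n, ω) * ustat g (n, ω)
      ∂(Measure.infinitePi fun _ : ℕ => μ) =
      ∑ p ∈ Finset.univ.filter (IsPattern (ι := ι) (κ := κ)),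
        (n.descFactorial (Fintype.card ι + free p) : ℝ≥0∞) * overlap μ f g p := by
    intro n
    simp_rw [ustat_mk]
    simp_rw [Finset.sum_mul_sum]
    have hm : ∀ (i : ι ↪ Fin n) (j : κ ↪ Fin n), Measurable fun ω : ℕ → X =>
        f (fun a => ω (i a)) * g (fun b => ω (j b)) := fun i j =>
      (measurable_comp_index hf fun a => (i a : ℕ)).mul
        (measurable_comp_index hg fun b => (j b : ℕ))
    rw [lintegral_finsetSum _ fun i _ => Finset.measurable_fun_sum _ fun j _ => hm i j]
    have h1 : ∀ i : ι ↪ Fin n, ∫⁻ ω : ℕ → X, ∑ j : κ ↪ Fin n, f (fun a => ω (i a)) *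
        g (fun b => ω (j b)) ∂(Measure.infinitePi fun _ : ℕ => μ) =
        ∑ j : κ ↪ Fin n, overlap μ f g (pattern i j) := fun i => by
      rw [lintegral_finsetSum _ fun j _ => hm i j]
      refine Finset.sum_congr rfl fun j _ => ?_
      refine (lintegral_mul_eq_overlap μ (Fin.val_injective.comp i.injective)
        (Fin.val_injective.comp j.injective) hf hg).trans ?_
      -- The pattern is the same whether the indices are regarded in `Fin n` or in `ℕ`.
      congr 1
      funext b
      refine Option.ext fun a => ?_
      rw [pattern_eq_some (Fin.val_injective.comp i.injective), pattern_eq_some i.injective]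
      exact Fin.val_inj
    rw [Finset.sum_congr rfl fun i _ => h1 i, ← Finset.sum_product', Finset.univ_product_univ,
      ← Finset.sum_fiberwise_of_maps_to (s := Finset.univ)
        (t := Finset.univ.filter (IsPattern (ι := ι) (κ := κ)))
        (g := fun ij : (ι ↪ Fin n) × (κ ↪ Fin n) => pattern ij.1 ij.2)]
    · refine Finset.sum_congr rfl fun p hp => ?_
      rw [Finset.sum_congr rfl (g := fun _ => overlap μ f g p)
        fun ij hij => by rw [(Finset.mem_filter.1 hij).2], Finset.sum_const, nsmul_eq_mul]
      have h2 := card_pattern (α := Fin n) (Finset.mem_filter.1 hp).2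
      rw [Fintype.card_fin, Nat.card_eq_fintype_card, Fintype.card_subtype] at h2
      rw [h2]
    · exact fun ij _ => Finset.mem_filter.2
        ⟨Finset.mem_univ _, isPattern_pattern ij.1.injective ij.2.injective⟩
  simp_rw [h]
  rw [lintegral_finsetSum _ fun p _ => by fun_prop]
  refine Finset.sum_congr rfl fun p _ => ?_
  rw [lintegral_mul_const _ (by fun_prop), lintegral_descFactorial_poisson]

omit [DecidableEq ι] [DecidableEq κ]

omit [IsProbabilityMeasure μ] in
theorem overlap_none (f : (ι → X) → ℝ≥0∞) {g : (κ → X) → ℝ≥0∞} (hg : Measurable g)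
    (hf : Measurable f) :
    overlap μ f g (fun _ => none) =
      (∫⁻ x, f x ∂(Measure.pi fun _ => μ)) * ∫⁻ y, g y ∂(Measure.pi fun _ => μ) := by
  unfold overlap
  rw [← lintegral_mul_const _ hf]
  refine lintegral_congr fun x => ?_
  rw [← lintegral_const_mul _ hg]
  rfl

/-- A pattern identifies distinct coordinates with distinct points, so the mixed tuple again
consists of independent points with law `μ`. -/
theorem lintegral_lintegral_mix {g : (κ → X) → ℝ≥0∞} (hg : Measurable g) {p : κ → Option ι}
    (hp : IsPattern p) :
    ∫⁻ x, ∫⁻ y, g (mix p x y) ∂(Measure.pi fun _ => μ) ∂(Measure.pi fun _ => μ) =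
      ∫⁻ y, g y ∂(Measure.pi fun _ => μ) := by
  let e : κ → ι ⊕ κ := fun b => (p b).elim (Sum.inr b) Sum.inl
  have he : Function.Injective e := by
    intro b b' h
    cases hb : p b <;> cases hb' : p b' <;> simp [e, hb, hb'] at h
    · exact h
    · exact hp b b' _ hb (h ▸ hb')
  have hm : Measurable fun z : ι ⊕ κ → X => g fun b => z (e b) := measurable_comp_index hg e
  rw [← lintegral_pi_comp_injective μ he hg, lintegral_pi_sum μ hm]
  refine lintegral_congr fun x => lintegral_congr fun y => ?_
  congr 1
  funext b
  unfold mix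
  cases hb : p b <;> simp [e, hb]

/-- Pointwise `ab ≤ a² + b²`, and the mixed tuple has the law of an ordinary one. This supplies
finiteness of all overlap integrals from square integrability of the kernels. -/
theorem overlap_le {f : (ι → X) → ℝ≥0∞} {g : (κ → X) → ℝ≥0∞} (hf : Measurable f)
    (hg : Measurable g) {p : κ → Option ι} (hp : IsPattern p) :
    overlap μ f g p ≤ ∫⁻ x, f x ^ 2 ∂(Measure.pi fun _ => μ) +
      ∫⁻ y, g y ^ 2 ∂(Measure.pi fun _ => μ) := by
  have h1 : ∀ a b : ℝ≥0∞, a * b ≤ a ^ 2 + b ^ 2 := fun a b => by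
    rcases le_total a b with h | h
    · calc a * b ≤ b * b := by gcongr
        _ = b ^ 2 := (sq b).symm
        _ ≤ _ := le_add_self
    · calc a * b ≤ a * a := by gcongr
        _ = a ^ 2 := (sq a).symm
        _ ≤ _ := le_self_add
  have hm : Measurable fun z : (ι → X) × (κ → X) => g (mix p z.1 z.2) ^ 2 :=
    (hg.comp (measurable_mix p)).pow_const 2
  calc overlap μ f g p ≤ ∫⁻ x, ∫⁻ y, f x ^ 2 + g (mix p x y) ^ 2
        ∂(Measure.pi fun _ => μ) ∂(Measure.pi fun _ => μ) :=
        lintegral_mono fun x => lintegral_mono fun y => h1 _ _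
    _ = ∫⁻ x, f x ^ 2 + ∫⁻ y, g (mix p x y) ^ 2
        ∂(Measure.pi fun _ => μ) ∂(Measure.pi fun _ => μ) := by
        refine lintegral_congr fun x => ?_
        rw [lintegral_add_left measurable_const]
        simp
    _ = _ := by
        rw [lintegral_add_left (hf.pow_const 2),
          lintegral_lintegral_mix μ (g := fun y => g y ^ 2) (hg.pow_const 2) hp]

omit [MeasurableSpace X] in
theorem ofReal_ustat {f : (ι → X) → ℝ} (hf : 0 ≤ f) (ω : ℕ × (ℕ → X)) :
    ENNReal.ofReal (ustat f ω) = ustat (fun x => ENNReal.ofReal (f x)) ω :=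
  ENNReal.ofReal_sum_of_nonneg fun _ _ => hf _

omit [MeasurableSpace X] in
theorem ustat_nonneg {f : (ι → X) → ℝ} (hf : 0 ≤ f) (ω : ℕ × (ℕ → X)) : 0 ≤ ustat f ω :=
  Finset.sum_nonneg fun _ _ => hf _

variable [DecidableEq ι] [DecidableEq κ]

theorem memLp_ustat (r : ℝ≥0) {f : (ι → X) → ℝ} (hf : Measurable f) (hf0 : 0 ≤ f)
    (hf2 : ∫⁻ x, ENNReal.ofReal (f x) ^ 2 ∂(Measure.pi fun _ => μ) ≠ ∞) :
    MemLp (ustat f) 2 (sample μ r) := by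
  rw [memLp_two_iff_integrable_sq (measurable_ustat hf).aestronglyMeasurable]
  refine ⟨((measurable_ustat hf).pow_const 2).aestronglyMeasurable, ?_⟩
  rw [hasFiniteIntegral_iff_ofReal (.of_forall fun ω => sq_nonneg _)]
  have h := lintegral_ustat_mul_ustat μ r hf.ennreal_ofReal hf.ennreal_ofReal
  have h1 : ∀ ω, ENNReal.ofReal (ustat f ω ^ 2) =
      ustat (fun x => ENNReal.ofReal (f x)) ω * ustat (fun x => ENNReal.ofReal (f x)) ω := by
    intro ω
    rw [ENNReal.ofReal_pow (ustat_nonneg hf0 ω), ofReal_ustat hf0, sq]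
  simp_rw [h1]
  rw [h, lt_top_iff_ne_top]
  refine ENNReal.sum_ne_top.2 fun p hp => ENNReal.mul_ne_top (by finiteness) ?_
  refine ((overlap_le μ hf.ennreal_ofReal hf.ennreal_ofReal
    (Finset.mem_filter.1 hp).2).trans_lt ?_).ne
  exact ENNReal.add_lt_top.2 ⟨hf2.lt_top, hf2.lt_top⟩

/-- The covariance of two Poisson U-statistics. -/
theorem covariance_ustat (r : ℝ≥0) {f : (ι → X) → ℝ} {g : (κ → X) → ℝ} (hf : Measurable f)
    (hg : Measurable g) (hf0 : 0 ≤ f) (hg0 : 0 ≤ g)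
    (hf2 : ∫⁻ x, ENNReal.ofReal (f x) ^ 2 ∂(Measure.pi fun _ => μ) ≠ ∞)
    (hg2 : ∫⁻ x, ENNReal.ofReal (g x) ^ 2 ∂(Measure.pi fun _ => μ) ≠ ∞) :
    covariance (ustat f) (ustat g) (sample μ r) =
      ∑ p ∈ Finset.univ.filter fun p : κ → Option ι => IsPattern p ∧ p ≠ fun _ => none,
        (r : ℝ) ^ (Fintype.card ι + free p) *
          (overlap μ (fun x => ENNReal.ofReal (f x)) (fun x => ENNReal.ofReal (g x)) p).toReal := by
  classical
  have hmf := hf.ennreal_ofReal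
  have hmg := hg.ennreal_ofReal
  have hfin : ∀ p : κ → Option ι, IsPattern p →
      overlap μ (fun x => ENNReal.ofReal (f x)) (fun x => ENNReal.ofReal (g x)) p ≠ ∞ :=
    fun p hp => ((overlap_le μ hmf hmg hp).trans_lt
      (ENNReal.add_lt_top.2 ⟨hf2.lt_top, hg2.lt_top⟩)).ne
  rw [covariance_eq_sub (memLp_ustat μ r hf hf0 hf2) (memLp_ustat μ r hg hg0 hg2)]
  have h1 : ∫ ω, (ustat f * ustat g) ω ∂(sample μ r) =
      ∑ p ∈ Finset.univ.filter (IsPattern (ι := ι) (κ := κ)),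
        (r : ℝ) ^ (Fintype.card ι + free p) *
          (overlap μ (fun x => ENNReal.ofReal (f x)) (fun x => ENNReal.ofReal (g x)) p).toReal := by
    simp_rw [Pi.mul_apply]
    rw [integral_eq_lintegral_of_nonneg_ae
      (.of_forall fun ω => mul_nonneg (ustat_nonneg hf0 ω) (ustat_nonneg hg0 ω))
      ((measurable_ustat hf).mul (measurable_ustat hg)).aestronglyMeasurable]
    simp_rw [ENNReal.ofReal_mul (ustat_nonneg hf0 _), ofReal_ustat hf0,
      ofReal_ustat hg0]
    rw [lintegral_ustat_mul_ustat μ r hmf hmg, ENNReal.toReal_sum]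
    · simp
    · exact fun p hp => ENNReal.mul_ne_top (by finiteness) (hfin p (Finset.mem_filter.1 hp).2)
  have h2 : ∫ ω, ustat f ω ∂(sample μ r) = (r : ℝ) ^ Fintype.card ι *
      (∫⁻ x, ENNReal.ofReal (f x) ∂(Measure.pi fun _ => μ)).toReal := by
    rw [integral_eq_lintegral_of_nonneg_ae (.of_forall fun ω => ustat_nonneg hf0 ω)
      (measurable_ustat hf).aestronglyMeasurable]
    simp_rw [ofReal_ustat hf0]
    rw [lintegral_ustat μ r hmf]
    simp
  have h3 : ∫ ω, ustat g ω ∂(sample μ r) = (r : ℝ) ^ Fintype.card κ *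
      (∫⁻ x, ENNReal.ofReal (g x) ∂(Measure.pi fun _ => μ)).toReal := by
    rw [integral_eq_lintegral_of_nonneg_ae (.of_forall fun ω => ustat_nonneg hg0 ω)
      (measurable_ustat hg).aestronglyMeasurable]
    simp_rw [ofReal_ustat hg0]
    rw [lintegral_ustat μ r hmg]
    simp
  have h4 : (fun _ => none : κ → Option ι) ∈ Finset.univ.filter (IsPattern (ι := ι) (κ := κ)) := by
    simp [IsPattern]
  -- The empty pattern contributes exactly the product of the two means, so subtracting that product
  -- removes this one term.
  rw [h1, h2, h3, ← Finset.add_sum_erase _ _ h4, overlap_none μ _ hmg hmf, ENNReal.toReal_mul]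
  have h5 : free (fun _ => none : κ → Option ι) = Fintype.card κ := by simp [free]
  rw [h5, pow_add]
  have h6 : (Finset.univ.filter fun p : κ → Option ι => IsPattern p ∧ p ≠ fun _ => none) =
      (Finset.univ.filter (IsPattern (ι := ι) (κ := κ))).erase fun _ => none := by
    ext p
    simp [and_comm]
  rw [h6]
  ring

end Poisson

/-! ### Reduction to a fixed plane -/

section Segments

variable {d : ℕ}

/-- The set is the image of a closed set of end points and parameters under the projection along the
compact parameter square, and such a projection is a closed map. Measurability of the crossing event
rests on this. -/
theorem isClosed_segment_inter : IsClosed {q : (E d × E d) × (E d × E d) |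
    (segment ℝ q.1.1 q.1.2 ∩ segment ℝ q.2.1 q.2.2).Nonempty} := by
  let K : Set (((E d × E d) × (E d × E d)) × (unitInterval × unitInterval)) :=
    {p | AffineMap.lineMap p.1.1.1 p.1.1.2 (p.2.1 : ℝ) =
      AffineMap.lineMap p.1.2.1 p.1.2.2 (p.2.2 : ℝ)}
  have hK : IsClosed K := by
    refine isClosed_eq ?_ ?_ <;> simp only [AffineMap.lineMap_apply_module] <;> fun_prop
  have h := isClosedMap_fst_of_compactSpace K hK
  convert h using 1
  ext q
  constructor
  · rintro ⟨z, h1, h2⟩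
    rw [segment_eq_image_lineMap] at h1 h2
    obtain ⟨s, hs, rfl⟩ := h1
    obtain ⟨t, ht, h2⟩ := h2
    exact ⟨(q, (⟨s, hs⟩, ⟨t, ht⟩)), h2.symm, rfl⟩
  · rintro ⟨⟨q', s, t⟩, h1, rfl⟩
    refine ⟨AffineMap.lineMap q'.1.1 q'.1.2 (s : ℝ), ?_, ?_⟩
    · rw [segment_eq_image_lineMap]
      exact ⟨s, s.2, rfl⟩
    · rw [segment_eq_image_lineMap]
      exact ⟨t, t.2, h1.symm⟩

/-- The projections of the edges `[x₀,x₁]` and `[x₂,x₃]` under `A` meet. -/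
def Crossing (A : E d →L[ℝ] E d) (δ : ℝ) (x : Fin 4 → E d) : Prop :=
  dist (x 0) (x 1) ≤ δ ∧ dist (x 2) (x 3) ≤ δ ∧
    (segment ℝ (A (x 0)) (A (x 1)) ∩ segment ℝ (A (x 2)) (A (x 3))).Nonempty

theorem image_edge (A : E d →L[ℝ] E d) (δ : ℝ) (u v : E d) :
    A '' edge δ u v = {z | dist u v ≤ δ ∧ z ∈ segment ℝ (A u) (A v)} := by
  have h := image_segment ℝ (A : E d →ₗ[ℝ] E d).toAffineMap u v
  simp only [LinearMap.coe_toAffineMap, ContinuousLinearMap.coe_coe] at h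
  ext z
  simp only [Set.mem_ofPred_eq, ← h]
  constructor
  · rintro ⟨y, ⟨h1, h2⟩, rfl⟩
    exact ⟨h1, y, h2, rfl⟩
  · rintro ⟨h1, y, h2, rfl⟩
    exact ⟨y, ⟨h1, h2⟩, rfl⟩

theorem crossing_iff (A : E d →L[ℝ] E d) (δ : ℝ) (x : Fin 4 → E d) :
    ((A '' edge δ (x 0) (x 1)) ∩ (A '' edge δ (x 2) (x 3))).Nonempty ↔ Crossing A δ x := by
  rw [image_edge, image_edge]
  constructor
  · rintro ⟨z, ⟨h1, h2⟩, h3, h4⟩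
    exact ⟨h1, h3, z, h2, h4⟩
  · rintro ⟨h1, h3, z, h2, h4⟩
    exact ⟨z, ⟨h1, h2⟩, h3, h4⟩

theorem isClosed_crossing (δ : ℝ) :
    IsClosed {q : (E d →L[ℝ] E d) × (Fin 4 → E d) | Crossing q.1 δ q.2} := by
  have h : ∀ i j : Fin 4, IsClosed {q : (E d →L[ℝ] E d) × (Fin 4 → E d) |
      dist (q.2 i) (q.2 j) ≤ δ} := fun i j => isClosed_le (by fun_prop) continuous_const
  refine (h 0 1).inter ((h 2 3).inter ?_)
  exact isClosed_segment_inter.preimage (f := fun q : (E d →L[ℝ] E d) × (Fin 4 → E d) =>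
    ((q.1 (q.2 0), q.1 (q.2 1)), (q.1 (q.2 2), q.1 (q.2 3)))) (by fun_prop)

open Classical in
/-- The indicator function of a crossing. -/
noncomputable def crossInd (δ : ℝ) (L : Plane d) (x : Fin 4 → E d) : ℝ :=
  if Crossing L.proj δ x then 1 else 0

/-- The stress of a pair as a function on `Fin 2 → ℝ^d`. -/
noncomputable def stressKernel (w : E d → E d → ℝ) (L : Plane d) (x : Fin 2 → E d) : ℝ :=
  pairStress w L (x 0) (x 1)

theorem crossingNumber_eq (δ : ℝ) (L : Plane d) (ω : ℕ × (ℕ → E d)) :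
    crossingNumber δ L (vertices ω) = 1 / 8 * ustat (crossInd δ L) ω := by
  classical
  unfold crossingNumber ustat crossInd
  congr 1
  refine Finset.sum_congr rfl fun i _ => ?_
  refine if_congr ?_ rfl rfl
  exact crossing_iff L.proj δ fun a => vertices ω (i a)

theorem stress_eq (w : E d → E d → ℝ) (L : Plane d) (ω : ℕ × (ℕ → E d)) :
    stress w L (vertices ω) = 1 / 2 * ustat (stressKernel w L) ω := rfl

theorem secondCountable_clm : SecondCountableTopology (E d →L[ℝ] E d) :=
  haveI : ProperSpace (E d →L[ℝ] E d) := FiniteDimensional.proper ℝ _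
  inferInstance

theorem measurable_proj : Measurable (Plane.proj (d := d)) := comap_measurable _

theorem measurable_crossInd_joint (δ : ℝ) :
    Measurable fun q : Plane d × (Fin 4 → E d) => crossInd δ q.1 q.2 := by
  classical
  have := secondCountable_clm (d := d)
  have h : Measurable fun q : Plane d × (Fin 4 → E d) => (q.1.proj, q.2) :=
    (measurable_proj.comp measurable_fst).prodMk measurable_snd
  have h1 : MeasurableSet {q : Plane d × (Fin 4 → E d) | Crossing q.1.proj δ q.2} :=
    h (isClosed_crossing δ).measurableSet
  exact Measurable.ite h1 measurable_const measurable_const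

theorem measurable_stressKernel_joint {w : E d → E d → ℝ}
    (hw : Measurable (Function.uncurry w)) :
    Measurable fun q : Plane d × (Fin 2 → E d) => stressKernel w q.1 q.2 := by
  have := secondCountable_clm (d := d)
  have h1 : ∀ i : Fin 2, Measurable fun q : Plane d × (Fin 2 → E d) => q.2 i := fun i =>
    (measurable_pi_apply i).comp measurable_snd
  have h2 : ∀ i : Fin 2, Measurable fun q : Plane d × (Fin 2 → E d) => q.1.proj (q.2 i) := by
    intro i
    have h3 : Measurable fun p : (E d →L[ℝ] E d) × E d => p.1 p.2 :=
      Continuous.measurable (by fun_prop)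
    exact h3.comp ((measurable_proj.comp measurable_fst).prodMk (h1 i))
  exact (hw.comp ((h1 0).prodMk (h1 1))).mul
    ((((h1 0).dist (h1 1)).sub ((h2 0).dist (h2 1))).pow_const 2)

theorem measurable_crossInd (δ : ℝ) (L : Plane d) : Measurable (crossInd δ L) := by
  have h : Measurable fun x : Fin 4 → E d => (L, x) := measurable_prodMk_left
  have h1 := (measurable_crossInd_joint δ).comp h
  rw [Function.comp_def] at h1
  exact h1

theorem measurable_stressKernel {w : E d → E d → ℝ} (hw : Measurable (Function.uncurry w))
    (L : Plane d) : Measurable (stressKernel w L) :=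
  (measurable_stressKernel_joint hw).comp
    (g := fun q : Plane d × (Fin 2 → E d) => stressKernel w q.1 q.2)
    (measurable_prodMk_left (x := L))

theorem measurable_ustat_joint {Y X : Type*} [MeasurableSpace Y] [MeasurableSpace X] {k : ℕ}
    {f : Y → (Fin k → X) → ℝ} (hf : Measurable fun q : Y × (Fin k → X) => f q.1 q.2) :
    Measurable fun q : Y × (ℕ × (ℕ → X)) => ustat (f q.1) q.2 := by
  -- The number of points is moved to the front: it is a countable coordinate, and for a fixed value
  -- the statistic is a finite sum.
  have h : Measurable fun q : ℕ × (Y × (ℕ → X)) => ustat (f q.2.1) (q.1, q.2.2) := by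
    refine measurable_from_prod_countable_right fun n => ?_
    simp_rw [ustat_mk]
    refine Finset.measurable_fun_sum _ fun i _ => ?_
    have h2 : Measurable fun q : Y × (ℕ → X) => (q.1, fun a => q.2 (i a)) :=
      measurable_fst.prodMk (measurable_pi_lambda _ fun a =>
        (measurable_pi_apply _).comp measurable_snd)
    exact hf.comp h2
  have h2 : Measurable fun q : Y × (ℕ × (ℕ → X)) => (q.2.1, (q.1, q.2.2)) := by fun_prop
  have h1 := h.comp h2
  rw [Function.comp_def] at h1
  exact h1

end Segments

/-! ### Rotation invariance: the law does not depend on the plane -/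

section Rotation

variable {d : ℕ}

/-- Matching orthonormal bases gives an isometry between the planes, which extends to an isometry of
the whole finite-dimensional space. -/
theorem exists_isometry_map (L L' : Plane d) :
    ∃ g : E d ≃ₗᵢ[ℝ] E d, L.toSubmodule.map (g.toLinearEquiv : E d →ₗ[ℝ] E d) =
      L'.toSubmodule := by
  let e : L.toSubmodule ≃ₗᵢ[ℝ] L'.toSubmodule :=
    ((stdOrthonormalBasis ℝ L.toSubmodule).reindex (finCongr L.finrank_eq)).repr.trans
      ((stdOrthonormalBasis ℝ L'.toSubmodule).reindex (finCongr L'.finrank_eq)).repr.symm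
  let f : L.toSubmodule →ₗᵢ[ℝ] E d := L'.toSubmodule.subtypeₗᵢ.comp e.toLinearIsometry
  refine ⟨f.extend.toLinearIsometryEquiv rfl, ?_⟩
  ext x
  constructor
  · rintro ⟨y, hy, rfl⟩
    have h : f.extend y = e ⟨y, hy⟩ := f.extend_apply ⟨y, hy⟩
    change f.extend y ∈ _
    rw [h]
    exact (e ⟨y, hy⟩).2
  · intro hx
    refine ⟨e.symm ⟨x, hx⟩, (e.symm ⟨x, hx⟩).2, ?_⟩
    have h : f.extend (e.symm ⟨x, hx⟩) = e (e.symm ⟨x, hx⟩) := f.extend_apply _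
    rw [e.apply_symm_apply] at h
    exact h

theorem proj_map {L L' : Plane d} {g : E d ≃ₗᵢ[ℝ] E d}
    (h : L.toSubmodule.map (g.toLinearEquiv : E d →ₗ[ℝ] E d) = L'.toSubmodule) (x : E d) :
    L'.proj (g x) = g (L.proj x) := by
  have h1 := Submodule.starProjection_map_apply g L.toSubmodule (g x)
  rw [g.symm_apply_apply] at h1
  rw [Plane.proj, Plane.proj, ← h1]
  congr! 2
  exact h.symm

theorem crossInd_map {L L' : Plane d} {g : E d ≃ₗᵢ[ℝ] E d}
    (h : L.toSubmodule.map (g.toLinearEquiv : E d →ₗ[ℝ] E d) = L'.toSubmodule) (δ : ℝ)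
    (x : Fin 4 → E d) : crossInd δ L' (fun a => g (x a)) = crossInd δ L x := by
  classical
  have h1 : ∀ a b : E d, segment ℝ (g a) (g b) = g '' segment ℝ a b := fun a b =>
    (image_segment ℝ (g.toLinearEquiv : E d →ₗ[ℝ] E d).toAffineMap a b).symm
  refine if_congr ?_ rfl rfl
  simp only [Crossing, proj_map h, g.dist_map, h1]
  rw [← Set.image_inter g.injective, Set.image_nonempty]

theorem stressKernel_map {L L' : Plane d} {g : E d ≃ₗᵢ[ℝ] E d}
    (h : L.toSubmodule.map (g.toLinearEquiv : E d →ₗ[ℝ] E d) = L'.toSubmodule)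
    {w : E d → E d → ℝ} (hw : ∀ (g : E d ≃ₗᵢ[ℝ] E d) (u v), w (g u) (g v) = w u v)
    (x : Fin 2 → E d) : stressKernel w L' (fun a => g (x a)) = stressKernel w L x := by
  simp only [stressKernel, pairStress, proj_map h, g.dist_map, hw]

theorem measurePreserving_sample {X : Type*} [MeasurableSpace X] {μ : Measure X}
    [IsProbabilityMeasure μ] {g : X → X} (hg : MeasurePreserving g μ μ) (r : ℝ≥0) :
    MeasurePreserving (fun ω : ℕ × (ℕ → X) => (ω.1, fun i => g (ω.2 i))) (sample μ r)
      (sample μ r) := by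
  have h : MeasurePreserving (fun (ω : ℕ → X) i => g (ω i)) (Measure.infinitePi fun _ => μ)
      (Measure.infinitePi fun _ => μ) := by
    refine ⟨measurable_pi_lambda _ fun i => hg.measurable.comp (measurable_pi_apply i), ?_⟩
    rw [Measure.infinitePi_map_pi (f := fun _ => g) (fun _ => μ) fun _ => hg.measurable, hg.map_eq]
  exact (MeasurePreserving.id (poissonMeasure r)).prod h

/-- The uniform distribution on the ball of volume one. -/
noncomputable abbrev ballMeasure (d : ℕ) : Measure (E d) := volume.restrict (unitVolBall d)

theorem isProbabilityMeasure_ballMeasure (hd : d ≠ 0) : IsProbabilityMeasure (ballMeasure d) :=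
  ⟨by rw [Measure.restrict_apply_univ, volume_unitVolBall d hd]⟩

theorem measurePreserving_ballMeasure (g : E d ≃ₗᵢ[ℝ] E d) :
    MeasurePreserving g (ballMeasure d) (ballMeasure d) := by
  have h := g.measurePreserving.restrict_preimage
    (s := unitVolBall d) Metric.isClosed_closedBall.measurableSet
  have h1 : g ⁻¹' unitVolBall d = unitVolBall d := by
    ext x
    simp [unitVolBall]
  rwa [h1] at h

variable [IsProbabilityMeasure (ballMeasure d)]

/-- An isometry carrying `L` to `L'` preserves the uniform law on the ball, hence the sample, and it
turns both kernels for `L'` into those for `L`. -/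
theorem map_stats_eq (L L' : Plane d) {w : E d → E d → ℝ}
    (hw_meas : Measurable (Function.uncurry w))
    (hw : ∀ (g : E d ≃ₗᵢ[ℝ] E d) (u v), w (g u) (g v) = w u v) (δ : ℝ) (r : ℝ≥0) :
    (sample (ballMeasure d) r).map
      (fun ω => (ustat (crossInd δ L') ω, ustat (stressKernel w L') ω)) =
    (sample (ballMeasure d) r).map
      (fun ω => (ustat (crossInd δ L) ω, ustat (stressKernel w L) ω)) := by
  obtain ⟨g, hg⟩ := exists_isometry_map L L'
  have h1 := measurePreserving_sample (measurePreserving_ballMeasure g) r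
  have hm : Measurable fun ω : ℕ × (ℕ → E d) =>
      (ustat (crossInd δ L') ω, ustat (stressKernel w L') ω) :=
    (measurable_ustat (measurable_crossInd δ L')).prodMk
      (measurable_ustat (measurable_stressKernel hw_meas L'))
  conv_lhs => rw [← h1.map_eq]
  rw [Measure.map_map hm h1.measurable]
  congr 1
  funext ω
  simp only [Function.comp_def, ustat]
  refine Prod.ext (Finset.sum_congr rfl fun i _ => ?_) (Finset.sum_congr rfl fun i _ => ?_)
  · exact crossInd_map hg δ _
  · exact stressKernel_map hg hw _

/-- The joint law of the statistics for a random plane is the one for a fixed plane. -/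
theorem map_stats_prod (L : Plane d) (Q : Measure (Plane d)) [IsProbabilityMeasure Q]
    {w : E d → E d → ℝ} (hw_meas : Measurable (Function.uncurry w))
    (hw : ∀ (g : E d ≃ₗᵢ[ℝ] E d) (u v), w (g u) (g v) = w u v) (δ : ℝ) (r : ℝ≥0) :
    (Q.prod (sample (ballMeasure d) r)).map
      (fun ω => (ustat (crossInd δ ω.1) ω.2, ustat (stressKernel w ω.1) ω.2)) =
    (sample (ballMeasure d) r).map
      (fun ω => (ustat (crossInd δ L) ω, ustat (stressKernel w L) ω)) := by
  have hm : Measurable fun ω : Plane d × (ℕ × (ℕ → E d)) =>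
      (ustat (crossInd δ ω.1) ω.2, ustat (stressKernel w ω.1) ω.2) :=
    (measurable_ustat_joint (measurable_crossInd_joint δ)).prodMk
      (measurable_ustat_joint (measurable_stressKernel_joint hw_meas))
  have hm' : ∀ L : Plane d, Measurable fun ω : ℕ × (ℕ → E d) =>
      (ustat (crossInd δ L) ω, ustat (stressKernel w L) ω) := fun L =>
    (measurable_ustat (measurable_crossInd δ L)).prodMk
      (measurable_ustat (measurable_stressKernel hw_meas L))
  ext s hs
  rw [Measure.map_apply hm hs, Measure.prod_apply (hm hs)]
  have h : ∀ L' : Plane d, sample (ballMeasure d) r (Prod.mk L' ⁻¹'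
      ((fun ω : Plane d × (ℕ × (ℕ → E d)) =>
        (ustat (crossInd δ ω.1) ω.2, ustat (stressKernel w ω.1) ω.2)) ⁻¹' s)) =
      (sample (ballMeasure d) r).map
      (fun ω => (ustat (crossInd δ L) ω, ustat (stressKernel w L) ω)) s := fun L' => by
    rw [← map_stats_eq L L' hw_meas hw, Measure.map_apply (hm' L') hs]
    rfl
  simp_rw [h]
  simp

end Rotation

/-! ### Correlation and square integrability depend only on the joint law -/

theorem corr_map {Ω : Type*} [MeasurableSpace Ω] {P : Measure Ω} {X Y : Ω → ℝ}
    (hX : Measurable X) (hY : Measurable Y) :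
    corr X Y P = corr Prod.fst Prod.snd (P.map fun ω => (X ω, Y ω)) := by
  have hXY : AEMeasurable (fun ω => (X ω, Y ω)) P := (hX.prodMk hY).aemeasurable
  unfold corr
  rw [covariance_map measurable_fst.aestronglyMeasurable measurable_snd.aestronglyMeasurable hXY,
    variance_map measurable_fst.aemeasurable hXY, variance_map measurable_snd.aemeasurable hXY]
  rfl

theorem memLp_of_map_eq {Ω Ω' Y : Type*} [MeasurableSpace Ω] [MeasurableSpace Ω']
    [MeasurableSpace Y] {P : Measure Ω} {P' : Measure Ω'} {Z : Ω → Y} {Z' : Ω' → Y}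
    (hZ : Measurable Z) (hZ' : Measurable Z') (h : P.map Z = P'.map Z') {F : Y → ℝ}
    (hF : Measurable F) (hm : MemLp (F ∘ Z') 2 P') : MemLp (F ∘ Z) 2 P := by
  rw [← memLp_map_measure_iff hF.aestronglyMeasurable hZ.aemeasurable, h,
    memLp_map_measure_iff hF.aestronglyMeasurable hZ'.aemeasurable]
  exact hm

theorem corr_const_mul {Ω : Type*} [MeasurableSpace Ω] (P : Measure Ω) (X Y : Ω → ℝ) {a b : ℝ}
    (ha : 0 < a) (hb : 0 < b) :
    corr (fun ω => a * X ω) (fun ω => b * Y ω) P = corr X Y P := by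
  unfold corr
  rw [covariance_const_mul_left, covariance_const_mul_right, variance_const_mul,
    variance_const_mul, Real.sqrt_mul (sq_nonneg a), Real.sqrt_mul (sq_nonneg b),
    Real.sqrt_sq ha.le, Real.sqrt_sq hb.le]
  have : a * (b * covariance X Y P) = (a * b) * covariance X Y P := by ring
  rw [this, show a * √(variance X P) * (b * √(variance Y P)) =
    (a * b) * (√(variance X P) * √(variance Y P)) by ring, mul_div_mul_left _ _ (by positivity)]

/-! ### Local coordinates around a crossing -/

section Geometry

variable {d : ℕ} (L : Plane d)

/-- The set of triples whose volume is `crossConst L`. -/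
def crossSet : Set (E d × (L.toSubmodule × E d)) :=
  {p | p.1 ∈ Metric.closedBall 0 1 ∧ p.2.1 ∈ Metric.closedBall 0 2 ∧
      p.2.2 ∈ Metric.closedBall 0 1 ∧
      (segment ℝ 0 (L.proj p.1) ∩
        segment ℝ (p.2.1 : E d) ((p.2.1 : E d) + L.proj p.2.2)).Nonempty}

theorem isClosed_crossSet : IsClosed (crossSet L) := by
  refine (Metric.isClosed_closedBall.preimage continuous_fst).inter
    ((Metric.isClosed_closedBall.preimage (continuous_fst.comp continuous_snd)).inter
    ((Metric.isClosed_closedBall.preimage (continuous_snd.comp continuous_snd)).inter ?_))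
  exact isClosed_segment_inter.preimage (f := fun p : E d × (L.toSubmodule × E d) =>
    (((0 : E d), L.proj p.1), ((p.2.1 : E d), (p.2.1 : E d) + L.proj p.2.2))) (by fun_prop)

theorem norm_proj_le (x : E d) : ‖L.proj x‖ ≤ ‖x‖ :=
  L.toSubmodule.norm_starProjection_apply_le x

theorem proj_coe (y : L.toSubmodule) : L.proj (y : E d) = y :=
  Submodule.starProjection_eq_self_iff.2 y.2

theorem proj_orth (u : L.toSubmoduleᗮ) : L.proj (u : E d) = 0 :=
  (Submodule.starProjection_apply_eq_zero_iff _).2 u.2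

theorem proj_proj (x : E d) : L.proj (L.proj x) = L.proj x :=
  Submodule.starProjection_eq_self_iff.2 (L.toSubmodule.starProjection_apply_mem x)

theorem norm_le_one_of_mem_segment {x z : E d} (hx : ‖x‖ ≤ 1) (hz : z ∈ segment ℝ 0 x) :
    ‖z‖ ≤ 1 := by
  have h : segment ℝ 0 x ⊆ Metric.closedBall 0 1 :=
    (convex_closedBall _ _).segment_subset (by simp) (by simpa using hx)
  simpa using h hz

/-- A common point `p` satisfies `‖p‖ ≤ 1` and `‖p - y‖ ≤ 1`. Hence the restriction of `y` to the
disc of radius two in `crossSet` excludes no crossing. -/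
theorem norm_le_two_of_segment_inter {x z : E d} {y : E d} (hx : ‖x‖ ≤ 1) (hz : ‖z‖ ≤ 1)
    (h : (segment ℝ 0 x ∩ segment ℝ y (y + z)).Nonempty) : ‖y‖ ≤ 2 := by
  obtain ⟨p, hp, hq⟩ := h
  have h1 := norm_le_one_of_mem_segment hx hp
  have h2 : p - y ∈ segment ℝ 0 z := by
    have h3 := (mem_segment_translate ℝ y (x := p - y) (b := 0) (c := z)).1
    rw [← mem_segment_translate ℝ y]
    simpa using hq
  have h3 := norm_le_one_of_mem_segment hz h2
  calc ‖y‖ = ‖p - (p - y)‖ := by rw [sub_sub_cancel]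
    _ ≤ ‖p‖ + ‖p - y‖ := norm_sub_le _ _
    _ ≤ 2 := by linarith

/-- After projection the fibre coordinate `u` disappears, and both segments are images of the
rescaled ones under a single injective similarity, which preserves the property of meeting. -/
theorem crossing_local {δ : ℝ} (hδ : 0 < δ) (v x z : E d) (y : L.toSubmodule)
    (u : L.toSubmoduleᗮ) :
    Crossing L.proj δ ![v, v + δ • x, L.proj v + δ • (y : E d) + u,
      L.proj v + δ • (y : E d) + u + δ • z] ↔ (x, (y, z)) ∈ crossSet L := by
  have h1 : ∀ a b : E d, dist a (a + δ • b) ≤ δ ↔ ‖b‖ ≤ 1 := by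
    intro a b
    rw [dist_self_add_right, norm_smul, Real.norm_of_nonneg hδ.le]
    exact mul_le_iff_le_one_right hδ
  let T : E d →ᵃ[ℝ] E d := AffineMap.homothety (0 : E d) δ + AffineMap.const ℝ (E d) (L.proj v)
  have hT : ∀ a, T a = δ • a + L.proj v := by
    intro a
    simp [T, AffineMap.homothety_apply]
  have hinj : Function.Injective T := by
    intro a b hab
    rw [hT, hT] at hab
    exact smul_right_injective _ hδ.ne' (add_right_cancel hab)
  have h2 : L.proj v = T 0 := by simp [hT]
  have h3 : L.proj (v + δ • x) = T (L.proj x) := by simp [hT, add_comm]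
  have h4 : L.proj (L.proj v + δ • (y : E d) + u) = T y := by
    simp [hT, proj_proj, proj_coe, proj_orth, add_comm]
  have h5 : L.proj (L.proj v + δ • (y : E d) + u + δ • z) = T (y + L.proj z) := by
    rw [map_add, h4, hT, hT]
    simp only [map_smul, smul_add]
    abel
  have h6 : (segment ℝ (L.proj v) (L.proj (v + δ • x)) ∩
      segment ℝ (L.proj (L.proj v + δ • (y : E d) + u))
        (L.proj (L.proj v + δ • (y : E d) + u + δ • z))).Nonempty ↔
      (segment ℝ 0 (L.proj x) ∩ segment ℝ (y : E d) ((y : E d) + L.proj z)).Nonempty := by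
    rw [h5, h4, h3, h2, ← image_segment, ← image_segment, ← Set.image_inter hinj,
      Set.image_nonempty]
  simp only [Crossing, Matrix.cons_val_zero, Matrix.cons_val_one, Matrix.cons_val, h1]
  rw [h6]
  simp only [crossSet, Set.mem_ofPred_eq, mem_closedBall_zero_iff]
  constructor
  · rintro ⟨hx, hz, h⟩
    exact ⟨hx, norm_le_two_of_segment_inter ((norm_proj_le L x).trans hx)
      ((norm_proj_le L z).trans hz) h, hz, h⟩
  · rintro ⟨hx, -, hz, h⟩
    exact ⟨hx, hz, h⟩

theorem lintegral_eq_add_smul {V : Type*} [NormedAddCommGroup V] [InnerProductSpace ℝ V]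
    [FiniteDimensional ℝ V] [MeasurableSpace V] [BorelSpace V] {δ : ℝ} (hδ : 0 < δ) (c : V)
    (Ψ : V → ℝ≥0∞) :
    ∫⁻ b, Ψ b = ENNReal.ofReal (δ ^ Module.finrank ℝ V) * ∫⁻ z, Ψ (c + δ • z) := by
  have he : MeasurableEmbedding (fun z : V => δ • z) :=
    (Homeomorph.smulOfNeZero δ hδ.ne').measurableEmbedding
  have h1 : ∫⁻ z, Ψ (c + δ • z) = ∫⁻ z, Ψ (c + z) ∂(Measure.map (δ • ·) (volume : Measure V)) := by
    rw [he.lintegral_map]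
  rw [h1, Measure.map_addHaar_smul _ hδ.ne', lintegral_smul_measure, lintegral_add_left_eq_self,
    smul_eq_mul, ← mul_assoc, ← ENNReal.ofReal_mul (by positivity), abs_of_pos (by positivity),
    mul_inv_cancel₀ (by positivity), ENNReal.ofReal_one, one_mul]

theorem lintegral_eq_plane {Ψ : E d → ℝ≥0∞} (hΨ : Measurable Ψ) :
    ∫⁻ a, Ψ a = ∫⁻ y : L.toSubmodule, ∫⁻ u : L.toSubmoduleᗮ, Ψ (y + u) := by
  have h : MeasurePreserving (fun q : L.toSubmodule × L.toSubmoduleᗮ => (q.1 : E d) + q.2)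
      volume volume := by
    have h1 := (WithLp.volume_preserving_toLp L.toSubmodule L.toSubmoduleᗮ)
    exact L.toSubmodule.orthogonalDecomposition.symm.measurePreserving.comp h1
  rw [← h.lintegral_comp hΨ, Measure.volume_eq_prod, lintegral_prod]
  exact (hΨ.comp h.measurable).aemeasurable

/-- Only the two directions of the plane are rescaled, whence `δ ^ 2`. The fibre keeps its full size
because a crossing does not see it; it is the source of the section volumes. -/
theorem lintegral_eq_local {δ : ℝ} (hδ : 0 < δ) (v : E d) {Ψ : E d → ℝ≥0∞} (hΨ : Measurable Ψ) :
    ∫⁻ a, Ψ a = ENNReal.ofReal (δ ^ 2) *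
      ∫⁻ y : L.toSubmodule, ∫⁻ u : L.toSubmoduleᗮ, Ψ (L.proj v + δ • (y : E d) + u) := by
  rw [lintegral_eq_plane L hΨ, lintegral_eq_add_smul hδ
    (⟨L.proj v, L.toSubmodule.starProjection_apply_mem v⟩ : L.toSubmodule), L.finrank_eq]
  rfl

/-- The radius of the ball of volume one. -/
noncomputable def rad (d : ℕ) : ℝ := (kappa d)⁻¹ ^ ((d : ℝ)⁻¹)

theorem unitVolBall_eq : unitVolBall d = Metric.closedBall 0 (rad d) := rfl

theorem rad_pos : 0 < rad d := Real.rpow_pos_of_pos (inv_pos.2 (kappa_pos d)) _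

theorem measurableSet_unitVolBall : MeasurableSet (unitVolBall d) :=
  Metric.isClosed_closedBall.measurableSet

/-- The indicator function of the ball of volume one. -/
noncomputable def ballInd (x : E d) : ℝ≥0∞ := (unitVolBall d).indicator 1 x

theorem measurable_ballInd : Measurable (ballInd (d := d)) :=
  measurable_one.indicator measurableSet_unitVolBall

theorem ballInd_le_one (x : E d) : ballInd x ≤ 1 :=
  Set.indicator_le_self' (fun _ _ => zero_le) x

theorem tendsto_ballInd {α : Type*} {l : Filter α} {f : α → E d} {x : E d}
    (h : Tendsto f l (𝓝 x)) (hx : ‖x‖ ≠ rad d) :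
    Tendsto (fun a => ballInd (f a)) l (𝓝 (ballInd x)) := by
  have hn := h.norm
  rcases hx.lt_or_gt with h1 | h1
  · refine tendsto_const_nhds.congr' ?_
    filter_upwards [hn.eventually_lt_const h1] with a ha
    rw [ballInd, ballInd, Set.indicator_of_mem, Set.indicator_of_mem]
    · rfl
    · simpa [unitVolBall_eq] using ha.le
    · simpa [unitVolBall_eq] using h1.le
  · refine tendsto_const_nhds.congr' ?_
    filter_upwards [hn.eventually_const_lt h1] with a ha
    rw [ballInd, ballInd, Set.indicator_of_notMem, Set.indicator_of_notMem]
    · simpa [unitVolBall_eq] using ha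
    · simpa [unitVolBall_eq] using h1

/-- The volume of a section of the ball, as an extended nonnegative number. -/
noncomputable def secVol (v : E d) : ℝ≥0∞ := ∫⁻ u : L.toSubmoduleᗮ, ballInd (L.proj v + (u : E d))

/-- The volume of the section through a point near `v`, restricted to those points which remain in
the ball after a small displacement. -/
noncomputable def localSec (δ : ℝ) (v : E d) (p : L.toSubmodule × E d) : ℝ≥0∞ :=
  ∫⁻ u : L.toSubmoduleᗮ, ballInd (L.proj v + δ • (p.1 : E d) + (u : E d)) *
    ballInd (L.proj v + δ • (p.1 : E d) + (u : E d) + δ • p.2)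

/-- An upper bound for the volume of sections. -/
noncomputable def maxSec : ℝ≥0∞ := volume (Metric.closedBall (0 : L.toSubmoduleᗮ) (rad d))

theorem maxSec_ne_top : maxSec L ≠ ∞ := measure_closedBall_lt_top.ne

theorem norm_add_orth_sq {a : E d} (ha : a ∈ L.toSubmodule) (u : L.toSubmoduleᗮ) :
    ‖a + (u : E d)‖ ^ 2 = ‖a‖ ^ 2 + ‖(u : E d)‖ ^ 2 := by
  have h := norm_add_sq_eq_norm_sq_add_norm_sq_of_inner_eq_zero a (u : E d)
    (Submodule.inner_right_of_mem_orthogonal ha u.2)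
  simpa only [← sq] using h

theorem ballInd_add_orth_le {a : E d} (ha : a ∈ L.toSubmodule) (u : L.toSubmoduleᗮ) :
    ballInd (a + (u : E d)) ≤ (Metric.closedBall (0 : L.toSubmoduleᗮ) (rad d)).indicator 1 u := by
  by_cases h : a + (u : E d) ∈ unitVolBall d
  · have h1 : u ∈ Metric.closedBall (0 : L.toSubmoduleᗮ) (rad d) := by
      rw [unitVolBall_eq, mem_closedBall_zero_iff] at h
      rw [mem_closedBall_zero_iff]
      have h2 := norm_add_orth_sq L ha u
      have h3 : ‖(u : E d)‖ ≤ ‖a + (u : E d)‖ :=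
        abs_le_of_sq_le_sq' (by nlinarith [sq_nonneg ‖a‖]) (norm_nonneg _) |>.2
      exact h3.trans h
    rw [Set.indicator_of_mem h1]
    exact ballInd_le_one _
  · rw [ballInd, Set.indicator_of_notMem h]
    exact zero_le

theorem proj_mem (v : E d) : L.proj v ∈ L.toSubmodule :=
  L.toSubmodule.starProjection_apply_mem v

theorem lintegral_maxSec : ∫⁻ u : L.toSubmoduleᗮ,
    (Metric.closedBall (0 : L.toSubmoduleᗮ) (rad d)).indicator 1 u = maxSec L :=
  lintegral_indicator_one Metric.isClosed_closedBall.measurableSet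

theorem localSec_le (δ : ℝ) (v : E d) (p : L.toSubmodule × E d) : localSec L δ v p ≤ maxSec L := by
  rw [← lintegral_maxSec, localSec]
  refine lintegral_mono fun u => ?_
  refine (mul_le_of_le_one_right' (ballInd_le_one _)).trans (ballInd_add_orth_le L ?_ u)
  exact L.toSubmodule.add_mem (proj_mem L v) (L.toSubmodule.smul_mem _ p.1.2)

theorem secVol_le (v : E d) : secVol L v ≤ maxSec L := by
  rw [← lintegral_maxSec]
  exact lintegral_mono fun u => ballInd_add_orth_le L (proj_mem L v) u

theorem finrank_orth : Module.finrank ℝ L.toSubmoduleᗮ + 2 = d := by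
  have h := L.toSubmodule.finrank_add_finrank_orthogonal
  rw [L.finrank_eq, finrank_euclideanSpace_fin] at h
  omega

/-- By Pythagoras the exceptional `u` lie on one sphere of the orthogonal complement. For `d ≥ 3`
this space is nontrivial, so even a sphere of radius zero is a null set. -/
theorem ae_norm_add_orth_ne (hd : 3 ≤ d) {a : E d} (ha : a ∈ L.toSubmodule) :
    ∀ᵐ u : L.toSubmoduleᗮ, ‖a + (u : E d)‖ ≠ rad d := by
  have hf := finrank_orth L
  have : Nontrivial L.toSubmoduleᗮ := Module.nontrivial_of_finrank_pos (R := ℝ) (by omega)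
  refine measure_mono_null (fun u hu => ?_)
    (Measure.addHaar_sphere volume (0 : L.toSubmoduleᗮ) (√(rad d ^ 2 - ‖a‖ ^ 2)))
  have hu : ‖a + (u : E d)‖ = rad d := by simpa using hu
  have h := norm_add_orth_sq L ha u
  rw [hu] at h
  rw [mem_sphere_zero_iff_norm, h, add_sub_cancel_left, Real.sqrt_sq (norm_nonneg _)]
  rfl

/-- Both displaced points tend to `L.proj v + u`, and the indicator of the ball is continuous off
the bounding sphere, which almost every `u` avoids. -/
theorem tendsto_localSec (hd : 3 ≤ d) (v : E d) (p : L.toSubmodule × E d) :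
    Tendsto (fun δ => localSec L δ v p) (𝓝[>] 0) (𝓝 (secVol L v)) := by
  unfold localSec secVol
  refine tendsto_lintegral_filter_of_dominated_convergence
    ((Metric.closedBall (0 : L.toSubmoduleᗮ) (rad d)).indicator 1) ?_ ?_ ?_ ?_
  · refine .of_forall fun δ => ?_
    exact (measurable_ballInd.comp (by fun_prop)).mul (measurable_ballInd.comp (by fun_prop))
  · refine .of_forall fun δ => .of_forall fun u => ?_
    refine (mul_le_of_le_one_right' (ballInd_le_one _)).trans (ballInd_add_orth_le L ?_ u)
    exact L.toSubmodule.add_mem (proj_mem L v) (L.toSubmodule.smul_mem _ p.1.2)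
  · rw [lintegral_maxSec]
    exact maxSec_ne_top L
  · filter_upwards [ae_norm_add_orth_ne L hd (proj_mem L v)] with u hu
    have h0 : Tendsto (fun δ : ℝ => δ) (𝓝[>] 0) (𝓝 0) := nhdsWithin_le_nhds
    have h1 : Tendsto (fun δ : ℝ => L.proj v + δ • (p.1 : E d) + (u : E d)) (𝓝[>] 0)
        (𝓝 (L.proj v + (u : E d))) := by
      simpa using ((h0.smul_const (p.1 : E d)).const_add (L.proj v)).add_const (u : E d)
    have h2 : Tendsto (fun δ : ℝ => L.proj v + δ • (p.1 : E d) + (u : E d) + δ • p.2) (𝓝[>] 0)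
        (𝓝 (L.proj v + (u : E d))) := by
      simpa using h1.add (h0.smul_const p.2)
    -- The indicator is idempotent, so the limit can be written as a product of the two limits.
    have h3 : ballInd (L.proj v + (u : E d)) = ballInd (L.proj v + (u : E d)) * ballInd (L.proj v + (u : E d)) := by
      by_cases h : L.proj v + (u : E d) ∈ unitVolBall d <;> simp [ballInd, h]
    rw [h3]
    refine ENNReal.Tendsto.mul (tendsto_ballInd h1 hu) (.inr ?_) (tendsto_ballInd h2 hu) (.inr ?_)
    all_goals exact ((ballInd_le_one _).trans_lt ENNReal.one_lt_top).ne

/-- The indicator function of `crossSet`. -/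
noncomputable def crossKernel (x : E d) (p : L.toSubmodule × E d) : ℝ≥0∞ :=
  (crossSet L).indicator 1 (x, p)

theorem measurable_crossKernel :
    Measurable fun q : E d × (L.toSubmodule × E d) => crossKernel L q.1 q.2 :=
  measurable_one.indicator (isClosed_crossSet L).measurableSet

theorem measurable_localSec (δ : ℝ) :
    Measurable fun q : E d × (L.toSubmodule × E d) => localSec L δ q.1 q.2 := by
  have h : Measurable fun q : (E d × (L.toSubmodule × E d)) × L.toSubmoduleᗮ =>
      ballInd (L.proj q.1.1 + δ • (q.1.2.1 : E d) + (q.2 : E d)) *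
      ballInd (L.proj q.1.1 + δ • (q.1.2.1 : E d) + (q.2 : E d) + δ • q.1.2.2) :=
    (measurable_ballInd.comp (by fun_prop)).mul (measurable_ballInd.comp (by fun_prop))
  exact h.lintegral_prod_right'

theorem measurable_localSec_right (δ : ℝ) (v : E d) : Measurable (localSec L δ v) := by
  have h : Measurable fun p : L.toSubmodule × E d => (v, p) := measurable_prodMk_left
  have h1 := (measurable_localSec L δ).comp h
  rw [Function.comp_def] at h1
  exact h1

theorem measurable_secVol : Measurable (secVol L) := by
  have h : Measurable fun q : E d × L.toSubmoduleᗮ => ballInd (L.proj q.1 + (q.2 : E d)) :=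
    measurable_ballInd.comp (by fun_prop)
  exact h.lintegral_prod_right'

theorem measurable_crossKernel_right (x : E d) : Measurable (crossKernel L x) := by
  have h : Measurable fun p : L.toSubmodule × E d => (x, p) := measurable_prodMk_left
  have h1 := (measurable_crossKernel L).comp h
  rw [Function.comp_def] at h1
  exact h1

omit L in
theorem measurable_comp₂ {α β γ ζ : Type*} [MeasurableSpace α] [MeasurableSpace β]
    [MeasurableSpace γ] [MeasurableSpace ζ] {F : β → γ → ζ}
    (hF : Measurable fun q : β × γ => F q.1 q.2) {f : α → β} {g : α → γ} (hf : Measurable f)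
    (hg : Measurable g) : Measurable fun a => F (f a) (g a) :=
  hF.comp (hf.prodMk hg)

/-- The measure of crossing positions of an edge with displacement `x`. -/
noncomputable def crossProfile (x : E d) : ℝ≥0∞ := ∫⁻ p, crossKernel L x p

/-- The rescaled version of `edgeCross`. -/
noncomputable def localCross (δ : ℝ) (v x : E d) : ℝ≥0∞ :=
  ∫⁻ p, crossKernel L x p * localSec L δ v p

theorem measurable_crossProfile : Measurable (crossProfile L) :=
  (measurable_crossKernel L).lintegral_prod_right'

theorem measurable_localCross (δ : ℝ) :
    Measurable fun q : E d × E d => localCross L δ q.1 q.2 := by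
  have h : Measurable fun q : (E d × E d) × (L.toSubmodule × E d) =>
      crossKernel L q.1.2 q.2 * localSec L δ q.1.1 q.2 :=
    (measurable_comp₂ (measurable_crossKernel L) (by fun_prop) measurable_snd).mul
      (measurable_comp₂ (measurable_localSec L δ) (by fun_prop) measurable_snd)
  exact h.lintegral_prod_right'

/-- An upper bound for `crossProfile`. -/
noncomputable def maxProfile : ℝ≥0∞ :=
  volume (Metric.closedBall (0 : L.toSubmodule) 2) * volume (Metric.closedBall (0 : E d) 1)

theorem maxProfile_ne_top : maxProfile L ≠ ∞ :=
  ENNReal.mul_ne_top measure_closedBall_lt_top.ne measure_closedBall_lt_top.ne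

theorem crossKernel_apply_le (x : E d) (p : L.toSubmodule × E d) : crossKernel L x p ≤
    (Metric.closedBall (0 : L.toSubmodule) 2 ×ˢ Metric.closedBall (0 : E d) 1).indicator 1 p := by
  by_cases h : (x, p) ∈ crossSet L
  · rw [crossKernel, Set.indicator_of_mem h, Set.indicator_of_mem]
    · rfl
    · exact ⟨h.2.1, h.2.2.1⟩
  · rw [crossKernel, Set.indicator_of_notMem h]
    exact zero_le

/-- For any `x`, the crossing forces `y` into the disc of radius two and `z` into the unit ball. The
resulting constant is the one that appears in the final bound. -/
theorem crossProfile_le (x : E d) :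
    crossProfile L x ≤ (Metric.closedBall (0 : E d) 1).indicator (fun _ => maxProfile L) x := by
  by_cases hx : x ∈ Metric.closedBall (0 : E d) 1
  · rw [Set.indicator_of_mem hx]
    refine (lintegral_mono fun p => crossKernel_apply_le L x p).trans ?_
    rw [lintegral_indicator_one (Metric.isClosed_closedBall.measurableSet.prod
      Metric.isClosed_closedBall.measurableSet), Measure.volume_eq_prod, Measure.prod_prod]
    rfl
  · rw [Set.indicator_of_notMem hx]
    have h : ∀ p, crossKernel L x p = 0 := fun p =>
      Set.indicator_of_notMem (fun h => hx h.1) _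
    simp [crossProfile, h]

theorem crossProfile_le_maxProfile (x : E d) : crossProfile L x ≤ maxProfile L :=
  (crossProfile_le L x).trans (Set.indicator_le_self' (fun _ _ => zero_le) x)

theorem localCross_le (δ : ℝ) (v x : E d) :
    localCross L δ v x ≤ crossProfile L x * maxSec L := by
  have hm := measurable_crossKernel_right L x
  unfold crossProfile localCross
  rw [← lintegral_mul_const _ hm]
  exact lintegral_mono fun p => mul_le_mul_right (localSec_le L δ v p) _

theorem crossProfile_ne_top (x : E d) : crossProfile L x ≠ ∞ :=
  ((crossProfile_le_maxProfile L x).trans_lt (maxProfile_ne_top L).lt_top).ne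

/-- In the limit the section through the displaced point no longer depends on the displacement, so
the integral factorises into profile and section volume. -/
theorem tendsto_localCross (hd : 3 ≤ d) (v x : E d) :
    Tendsto (fun δ => localCross L δ v x) (𝓝[>] 0) (𝓝 (crossProfile L x * secVol L v)) := by
  have hm := measurable_crossKernel_right L x
  unfold crossProfile localCross
  rw [← lintegral_mul_const _ hm]
  refine tendsto_lintegral_filter_of_dominated_convergence
    (fun p => crossKernel L x p * maxSec L) ?_ ?_ ?_ ?_
  · exact .of_forall fun δ => hm.mul (measurable_localSec_right L δ v)
  · exact .of_forall fun δ => .of_forall fun p => mul_le_mul_right (localSec_le L δ v p) _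
  · rw [lintegral_mul_const _ hm]
    exact ENNReal.mul_ne_top (crossProfile_ne_top L x) (maxSec_ne_top L)
  · refine .of_forall fun p => ENNReal.Tendsto.const_mul (tendsto_localSec L hd v p) (.inr ?_)
    refine ((crossKernel_apply_le L x p).trans_lt ?_).ne
    exact (Set.indicator_le_self' (fun _ _ => zero_le) p).trans_lt ENNReal.one_lt_top

end Geometry

/-! ### Small-distance limits of the crossing integrals and their orders in `δ` -/

section Limits

variable {d : ℕ} (L : Plane d)

/-- The volume of `crossSet`, as an extended nonnegative number. -/
noncomputable def crossVol : ℝ≥0∞ := ∫⁻ x, crossProfile L x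

/-- The second moment of `crossProfile`. -/
noncomputable def crossSq : ℝ≥0∞ := ∫⁻ x, crossProfile L x ^ 2

theorem crossVol_ne_top : crossVol L ≠ ∞ := by
  refine ((lintegral_mono (crossProfile_le L)).trans_lt ?_).ne
  rw [lintegral_indicator_const Metric.isClosed_closedBall.measurableSet]
  exact ENNReal.mul_lt_top (maxProfile_ne_top L).lt_top measure_closedBall_lt_top

/-- One of the two factors is replaced by its upper bound. This is the only inequality between the
exact limit of the correlation and the stated bound. -/
theorem crossSq_le : crossSq L ≤ maxProfile L * crossVol L := by
  unfold crossSq crossVol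
  rw [← lintegral_const_mul _ (measurable_crossProfile L)]
  refine lintegral_mono fun x => ?_
  rw [sq]
  exact mul_le_mul_left (crossProfile_le_maxProfile L x) _

theorem crossSq_ne_top : crossSq L ≠ ∞ :=
  ((crossSq_le L).trans_lt
    (ENNReal.mul_lt_top (maxProfile_ne_top L).lt_top (crossVol_ne_top L).lt_top)).ne

theorem crossVol_eq_measure : crossVol L = ((volume : Measure (E d)).prod
    ((volume : Measure L.toSubmodule).prod (volume : Measure (E d)))) (crossSet L) := by
  rw [← lintegral_indicator_one (isClosed_crossSet L).measurableSet, lintegral_prod]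
  · rfl
  · exact (measurable_one.indicator (isClosed_crossSet L).measurableSet).aemeasurable

theorem crossVol_toReal : crossConst L = (crossVol L).toReal := by
  rw [crossVol_eq_measure]
  rfl

theorem secVol_ne_top (v : E d) : secVol L v ≠ ∞ :=
  ((secVol_le L v).trans_lt (maxSec_ne_top L).lt_top).ne

/-- The rescaled version of `vertexCross`. -/
noncomputable def localVertex (δ : ℝ) (v : E d) : ℝ≥0∞ :=
  ∫⁻ x, ballInd (v + δ • x) * localCross L δ v x

theorem measurable_localCross_right (δ : ℝ) (v : E d) : Measurable (localCross L δ v) :=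
  measurable_comp₂ (measurable_localCross L δ) measurable_const measurable_id

theorem measurable_localVertex (δ : ℝ) : Measurable (localVertex L δ) := by
  have h : Measurable fun q : E d × E d => ballInd (q.1 + δ • q.2) * localCross L δ q.1 q.2 :=
    (measurable_ballInd.comp (by fun_prop)).mul (measurable_localCross L δ)
  exact h.lintegral_prod_right'

theorem localVertex_le (δ : ℝ) (v : E d) : localVertex L δ v ≤ crossVol L * maxSec L := by
  unfold localVertex crossVol
  rw [← lintegral_mul_const _ (measurable_crossProfile L)]
  exact lintegral_mono fun x =>
    (mul_le_of_le_one_left' (ballInd_le_one _)).trans (localCross_le L δ v x)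

theorem tendsto_ballInd_smul {v : E d} (hv : ‖v‖ < rad d) (x : E d) :
    Tendsto (fun δ : ℝ => ballInd (v + δ • x)) (𝓝[>] 0) (𝓝 1) := by
  have h0 : Tendsto (fun δ : ℝ => δ) (𝓝[>] 0) (𝓝 0) := nhdsWithin_le_nhds
  have h1 : Tendsto (fun δ : ℝ => v + δ • x) (𝓝[>] 0) (𝓝 v) := by
    simpa using (h0.smul_const x).const_add v
  have h2 : ballInd v = 1 := by
    rw [ballInd, Set.indicator_of_mem]
    · rfl
    · simpa [unitVolBall_eq] using hv.le
  rw [← h2]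
  exact tendsto_ballInd h1 hv.ne

/-- From an interior point the second end `v + δ • x` eventually stays in the ball, so its indicator
tends to one and the profile integrates to `crossVol`. -/
theorem tendsto_localVertex (hd : 3 ≤ d) {v : E d} (hv : ‖v‖ < rad d) :
    Tendsto (fun δ => localVertex L δ v) (𝓝[>] 0) (𝓝 (crossVol L * secVol L v)) := by
  unfold localVertex crossVol
  rw [← lintegral_mul_const _ (measurable_crossProfile L)]
  refine tendsto_lintegral_filter_of_dominated_convergence
    (fun x => crossProfile L x * maxSec L) ?_ ?_ ?_ ?_
  · exact .of_forall fun δ => (measurable_ballInd.comp (by fun_prop)).mul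
      (measurable_localCross_right L δ v)
  · exact .of_forall fun δ => .of_forall fun x =>
      (mul_le_of_le_one_left' (ballInd_le_one _)).trans (localCross_le L δ v x)
  · rw [lintegral_mul_const _ (measurable_crossProfile L)]
    exact ENNReal.mul_ne_top (crossVol_ne_top L) (maxSec_ne_top L)
  · refine .of_forall fun x => ?_
    have h := ENNReal.Tendsto.mul (tendsto_ballInd_smul hv x)
      (.inr (ENNReal.mul_ne_top (crossProfile_ne_top L x) (secVol_ne_top L v)))
      (tendsto_localCross L hd v x) (.inr ENNReal.one_ne_top)
    simpa using h

theorem ae_norm_lt_rad : ∀ᵐ v ∂(ballMeasure d), ‖v‖ < rad d := by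
  rw [ae_restrict_iff' measurableSet_unitVolBall]
  have h : ∀ᵐ v : E d, v ∉ Metric.sphere (0 : E d) (rad d) :=
    measure_eq_zero_iff_ae_notMem.1
      (Measure.addHaar_sphere_of_ne_zero volume (0 : E d) (rad_pos (d := d)).ne')
  filter_upwards [h] with v hv hB
  rw [unitVolBall_eq, mem_closedBall_zero_iff] at hB
  rw [mem_sphere_zero_iff_norm] at hv
  exact lt_of_le_of_ne hB hv

theorem tendsto_lintegral_localVertex_sq (hd : 3 ≤ d) [IsProbabilityMeasure (ballMeasure d)] :
    Tendsto (fun δ => ∫⁻ v, localVertex L δ v ^ 2 ∂(ballMeasure d)) (𝓝[>] 0)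
      (𝓝 (crossVol L ^ 2 * ∫⁻ v, secVol L v ^ 2 ∂(ballMeasure d))) := by
  rw [← lintegral_const_mul _ ((measurable_secVol L).pow_const 2)]
  simp_rw [← mul_pow]
  have hc : (crossVol L * maxSec L) ^ 2 ≠ ∞ :=
    ENNReal.pow_ne_top (ENNReal.mul_ne_top (crossVol_ne_top L) (maxSec_ne_top L))
  refine tendsto_lintegral_filter_of_dominated_convergence
    (fun _ => (crossVol L * maxSec L) ^ 2) ?_ ?_ ?_ ?_
  · exact .of_forall fun δ => (measurable_localVertex L δ).pow_const 2
  · exact .of_forall fun δ => .of_forall fun v => pow_le_pow_left' (localVertex_le L δ v) 2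
  · simpa using hc
  · filter_upwards [ae_norm_lt_rad] with v hv
    exact ENNReal.Tendsto.pow (tendsto_localVertex L hd hv)

theorem tendsto_lintegral_localVertex_mul (hd : 3 ≤ d) {γ : E d → ℝ≥0∞} (hγ : Measurable γ)
    (hγi : ∫⁻ v, γ v ∂(ballMeasure d) ≠ ∞) :
    Tendsto (fun δ => ∫⁻ v, localVertex L δ v * γ v ∂(ballMeasure d)) (𝓝[>] 0)
      (𝓝 (crossVol L * ∫⁻ v, secVol L v * γ v ∂(ballMeasure d))) := by
  have hm : Measurable fun v => secVol L v * γ v := (measurable_secVol L).mul hγ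
  rw [← lintegral_const_mul _ hm]
  simp_rw [← mul_assoc]
  have hc : crossVol L * maxSec L ≠ ∞ := ENNReal.mul_ne_top (crossVol_ne_top L) (maxSec_ne_top L)
  refine tendsto_lintegral_filter_of_dominated_convergence
    (fun v => crossVol L * maxSec L * γ v) ?_ ?_ ?_ ?_
  · exact .of_forall fun δ => (measurable_localVertex L δ).mul hγ
  · exact .of_forall fun δ => .of_forall fun v => mul_le_mul_left (localVertex_le L δ v) _
  · rw [lintegral_const_mul _ hγ]
    exact ENNReal.mul_ne_top hc hγi
  · filter_upwards [ae_norm_lt_rad, ae_lt_top hγ hγi] with v hv hv'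
    exact ENNReal.Tendsto.mul_const (tendsto_localVertex L hd hv) (.inr hv'.ne)

/-- Two crossings sharing an edge share its displacement `x`, so the square stays inside the
integral over `x` and produces `crossSq` rather than `crossVol ^ 2`. Dominated convergence is
applied in `x` and then in `v`. -/
theorem tendsto_lintegral_localCross_sq (hd : 3 ≤ d) [IsProbabilityMeasure (ballMeasure d)] :
    Tendsto (fun δ => ∫⁻ v, (∫⁻ x, ballInd (v + δ • x) * localCross L δ v x ^ 2) ∂(ballMeasure d))
      (𝓝[>] 0) (𝓝 (crossSq L * ∫⁻ v, secVol L v ^ 2 ∂(ballMeasure d))) := by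
  rw [← lintegral_const_mul _ ((measurable_secVol L).pow_const 2)]
  have hc : crossSq L * maxSec L ^ 2 ≠ ∞ :=
    ENNReal.mul_ne_top (crossSq_ne_top L) (ENNReal.pow_ne_top (maxSec_ne_top L))
  have hm := (measurable_crossProfile L).pow_const 2
  have hle : ∀ (δ : ℝ) (v x : E d), ballInd (v + δ • x) * localCross L δ v x ^ 2 ≤
      crossProfile L x ^ 2 * maxSec L ^ 2 := fun δ v x => by
    rw [← mul_pow]
    exact (mul_le_of_le_one_left' (ballInd_le_one _)).trans
      (pow_le_pow_left' (localCross_le L δ v x) 2)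
  have hint : ∫⁻ x, crossProfile L x ^ 2 * maxSec L ^ 2 = crossSq L * maxSec L ^ 2 :=
    lintegral_mul_const _ hm
  refine tendsto_lintegral_filter_of_dominated_convergence
    (fun v => crossSq L * maxSec L ^ 2) ?_ ?_ ?_ ?_
  · refine .of_forall fun δ => ?_
    have h : Measurable fun q : E d × E d =>
        ballInd (q.1 + δ • q.2) * localCross L δ q.1 q.2 ^ 2 :=
      (measurable_ballInd.comp (by fun_prop)).mul ((measurable_localCross L δ).pow_const 2)
    exact h.lintegral_prod_right'
  · refine .of_forall fun δ => .of_forall fun v => ?_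
    rw [← hint]
    exact lintegral_mono fun x => hle δ v x
  · simpa using hc
  · filter_upwards [ae_norm_lt_rad] with v hv
    unfold crossSq
    rw [← lintegral_mul_const _ hm]
    refine tendsto_lintegral_filter_of_dominated_convergence
      (fun x => crossProfile L x ^ 2 * maxSec L ^ 2) ?_ ?_ ?_ ?_
    · exact .of_forall fun δ => (measurable_ballInd.comp (by fun_prop)).mul
        ((measurable_localCross_right L δ v).pow_const 2)
    · exact .of_forall fun δ => .of_forall fun x => hle δ v x
    · rwa [hint]
    · refine .of_forall fun x => ?_
      have h := ENNReal.Tendsto.mul (tendsto_ballInd_smul hv x)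
        (.inr (ENNReal.pow_ne_top
          (ENNReal.mul_ne_top (crossProfile_ne_top L x) (secVol_ne_top L v))))
        (ENNReal.Tendsto.pow (n := 2) (tendsto_localCross L hd v x)) (.inr ENNReal.one_ne_top)
      simpa [mul_pow] using h

/-- The indicator of a crossing, with extended nonnegative values. -/
noncomputable def crossFun (δ : ℝ) (x : Fin 4 → E d) : ℝ≥0∞ := ENNReal.ofReal (crossInd δ L x)

theorem measurable_crossFun (δ : ℝ) : Measurable (crossFun L δ) :=
  (measurable_crossInd δ L).ennreal_ofReal

/-- The probability that a given edge is crossed by a random edge. -/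
noncomputable def edgeCross (δ : ℝ) (u v : E d) : ℝ≥0∞ :=
  ∫⁻ a, ∫⁻ b, crossFun L δ ![u, v, a, b] ∂(ballMeasure d) ∂(ballMeasure d)

theorem lintegral_ballMeasure (f : E d → ℝ≥0∞) :
    ∫⁻ a, f a ∂(ballMeasure d) = ∫⁻ a, ballInd a * f a := by
  rw [← lintegral_indicator measurableSet_unitVolBall]
  refine lintegral_congr fun a => ?_
  by_cases h : a ∈ unitVolBall d <;> simp [ballInd, h]

theorem crossFun_local {δ : ℝ} (hδ : 0 < δ) (v x z : E d) (y : L.toSubmodule)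
    (u : L.toSubmoduleᗮ) :
    crossFun L δ ![v, v + δ • x, L.proj v + δ • (y : E d) + (u : E d),
      L.proj v + δ • (y : E d) + (u : E d) + δ • z] = crossKernel L x (y, z) := by
  classical
  unfold crossFun crossInd crossKernel
  rw [Set.indicator_apply]
  simp only [crossing_local L hδ v x z y u]
  split_ifs <;> simp

theorem measurable_crossFun_vec {α : Type*} [MeasurableSpace α] (δ : ℝ) {f₀ f₁ f₂ f₃ : α → E d}
    (h₀ : Measurable f₀) (h₁ : Measurable f₁) (h₂ : Measurable f₂) (h₃ : Measurable f₃) :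
    Measurable fun q => crossFun L δ ![f₀ q, f₁ q, f₂ q, f₃ q] := by
  have h : Measurable fun q => ![f₀ q, f₁ q, f₂ q, f₃ q] := by
    refine measurable_pi_lambda _ fun i => ?_
    fin_cases i
    exacts [h₀, h₁, h₂, h₃]
  have h' := (measurable_crossFun L δ).comp h
  rw [Function.comp_def] at h'
  exact h'

/-- The displacement `z` of the crossing edge costs `δ ^ d` and the planar offset of its first end
costs `δ ^ 2`; the fibre integral is moved inside to form `localSec`. -/
theorem edgeCross_local {δ : ℝ} (hδ : 0 < δ) (v x : E d) :
    edgeCross L δ v (v + δ • x) = ENNReal.ofReal (δ ^ (d + 2)) * localCross L δ v x := by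
  have h1 : ∀ a : E d, ∫⁻ b, crossFun L δ ![v, v + δ • x, a, b] ∂(ballMeasure d) =
      ENNReal.ofReal (δ ^ d) * ∫⁻ z, ballInd (a + δ • z) *
        crossFun L δ ![v, v + δ • x, a, a + δ • z] := fun a => by
    rw [lintegral_ballMeasure, lintegral_eq_add_smul hδ a, finrank_euclideanSpace_fin]
  have hm1 : Measurable fun q : E d × E d => ballInd (q.1 + δ • q.2) *
        crossFun L δ ![v, v + δ • x, q.1, q.1 + δ • q.2] :=
    (measurable_ballInd.comp (by fun_prop)).mul (measurable_crossFun_vec L δ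
      measurable_const measurable_const measurable_fst (by fun_prop))
  have hm2 : Measurable fun a : E d => ∫⁻ z, ballInd (a + δ • z) *
        crossFun L δ ![v, v + δ • x, a, a + δ • z] := hm1.lintegral_prod_right'
  have hm3 : Measurable fun a : E d => ballInd a * ∫⁻ z, ballInd (a + δ • z) *
        crossFun L δ ![v, v + δ • x, a, a + δ • z] := measurable_ballInd.mul hm2
  unfold edgeCross
  simp_rw [h1]
  rw [lintegral_const_mul _ hm2, lintegral_ballMeasure,
    lintegral_eq_local L hδ v hm3, ← mul_assoc,
    ← ENNReal.ofReal_mul (by positivity), ← pow_add]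
  congr 1
  simp_rw [crossFun_local L hδ]
  unfold localCross
  have hm4 : Measurable fun p => crossKernel L x p * localSec L δ v p :=
    (measurable_crossKernel_right L x).mul (measurable_localSec_right L δ v)
  rw [Measure.volume_eq_prod, lintegral_prod _ hm4.aemeasurable]
  refine lintegral_congr fun y => ?_
  have h2 : ∀ u : L.toSubmoduleᗮ, ballInd (L.proj v + δ • (y : E d) + (u : E d)) *
      ∫⁻ z, ballInd (L.proj v + δ • (y : E d) + (u : E d) + δ • z) * crossKernel L x (y, z) =
      ∫⁻ z, crossKernel L x (y, z) * (ballInd (L.proj v + δ • (y : E d) + (u : E d)) *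
        ballInd (L.proj v + δ • (y : E d) + (u : E d) + δ • z)) := fun u => by
    have h3 : Measurable fun z : E d => crossKernel L x (y, z) :=
      (measurable_crossKernel_right L x).comp measurable_prodMk_left
    have h4 : Measurable fun z : E d => ballInd (L.proj v + δ • (y : E d) + (u : E d) + δ • z) *
        crossKernel L x (y, z) := (measurable_ballInd.comp (by fun_prop)).mul h3
    rw [← lintegral_const_mul _ h4]
    exact lintegral_congr fun z => by ring
  simp_rw [h2]
  rw [lintegral_lintegral_swap]
  · refine lintegral_congr fun z => ?_
    unfold localSec
    exact lintegral_const_mul _ ((measurable_ballInd.comp (by fun_prop)).mul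
      (measurable_ballInd.comp (by fun_prop)))
  · have h3 : Measurable fun q : L.toSubmoduleᗮ × E d => crossKernel L x (y, q.2) :=
      (measurable_crossKernel_right L x).comp (measurable_const.prodMk measurable_snd)
    exact (h3.mul ((measurable_ballInd.comp (by fun_prop)).mul
      (measurable_ballInd.comp (by fun_prop)))).aemeasurable

theorem edgeCross_eq {δ : ℝ} (hδ : 0 < δ) (u v : E d) : edgeCross L δ u v =
    ENNReal.ofReal (δ ^ (d + 2)) * localCross L δ u (δ⁻¹ • (v - u)) := by
  rw [← edgeCross_local L hδ, smul_inv_smul₀ hδ.ne', add_sub_cancel]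

theorem edgeCross_le {δ : ℝ} (hδ : 0 < δ) (u v : E d) : edgeCross L δ u v ≤
    ENNReal.ofReal (δ ^ (d + 2)) * (maxProfile L * maxSec L) *
      {q : E d × E d | dist q.1 q.2 ≤ δ}.indicator 1 (u, v) := by
  rw [edgeCross_eq L hδ, mul_assoc]
  refine mul_le_mul_right ((localCross_le L δ _ _).trans ?_) _
  refine (mul_le_mul_left (crossProfile_le L _) _).trans_eq ?_
  have h : δ⁻¹ • (v - u) ∈ Metric.closedBall (0 : E d) 1 ↔
      (u, v) ∈ {q : E d × E d | dist q.1 q.2 ≤ δ} := by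
    rw [mem_closedBall_zero_iff, norm_smul, norm_inv, Real.norm_of_nonneg hδ.le,
      inv_mul_le_one₀ hδ, ← dist_eq_norm, dist_comm]
    rfl
  by_cases hx : (u, v) ∈ {q : E d × E d | dist q.1 q.2 ≤ δ}
  · rw [Set.indicator_of_mem hx, Set.indicator_of_mem (h.2 hx)]
    simp
  · rw [Set.indicator_of_notMem hx, Set.indicator_of_notMem (mt h.1 hx)]
    simp

/-- The probability that a random triple forms a crossing together with a given vertex. -/
noncomputable def vertexCross (δ : ℝ) (v : E d) : ℝ≥0∞ := ∫⁻ b, edgeCross L δ v b ∂(ballMeasure d)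

theorem vertexCross_eq {δ : ℝ} (hδ : 0 < δ) (v : E d) :
    vertexCross L δ v = ENNReal.ofReal (δ ^ (2 * d + 2)) * localVertex L δ v := by
  unfold vertexCross localVertex
  rw [lintegral_ballMeasure, lintegral_eq_add_smul hδ v, finrank_euclideanSpace_fin]
  simp_rw [edgeCross_local L hδ]
  have h : ∀ x, ballInd (v + δ • x) * (ENNReal.ofReal (δ ^ (d + 2)) * localCross L δ v x) =
      ENNReal.ofReal (δ ^ (d + 2)) * (ballInd (v + δ • x) * localCross L δ v x) := fun x => by ring
  simp_rw [h]
  rw [lintegral_const_mul, ← mul_assoc, ← ENNReal.ofReal_mul (by positivity), ← pow_add]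
  · congr 3
    ring
  · exact (measurable_ballInd.comp (by fun_prop)).mul (measurable_localCross_right L δ v)

/-- The exponent is `d` for the shared edge plus `d + 2` for each of the two crossing edges. -/
theorem lintegral_edgeCross_sq {δ : ℝ} (hδ : 0 < δ) :
    ∫⁻ v, ∫⁻ b, edgeCross L δ v b ^ 2 ∂(ballMeasure d) ∂(ballMeasure d) =
      ENNReal.ofReal (δ ^ (3 * d + 4)) *
        ∫⁻ v, (∫⁻ x, ballInd (v + δ • x) * localCross L δ v x ^ 2) ∂(ballMeasure d) := by
  have hm : Measurable fun q : E d × E d =>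
      ballInd (q.1 + δ • q.2) * localCross L δ q.1 q.2 ^ 2 :=
    (measurable_ballInd.comp (by fun_prop)).mul ((measurable_localCross L δ).pow_const 2)
  rw [← lintegral_const_mul _ hm.lintegral_prod_right']
  refine lintegral_congr fun v => ?_
  rw [lintegral_ballMeasure, lintegral_eq_add_smul hδ v, finrank_euclideanSpace_fin]
  simp_rw [edgeCross_local L hδ]
  have h : ∀ x, ballInd (v + δ • x) * (ENNReal.ofReal (δ ^ (d + 2)) * localCross L δ v x) ^ 2 =
      ENNReal.ofReal (δ ^ (2 * d + 4)) * (ballInd (v + δ • x) * localCross L δ v x ^ 2) := by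
    intro x
    rw [mul_pow, ← ENNReal.ofReal_pow (by positivity), ← pow_mul, add_mul, mul_comm d 2]
    ring
  simp_rw [h]
  rw [lintegral_const_mul, ← mul_assoc, ← ENNReal.ofReal_mul (by positivity), ← pow_add]
  · congr 3
    ring
  · exact (measurable_ballInd.comp (by fun_prop)).mul
      ((measurable_localCross_right L δ v).pow_const 2)

theorem measurable_edgeCross (δ : ℝ) : Measurable fun q : E d × E d => edgeCross L δ q.1 q.2 := by
  have h : Measurable fun q : ((E d × E d) × E d) × E d =>
      crossFun L δ ![q.1.1.1, q.1.1.2, q.1.2, q.2] :=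
    measurable_crossFun_vec L δ (by fun_prop) (by fun_prop) (by fun_prop) (by fun_prop)
  unfold edgeCross
  have h1 := h.lintegral_prod_right' (ν := ballMeasure d)
  exact h1.lintegral_prod_right' (ν := ballMeasure d)

theorem measurable_vertexCross (δ : ℝ) : Measurable (vertexCross L δ) :=
  (measurable_edgeCross L δ).lintegral_prod_right'

end Limits

/-! ### Overlap integrals -/

section Overlaps

variable {X : Type*} [MeasurableSpace X] (μ : Measure X) [IsProbabilityMeasure μ]
variable {ι κ : Type*} [Fintype ι] [DecidableEq ι] [Fintype κ] [DecidableEq κ]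

theorem lintegral_pi_update (a : ι) {F : (ι → X) → ℝ≥0∞} (hF : Measurable F) :
    ∫⁻ x, F x ∂(Measure.pi fun _ => μ) =
      ∫⁻ u, ∫⁻ y, F (Function.update y a u) ∂(Measure.pi fun _ => μ) ∂μ := by
  -- The extra variable carries the value at `a`, while the coordinate `y a` of the remaining tuple
  -- becomes a dummy.
  let e : ι → Unit ⊕ ι := fun i => if i = a then Sum.inl () else Sum.inr i
  have he : Function.Injective e := by
    intro i j h
    by_cases hi : i = a <;> by_cases hj : j = a <;> simp [e, hi, hj] at h
    · rw [hi, hj]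
    · exact h
  have hm : Measurable fun z : Unit ⊕ ι → X => F fun i => z (e i) := measurable_comp_index hF e
  rw [← lintegral_pi_comp_injective μ he hF, lintegral_pi_sum μ hm]
  have h1 : MeasurePreserving (fun (u : X) (_ : Unit) => u) μ (Measure.pi fun _ : Unit => μ) :=
    (measurePreserving_piUnique (fun _ : Unit => μ)).symm
  have hm2 : Measurable fun z : (Unit → X) × (ι → X) => F fun i => Sum.elim z.1 z.2 (e i) := by
    refine hF.comp (measurable_pi_lambda _ fun i => ?_)
    by_cases hi : i = a <;> simp [e, hi] <;> fun_prop
  rw [← h1.lintegral_comp hm2.lintegral_prod_right']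
  refine lintegral_congr fun u => lintegral_congr fun y => ?_
  congr 1
  funext i
  by_cases hi : i = a
  · subst hi
    simp [e]
  · simp [e, hi]

omit [Fintype ι] in
theorem measurable_update_joint (a : ι) :
    Measurable fun z : X × (ι → X) => Function.update z.2 a z.1 := by
  refine measurable_pi_lambda _ fun i => ?_
  by_cases hi : i = a
  · subst hi
    simpa using measurable_fst
  · simp only [Function.update_of_ne hi]
    fun_prop

/-- The function `f` with the coordinate `a` fixed and the others integrated out. -/
noncomputable def vert (f : (ι → X) → ℝ≥0∞) (a : ι) (u : X) : ℝ≥0∞ :=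
  ∫⁻ y, f (Function.update y a u) ∂(Measure.pi fun _ => μ)

theorem measurable_vert {f : (ι → X) → ℝ≥0∞} (hf : Measurable f) (a : ι) :
    Measurable (vert μ f a) :=
  Measurable.lintegral_prod_right' (f := fun z : X × (ι → X) => f (Function.update z.2 a z.1))
    (hf.comp (measurable_update_joint a))

theorem lintegral_mul_eval {f : (ι → X) → ℝ≥0∞} (hf : Measurable f) (a : ι) {φ : X → ℝ≥0∞}
    (hφ : Measurable φ) :
    ∫⁻ x, f x * φ (x a) ∂(Measure.pi fun _ => μ) = ∫⁻ u, vert μ f a u * φ u ∂μ := by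
  rw [lintegral_pi_update μ a (F := fun x => f x * φ (x a))
    (hf.mul (hφ.comp (measurable_pi_apply a)))]
  refine lintegral_congr fun u => ?_
  simp only [Function.update_self]
  rw [lintegral_mul_const]
  · rfl
  · exact (hf.comp (measurable_update_joint a)).comp measurable_prodMk_left

/-- The function `f` with the coordinates `a` and `a'` fixed and the others integrated out. -/
noncomputable def pair (f : (ι → X) → ℝ≥0∞) (a a' : ι) (u v : X) : ℝ≥0∞ :=
  ∫⁻ y, f (Function.update (Function.update y a' v) a u) ∂(Measure.pi fun _ => μ)

omit [Fintype ι] in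
theorem measurable_update_update (a a' : ι) :
    Measurable fun z : (X × X) × (ι → X) =>
      Function.update (Function.update z.2 a' z.1.2) a z.1.1 :=
  measurable_comp₂ (F := fun u (y : ι → X) => Function.update y a u) (measurable_update_joint a)
    (by fun_prop) (measurable_comp₂ (F := fun u (y : ι → X) => Function.update y a' u)
      (measurable_update_joint a') (by fun_prop) measurable_snd)

omit [Fintype ι] in
theorem measurable_comp_update_update {f : (ι → X) → ℝ≥0∞} (hf : Measurable f) (a a' : ι)
    (u v : X) : Measurable fun y => f (Function.update (Function.update y a' v) a u) :=
  measurable_comp₂ (F := fun (z : X × X) (y : ι → X) =>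
    f (Function.update (Function.update y a' z.2) a z.1))
    (hf.comp (measurable_update_update a a')) measurable_const measurable_id (f := fun _ => (u, v))

theorem lintegral_pi_update_update (a a' : ι) {F : (ι → X) → ℝ≥0∞}
    (hF : Measurable F) :
    ∫⁻ x, F x ∂(Measure.pi fun _ => μ) = ∫⁻ u, ∫⁻ v, pair μ F a a' u v ∂μ ∂μ := by
  rw [lintegral_pi_update μ a hF]
  refine lintegral_congr fun u => ?_
  exact lintegral_pi_update μ a' (F := fun y => F (Function.update y a u))
    ((hF.comp (measurable_update_joint a)).comp measurable_prodMk_left)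

theorem lintegral_mul_eval_eval {f : (ι → X) → ℝ≥0∞} (hf : Measurable f) {a a' : ι} (ha : a' ≠ a)
    {φ : X → X → ℝ≥0∞} (hφ : Measurable fun q : X × X => φ q.1 q.2) :
    ∫⁻ x, f x * φ (x a) (x a') ∂(Measure.pi fun _ => μ) =
      ∫⁻ u, ∫⁻ v, pair μ f a a' u v * φ u v ∂μ ∂μ := by
  have hφ' : Measurable fun x : ι → X => φ (x a) (x a') :=
    measurable_comp₂ hφ (measurable_pi_apply a) (measurable_pi_apply a')
  rw [lintegral_pi_update_update μ a a' (F := fun x => f x * φ (x a) (x a')) (hf.mul hφ')]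
  refine lintegral_congr fun u => lintegral_congr fun v => ?_
  unfold pair
  simp only [Function.update_self, Function.update_of_ne ha]
  rw [lintegral_mul_const]
  exact measurable_comp_update_update hf a a' u v

/-- Relabelling independent, identically distributed points does not change the integral, so a
symmetry of `f` moves the distinguished coordinate. -/
theorem vert_perm {f : (ι → X) → ℝ≥0∞} (hf : Measurable f) (σ : Equiv.Perm ι)
    (hσ : ∀ x, f (x ∘ σ) = f x) (a : ι) : vert μ f (σ a) = vert μ f a := by
  funext u
  unfold vert
  rw [← lintegral_pi_comp_injective μ σ.injective
    (Φ := fun y => f (Function.update y a u))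
    ((hf.comp (measurable_update_joint a)).comp measurable_prodMk_left)]
  refine lintegral_congr fun y => ?_
  rw [← hσ, Function.update_comp_equiv, σ.symm_apply_apply]
  rfl

theorem pair_perm {f : (ι → X) → ℝ≥0∞} (hf : Measurable f) (σ : Equiv.Perm ι)
    (hσ : ∀ x, f (x ∘ σ) = f x) (a a' : ι) : pair μ f (σ a) (σ a') = pair μ f a a' := by
  funext u v
  unfold pair
  rw [← lintegral_pi_comp_injective μ σ.injective
    (Φ := fun y => f (Function.update (Function.update y a' v) a u))
    (measurable_comp_update_update hf a a' u v)]
  refine lintegral_congr fun y => ?_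
  rw [← hσ, Function.update_comp_equiv, Function.update_comp_equiv, σ.symm_apply_apply,
    σ.symm_apply_apply]
  rfl

omit [IsProbabilityMeasure μ] [DecidableEq ι] [DecidableEq κ] in
theorem overlap_eq_lintegral (f : (ι → X) → ℝ≥0∞) {g : (κ → X) → ℝ≥0∞} (hg : Measurable g)
    (p : κ → Option ι) : overlap μ f g p =
      ∫⁻ x, f x * ∫⁻ y, g (mix p x y) ∂(Measure.pi fun _ => μ) ∂(Measure.pi fun _ => μ) := by
  refine lintegral_congr fun x => ?_
  exact lintegral_const_mul _ ((hg.comp (measurable_mix p)).comp measurable_prodMk_left)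

/-- The pattern in which exactly one point is shared. -/
def onePoint (a : ι) (b : κ) : κ → Option ι := fun i => if i = b then some a else none

theorem overlap_onePoint {f : (ι → X) → ℝ≥0∞} {g : (κ → X) → ℝ≥0∞} (hf : Measurable f)
    (hg : Measurable g) (a : ι) (b : κ) :
    overlap μ f g (onePoint a b) = ∫⁻ u, vert μ f a u * vert μ g b u ∂μ := by
  rw [overlap_eq_lintegral μ f hg, ← lintegral_mul_eval μ hf a (measurable_vert μ hg b)]
  refine lintegral_congr fun x => ?_
  congr 1
  refine lintegral_congr fun y => ?_
  congr 1
  funext i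
  by_cases hi : i = b
  · subst hi
    simp [mix, onePoint]
  · simp [mix, onePoint, hi]

/-- The coordinate `b` is a leaf: it occurs only as the second argument of `N`. Integrating it first
costs a factor of at most `r`. -/
theorem lintegral_mul_le_of_update {N : X → X → ℝ≥0∞} (hN : Measurable fun q : X × X => N q.1 q.2)
    {r : ℝ≥0∞} (hr : ∀ c, ∫⁻ v, N c v ∂μ ≤ r) (b : ι) {φ : (ι → X) → X} (hφm : Measurable φ)
    (hφ : ∀ x v, φ (Function.update x b v) = φ x) {F : (ι → X) → ℝ≥0∞} (hFm : Measurable F)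
    (hF : ∀ x v, F (Function.update x b v) = F x) :
    ∫⁻ x, N (φ x) (x b) * F x ∂(Measure.pi fun _ => μ) ≤
      r * ∫⁻ x, F x ∂(Measure.pi fun _ => μ) := by
  have hm : Measurable fun x : ι → X => N (φ x) (x b) * F x :=
    (measurable_comp₂ hN hφm (measurable_pi_apply b)).mul hFm
  rw [lintegral_pi_update μ b hm]
  simp only [Function.update_self, hφ, hF]
  rw [lintegral_lintegral_swap, ← lintegral_const_mul _ hFm]
  · refine lintegral_mono fun x => ?_
    have hm2 : Measurable fun v => N (φ x) v := measurable_comp₂ hN measurable_const measurable_id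
    rw [lintegral_mul_const _ hm2]
    exact mul_le_mul_left (hr _) _
  · have hm3 : Measurable fun q : X × (ι → X) => N (φ q.2) q.1 :=
      measurable_comp₂ hN (hφm.comp measurable_snd) measurable_fst
    exact (hm3.mul (hFm.comp measurable_snd)).aemeasurable

end Overlaps

/-! ### Two overlapping crossings: estimates and classification of patterns -/

section FourPoints

variable {X : Type*} [MeasurableSpace X] (μ : Measure X) [IsProbabilityMeasure μ]

/-- The Klein four-group acting on `Fin 4`. -/
def klein (a : Fin 4) : Equiv.Perm (Fin 4) where
  -- With the edges `{0, 1}` and `{2, 3}`, bitwise xor is convenient: `a ^^^ 1` is the other end of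
  -- the edge of `a`, and `a ^^^ 2`, `a ^^^ 3` are the ends of the other edge.
  toFun i := i ^^^ a
  invFun i := i ^^^ a
  left_inv i := by revert i a; decide
  right_inv i := by revert i a; decide

/-- The pattern in which exactly one edge is shared. -/
def oneEdge (a b : Fin 4) : Fin 4 → Option (Fin 4) :=
  fun i => if i = b then some a else if i = b ^^^ 1 then some (a ^^^ 1) else none

/-- A function of two edges `{x₀,x₁}` and `{x₂,x₃}` which vanishes unless the end points of the
edges are close to each other in the sense of the kernel `N`. -/
structure IsEdgeFun (f : (Fin 4 → X) → ℝ≥0∞) (N : X → X → ℝ≥0∞) (r : ℝ≥0∞) : Prop where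
  measurable : Measurable f
  measurable_kernel : Measurable fun q : X × X => N q.1 q.2
  klein : ∀ a x, f (x ∘ klein a) = f x
  symm : ∀ u v, N u v = N v u
  le_one : ∀ u v, N u v ≤ 1
  le : ∀ x, f x ≤ N (x 0) (x 1) * N (x 2) (x 3)
  bound : ∀ c, ∫⁻ v, N c v ∂μ ≤ r

variable {μ} {f : (Fin 4 → X) → ℝ≥0∞} {N : X → X → ℝ≥0∞} {r : ℝ≥0∞}

namespace IsEdgeFun

section Pointwise

omit [IsProbabilityMeasure μ]

theorem apply_le (h : IsEdgeFun μ f N r) (x : Fin 4 → X) (a : Fin 4) :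
    f x ≤ N (x a) (x (a ^^^ 1)) * N (x (a ^^^ 2)) (x (a ^^^ 3)) := by
  rw [← h.klein a x]
  refine (h.le _).trans_eq ?_
  fin_cases a <;> rfl

theorem apply_le_left (h : IsEdgeFun μ f N r) (x : Fin 4 → X) (a : Fin 4) :
    f x ≤ N (x a) (x (a ^^^ 1)) :=
  (h.apply_le x a).trans (mul_le_of_le_one_right' (h.le_one _ _))

theorem apply_le_mul (h : IsEdgeFun μ f N r) (x : Fin 4 → X) {a a' : Fin 4} (h1 : a' ≠ a)
    (h2 : a' ≠ a ^^^ 1) :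
    f x ≤ N (x a) (x (a ^^^ 1)) * N (x a') (x (a' ^^^ 1)) := by
  have h3 : ∀ a a' : Fin 4, a' ≠ a → a' ≠ a ^^^ 1 →
      (a' = a ^^^ 2 ∧ a' ^^^ 1 = a ^^^ 3) ∨ (a' = a ^^^ 3 ∧ a' ^^^ 1 = a ^^^ 2) := by decide
  rcases h3 a a' h1 h2 with ⟨h4, h5⟩ | ⟨h4, h5⟩
  · rw [h5, h4]
    exact h.apply_le x a
  · rw [h5, h4, h.symm (x (a ^^^ 3))]
    exact h.apply_le x a

theorem apply_le_one (h : IsEdgeFun μ f N r) (x : Fin 4 → X) : f x ≤ 1 :=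
  (h.apply_le_left x 0).trans (h.le_one _ _)

end Pointwise

variable (h : IsEdgeFun μ f N r)
include h

/-- The Klein group acts transitively on the four positions. -/
theorem vert_eq (a : Fin 4) : vert μ f a = vert μ f 0 := by
  have h1 := vert_perm μ h.measurable (RGG.klein a) (h.klein a) 0
  have h2 : ∀ a, RGG.klein a 0 = a := by decide
  rwa [h2] at h1

theorem pair_eq (a : Fin 4) : pair μ f a (a ^^^ 1) = pair μ f 0 1 := by
  have h1 := pair_perm μ h.measurable (RGG.klein a) (h.klein a) 0 1
  have h2 : ∀ a : Fin 4, RGG.klein a 0 = a ∧ RGG.klein a 1 = a ^^^ 1 := by decide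
  rwa [(h2 a).1, (h2 a).2] at h1

theorem overlap_onePoint_self (a b : Fin 4) :
    overlap μ f f (onePoint a b) = ∫⁻ u, vert μ f 0 u ^ 2 ∂μ := by
  rw [overlap_onePoint μ h.measurable h.measurable, h.vert_eq a, h.vert_eq b]
  simp_rw [sq]

theorem measurable_pair (a a' : Fin 4) : Measurable fun q : X × X => pair μ f a a' q.1 q.2 :=
  Measurable.lintegral_prod_right'
    (f := fun z : (X × X) × (Fin 4 → X) =>
      f (Function.update (Function.update z.2 a' z.1.2) a z.1.1))
    (h.measurable.comp (measurable_update_update a a'))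

theorem lintegral_mix_eq_pair {p : Fin 4 → Option (Fin 4)} {a a' b : Fin 4} (h1 : p b = some a)
    (h2 : p (b ^^^ 1) = some a') (h3 : p (b ^^^ 2) = none) (h4 : p (b ^^^ 3) = none)
    (x : Fin 4 → X) :
    ∫⁻ y, f (mix p x y) ∂(Measure.pi fun _ => μ) = pair μ f 0 1 (x a) (x a') := by
  rw [← h.pair_eq b]
  refine lintegral_congr fun y => ?_
  congr 1
  have h5 : ∀ b i : Fin 4, (i = b) ∨ (i = b ^^^ 1 ∧ i ≠ b) ∨
    ((i = b ^^^ 2 ∨ i = b ^^^ 3) ∧ i ≠ b ^^^ 1 ∧ i ≠ b) := by decide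
  funext i
  rcases h5 b i with rfl | ⟨rfl, hb⟩ | ⟨hi, hb1, hb⟩
  · simp [mix, h1]
  · simp [mix, h2, hb]
  · rw [Function.update_of_ne hb, Function.update_of_ne hb1]
    rcases hi with rfl | rfl
    · simp [mix, h3]
    · simp [mix, h4]

theorem overlap_oneEdge (a b : Fin 4) :
    overlap μ f f (oneEdge a b) = ∫⁻ u, ∫⁻ v, pair μ f 0 1 u v ^ 2 ∂μ ∂μ := by
  have h1 : ∀ b : Fin 4, b ^^^ 1 ≠ b ∧ b ^^^ 2 ≠ b ∧ b ^^^ 3 ≠ b ∧ b ^^^ 2 ≠ b ^^^ 1 ∧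
    b ^^^ 3 ≠ b ^^^ 1 := by decide
  obtain ⟨hb1, hb2, hb3, hb4, hb5⟩ := h1 b
  rw [overlap_eq_lintegral μ f h.measurable]
  have h2 : ∀ x : Fin 4 → X, ∫⁻ y, f (mix (oneEdge a b) x y) ∂(Measure.pi fun _ => μ) =
      pair μ f 0 1 (x a) (x (a ^^^ 1)) :=
    h.lintegral_mix_eq_pair (b := b) (by simp [oneEdge]) (by simp [oneEdge, hb1])
      (by simp [oneEdge, hb2, hb4]) (by simp [oneEdge, hb3, hb5])
  simp_rw [h2]
  rw [lintegral_mul_eval_eval μ h.measurable (h1 a).1 (h.measurable_pair 0 1), h.pair_eq a]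
  simp_rw [sq]

/-- All points are shared, so the second factor is simply bounded by one. -/
theorem overlap_le_of_free_eq_zero (p : Fin 4 → Option (Fin 4)) :
    overlap μ f f p ≤ ∫⁻ x, f x ∂(Measure.pi fun _ => μ) := by
  rw [overlap_eq_lintegral μ f h.measurable]
  refine lintegral_mono fun x => mul_le_of_le_one_right' ?_
  refine (lintegral_mono fun y => h.apply_le_one _).trans ?_
  simp

/-- The free end of a half-shared edge must be near its shared end; this gives one factor `r`. -/
theorem overlap_le_of_free_point {p : Fin 4 → Option (Fin 4)} {a b : Fin 4} (h1 : p b = none)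
    (h2 : p (b ^^^ 1) = some a) :
    overlap μ f f p ≤ r * ∫⁻ x, f x ∂(Measure.pi fun _ => μ) := by
  rw [overlap_eq_lintegral μ f h.measurable, mul_comm, ← lintegral_mul_const _ h.measurable]
  refine lintegral_mono fun x => mul_le_mul_right ?_ _
  calc ∫⁻ y, f (mix p x y) ∂(Measure.pi fun _ => μ)
      ≤ ∫⁻ y : Fin 4 → X, N (x a) (y b) * 1 ∂(Measure.pi fun _ => μ) := by
        refine lintegral_mono fun y => (h.apply_le_left _ b).trans_eq ?_
        rw [mul_one, h.symm]
        simp [mix, h1, h2]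
    _ ≤ r * ∫⁻ _, 1 ∂(Measure.pi fun _ : Fin 4 => μ) :=
        lintegral_mul_le_of_update μ h.measurable_kernel h.bound b (φ := fun _ => x a)
          measurable_const (fun _ _ => rfl) measurable_const (fun _ _ => rfl)
    _ = r := by simp

/-- Both edges of the second crossing are half shared. The two free ends lie on different edges and
are integrated one after the other, each costing `r`. -/
theorem overlap_le_of_free_points {p : Fin 4 → Option (Fin 4)} {a a' b b' : Fin 4} (hb : b' ≠ b)
    (hb1 : b' ≠ b ^^^ 1) (h1 : p b = none) (h2 : p (b ^^^ 1) = some a) (h1' : p b' = none)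
    (h2' : p (b' ^^^ 1) = some a') :
    overlap μ f f p ≤ r ^ 2 * ∫⁻ x, f x ∂(Measure.pi fun _ => μ) := by
  rw [overlap_eq_lintegral μ f h.measurable, mul_comm, ← lintegral_mul_const _ h.measurable]
  refine lintegral_mono fun x => mul_le_mul_right ?_ _
  calc ∫⁻ y, f (mix p x y) ∂(Measure.pi fun _ => μ)
      ≤ ∫⁻ y : Fin 4 → X, N (x a) (y b) * (N (x a') (y b') * 1) ∂(Measure.pi fun _ => μ) := by
        refine lintegral_mono fun y => (h.apply_le_mul _ hb hb1).trans_eq ?_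
        rw [mul_one, h.symm, h.symm (mix p x y b')]
        simp [mix, h1, h2, h1', h2']
    _ ≤ r * ∫⁻ y : Fin 4 → X, N (x a') (y b') * 1 ∂(Measure.pi fun _ : Fin 4 => μ) := by
        refine lintegral_mul_le_of_update μ h.measurable_kernel h.bound b (φ := fun _ => x a)
          (F := fun y => N (x a') (y b') * 1)
          measurable_const (fun _ _ => rfl) ?_ (fun y v => ?_)
        · exact (measurable_comp₂ h.measurable_kernel measurable_const
            (measurable_pi_apply b')).mul measurable_const
        · simp only [Function.update_of_ne hb]
    _ ≤ r * (r * ∫⁻ _, 1 ∂(Measure.pi fun _ : Fin 4 => μ)) := by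
        refine mul_le_mul_right ?_ _
        exact lintegral_mul_le_of_update μ h.measurable_kernel h.bound b' (φ := fun _ => x a')
          measurable_const (fun _ _ => rfl) measurable_const (fun _ _ => rfl)
    _ = r ^ 2 := by simp [sq]

/-- The partners of `a` and `a'` are two different leaves which `φ` does not see, and each is
integrated out for a factor `r`. -/
theorem lintegral_mul_le {a a' : Fin 4} (h1 : a' ≠ a) (h2 : a' ≠ a ^^^ 1)
    {φ : X → X → ℝ≥0∞} (hφ : Measurable fun q : X × X => φ q.1 q.2) :
    ∫⁻ x, f x * φ (x a) (x a') ∂(Measure.pi fun _ => μ) ≤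
      r ^ 2 * ∫⁻ x : Fin 4 → X, φ (x a) (x a') ∂(Measure.pi fun _ => μ) := by
  have h3 : ∀ a a' : Fin 4, a' ≠ a → a' ≠ a ^^^ 1 → a ≠ a ^^^ 1 ∧ a' ≠ a' ^^^ 1 ∧ a ≠ a' ^^^ 1 ∧
      a' ^^^ 1 ≠ a ^^^ 1 := by decide
  obtain ⟨h4, h5, h6, h7⟩ := h3 a a' h1 h2
  have hm := h.measurable_kernel
  calc ∫⁻ x, f x * φ (x a) (x a') ∂(Measure.pi fun _ => μ)
      ≤ ∫⁻ x : Fin 4 → X, N (x a) (x (a ^^^ 1)) * (N (x a') (x (a' ^^^ 1)) * φ (x a) (x a'))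
        ∂(Measure.pi fun _ => μ) := by
        refine lintegral_mono fun x => ?_
        rw [← mul_assoc]
        exact mul_le_mul_left (h.apply_le_mul x h1 h2) _
    _ ≤ r * ∫⁻ x : Fin 4 → X, N (x a') (x (a' ^^^ 1)) * φ (x a) (x a')
        ∂(Measure.pi fun _ => μ) := by
        refine lintegral_mul_le_of_update μ hm h.bound (a ^^^ 1) (φ := fun x => x a)
          (F := fun x => N (x a') (x (a' ^^^ 1)) * φ (x a) (x a'))
          (measurable_pi_apply a) (fun x v => ?_) ?_ (fun x v => ?_)
        · rw [Function.update_of_ne h4]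
        · exact (measurable_comp₂ hm (measurable_pi_apply _) (measurable_pi_apply _)).mul
            (measurable_comp₂ hφ (measurable_pi_apply _) (measurable_pi_apply _))
        · simp only [Function.update_of_ne h4, Function.update_of_ne h2, Function.update_of_ne h7]
    _ ≤ r * (r * ∫⁻ x : Fin 4 → X, φ (x a) (x a') ∂(Measure.pi fun _ => μ)) := by
        refine mul_le_mul_right ?_ _
        refine lintegral_mul_le_of_update μ hm h.bound (a' ^^^ 1) (φ := fun x => x a')
          (F := fun x => φ (x a) (x a'))
          (measurable_pi_apply a') (fun x v => ?_) ?_ (fun x v => ?_)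
        · rw [Function.update_of_ne h5]
        · exact measurable_comp₂ hφ (measurable_pi_apply _) (measurable_pi_apply _)
        · simp only [Function.update_of_ne h5, Function.update_of_ne h6]
    _ = _ := by rw [sq, mul_assoc]

omit h in
theorem lintegral_pi_eval_eval {a a' : Fin 4} (h1 : a' ≠ a)
    {φ : X → X → ℝ≥0∞} (hφ : Measurable fun q : X × X => φ q.1 q.2) :
    ∫⁻ x : Fin 4 → X, φ (x a) (x a') ∂(Measure.pi fun _ => μ) = ∫⁻ u, ∫⁻ v, φ u v ∂μ ∂μ := by
  have h2 := lintegral_mul_eval_eval μ (f := fun _ : Fin 4 → X => 1) measurable_const h1 hφ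
  simpa [pair] using h2

/-- One edge of the second crossing joins ends of the two different edges of the first. The shared
pair and its two partners form a path of three short links, hence `r ^ 3`; the free edge of the
second crossing accounts for `M`. -/
theorem overlap_le_of_two_edges {p : Fin 4 → Option (Fin 4)} {a a' b : Fin 4} (h1 : a' ≠ a)
    (h2 : a' ≠ a ^^^ 1) (hb : p b = some a) (hb1 : p (b ^^^ 1) = some a')
    (hb2 : p (b ^^^ 2) = none) (hb3 : p (b ^^^ 3) = none) {M : ℝ≥0∞}
    (hM : ∀ u v, pair μ f 0 1 u v ≤ M * N u v) :
    overlap μ f f p ≤ M * r ^ 3 := by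
  have hm := h.measurable_kernel
  rw [overlap_eq_lintegral μ f h.measurable]
  simp_rw [h.lintegral_mix_eq_pair hb hb1 hb2 hb3]
  refine (h.lintegral_mul_le h1 h2 (h.measurable_pair 0 1)).trans ?_
  rw [lintegral_pi_eval_eval h1 (h.measurable_pair 0 1)]
  calc r ^ 2 * ∫⁻ u, ∫⁻ v, pair μ f 0 1 u v ∂μ ∂μ ≤ r ^ 2 * ∫⁻ _, M * r ∂μ := by
        refine mul_le_mul_right (lintegral_mono fun u => ?_) _
        refine (lintegral_mono fun v => hM u v).trans ?_
        have hm' : Measurable (N u) := measurable_comp₂ hm measurable_const measurable_id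
        rw [lintegral_const_mul _ hm']
        exact mul_le_mul_right (h.bound u) _
    _ = M * r ^ 3 := by
        simp only [lintegral_const, measure_univ, mul_one]
        ring

end IsEdgeFun

/-! ### Classification of the patterns -/

theorem eq_onePoint {ι κ : Type*} [DecidableEq κ] {p : κ → Option ι} {a : ι} {b : κ}
    (h : p b = some a) (h' : ∀ i, i ≠ b → p i = none) : p = onePoint a b := by
  funext i
  by_cases hi : i = b
  · simp [onePoint, hi, h]
  · simp [onePoint, hi, h' i hi]

/-- The patterns in which exactly one edge is shared. -/
def IsOneEdge (p : Fin 4 → Option (Fin 4)) : Prop := ∃ a b, p = oneEdge a b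

instance : DecidablePred IsOneEdge := fun p => by unfold IsOneEdge; infer_instance

/-- Only the set of free coordinates matters here, so this is a finite check over sixteen Boolean
functions. -/
theorem shape_cases (s : Fin 4 → Bool) : (∀ i, s i = true) ∨
    ((Finset.univ.filter fun b => s b).card = 3 ∧ ∃ b, s b = false ∧ ∀ i, i ≠ b → s i = true) ∨
    ((Finset.univ.filter fun b => s b).card = 2 ∧ ∃ b, s b = false ∧ s (b ^^^ 1) = false ∧
      s (b ^^^ 2) = true ∧ s (b ^^^ 3) = true) ∨
    ((Finset.univ.filter fun b => s b).card = 2 ∧ ∃ b b', b' ≠ b ∧ b' ≠ b ^^^ 1 ∧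
      s b = true ∧ s (b ^^^ 1) = false ∧ s b' = true ∧ s (b' ^^^ 1) = false) ∨
    ((Finset.univ.filter fun b => s b).card = 1 ∧ ∃ b, s b = true ∧ s (b ^^^ 1) = false) ∨
    (Finset.univ.filter fun b => s b).card = 0 := by
  revert s
  decide

theorem isSome_of {ι κ : Type*} {p : κ → Option ι} {b : κ} (h : (p b).isNone = false) :
    ∃ a, p b = some a :=
  Option.isSome_iff_exists.1 (by simpa using h)

theorem isNone_of {ι κ : Type*} {p : κ → Option ι} {b : κ} (h : (p b).isNone = true) :
    p b = none := by simpa using h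

theorem pattern_cases {p : Fin 4 → Option (Fin 4)} (hp : IsPattern p) (h0 : p ≠ fun _ => none) :
    (free p = 3 ∧ ∃ a b, p = onePoint a b) ∨
    (free p = 2 ∧ IsOneEdge p) ∨
    (free p = 2 ∧ ∃ a a' b, a' ≠ a ∧ a' ≠ a ^^^ 1 ∧ p b = some a ∧
      p (b ^^^ 1) = some a' ∧ p (b ^^^ 2) = none ∧ p (b ^^^ 3) = none) ∨
    (free p = 2 ∧ ∃ a a' b b', b' ≠ b ∧ b' ≠ b ^^^ 1 ∧ p b = none ∧
      p (b ^^^ 1) = some a ∧ p b' = none ∧ p (b' ^^^ 1) = some a') ∨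
    (free p = 1 ∧ ∃ a b, p b = none ∧ p (b ^^^ 1) = some a) ∨
    free p = 0 := by
  rcases shape_cases fun b => (p b).isNone with h | ⟨hf, b, hb, h⟩ | ⟨hf, b, h1, h2, h3, h4⟩ |
    ⟨hf, b, b', h1, h2, h3, h4, h5, h6⟩ | ⟨hf, b, h1, h2⟩ | hf
  · exact absurd (funext fun i => isNone_of (h i)) h0
  · obtain ⟨a, ha⟩ := isSome_of hb
    exact .inl ⟨hf, a, b, eq_onePoint ha fun i hi => isNone_of (h i hi)⟩
  · obtain ⟨a, ha⟩ := isSome_of h1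
    obtain ⟨a', ha'⟩ := isSome_of h2
    have h5 : a' ≠ a := by
      rintro rfl
      have h6 : ∀ b : Fin 4, b ≠ b ^^^ 1 := by decide
      exact h6 b (hp _ _ _ ha ha')
    by_cases h6 : a' = a ^^^ 1
    · refine .inr (.inl ⟨hf, a, b, funext fun i => ?_⟩)
      have h7 : ∀ b i : Fin 4, (i = b) ∨ (i = b ^^^ 1 ∧ i ≠ b) ∨
        ((i = b ^^^ 2 ∨ i = b ^^^ 3) ∧ i ≠ b ^^^ 1 ∧ i ≠ b) := by decide
      rcases h7 b i with rfl | ⟨rfl, hb⟩ | ⟨hi, hb1, hb⟩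
      · simp [oneEdge, ha]
      · simp [oneEdge, ha', h6, hb]
      · rcases hi with rfl | rfl
        · simp [oneEdge, hb, hb1, isNone_of h3]
        · simp [oneEdge, hb, hb1, isNone_of h4]
    · exact .inr (.inr (.inl ⟨hf, a, a', b, h5, h6, ha, ha', isNone_of h3, isNone_of h4⟩))
  · obtain ⟨a, ha⟩ := isSome_of h4
    obtain ⟨a', ha'⟩ := isSome_of h6
    exact .inr (.inr (.inr (.inl ⟨hf, a, a', b, b', h1, h2, isNone_of h3, ha, isNone_of h5, ha'⟩)))
  · obtain ⟨a, ha⟩ := isSome_of h2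
    exact .inr (.inr (.inr (.inr (.inl ⟨hf, a, b, isNone_of h1, ha⟩))))
  · exact .inr (.inr (.inr (.inr (.inr hf))))

theorem free_oneEdge : ∀ a b : Fin 4, IsPattern (oneEdge a b) ∧ free (oneEdge a b) = 2 := by
  decide

/-- The sixteen pairs `(a, b)` give each pattern twice, since `oneEdge a b = oneEdge (a ^^^ 1) (b
^^^ 1)`: two choices of edge on each side and two orientations. -/
theorem card_oneEdge : (Finset.univ.filter fun p : Fin 4 → Option (Fin 4) =>
    (IsPattern p ∧ p ≠ fun _ => none) ∧ free p = 2 ∧ IsOneEdge p).card = 8 := by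
  have h : (Finset.univ.filter fun p : Fin 4 → Option (Fin 4) =>
      (IsPattern p ∧ p ≠ fun _ => none) ∧ free p = 2 ∧ IsOneEdge p) =
      Finset.univ.image fun q : Fin 4 × Fin 4 => oneEdge q.1 q.2 := by
    ext p
    simp only [Finset.mem_filter, Finset.mem_univ, true_and, Finset.mem_image, Prod.exists]
    constructor
    · rintro ⟨-, -, a, b, rfl⟩
      exact ⟨a, b, rfl⟩
    · rintro ⟨a, b, rfl⟩
      refine ⟨⟨(free_oneEdge a b).1, fun h => ?_⟩, (free_oneEdge a b).2, a, b, rfl⟩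
      have := congrFun h b
      simp [oneEdge] at this
  rw [h]
  decide

theorem free_onePoint_iff {ι κ : Type*} [Fintype κ] [DecidableEq κ] {p : κ → Option ι} :
    free p + 1 = Fintype.card κ ↔ ∃ a b, p = onePoint a b := by
  have h1 : (Finset.univ.filter fun b => ¬ (p b).isNone).card + free p = Fintype.card κ := by
    rw [free, add_comm, Finset.card_filter_add_card_filter_not, Finset.card_univ]
  have h2 : free p + 1 = Fintype.card κ ↔
      (Finset.univ.filter fun b => ¬ (p b).isNone).card = 1 := by omega
  rw [h2, Finset.card_eq_one]
  constructor
  · rintro ⟨b, hb⟩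
    have h3 : ∀ i, ¬ (p i).isNone ↔ i = b := fun i => by
      have := Finset.ext_iff.1 hb i
      simpa using this
    obtain ⟨a, ha⟩ := isSome_of (p := p) (b := b) (Bool.eq_false_iff.2 ((h3 b).2 rfl))
    exact ⟨a, b, eq_onePoint ha fun i hi => isNone_of (by simpa using mt (h3 i).1 hi)⟩
  · rintro ⟨a, b, rfl⟩
    refine ⟨b, ?_⟩
    ext i
    by_cases hi : i = b <;> simp [onePoint, hi]

theorem isPattern_onePoint {ι κ : Type*} [DecidableEq κ] (a : ι) (b : κ) :
    IsPattern (onePoint a b) ∧ onePoint a b ≠ fun _ => none := by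
  constructor
  · intro i j c hi hj
    by_cases h1 : i = b <;> by_cases h2 : j = b <;> simp [onePoint, h1, h2] at hi hj ⊢
  · intro h
    have := congrFun h b
    simp [onePoint] at this

theorem card_onePoint {ι κ : Type*} [Fintype ι] [Fintype κ] [DecidableEq ι] [DecidableEq κ] :
    (Finset.univ.filter fun p : κ → Option ι =>
      (IsPattern p ∧ p ≠ fun _ => none) ∧ free p + 1 = Fintype.card κ).card =
      Fintype.card ι * Fintype.card κ := by
  have h : (Finset.univ.filter fun p : κ → Option ι =>
      (IsPattern p ∧ p ≠ fun _ => none) ∧ free p + 1 = Fintype.card κ) =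
      Finset.univ.image fun q : ι × κ => onePoint q.1 q.2 := by
    ext p
    simp only [Finset.mem_filter, Finset.mem_univ, true_and, Finset.mem_image, Prod.exists,
      free_onePoint_iff]
    constructor
    · rintro ⟨-, a, b, rfl⟩
      exact ⟨a, b, rfl⟩
    · rintro ⟨a, b, rfl⟩
      exact ⟨isPattern_onePoint a b, a, b, rfl⟩
  rw [h, Finset.card_image_of_injective, Finset.card_univ, Fintype.card_prod]
  rintro ⟨a, b⟩ ⟨a', b'⟩ hab
  have h1 := congrFun hab b
  by_cases hb : b = b'
  · subst hb
    simpa [onePoint] using h1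
  · simp [onePoint, hb] at h1

end FourPoints

/-! ### The constants of the lower bound -/

section Constants

variable {d : ℕ} (L : Plane d)

theorem lintegral_pos_of_ae_pos {X : Type*} [MeasurableSpace X] {μ : Measure X}
    [IsProbabilityMeasure μ] {f : X → ℝ≥0∞} (hf : Measurable f) (h : ∀ᵐ x ∂μ, 0 < f x) :
    0 < ∫⁻ x, f x ∂μ := by
  rw [pos_iff_ne_zero, Ne, lintegral_eq_zero_iff hf]
  intro h0
  obtain ⟨x, hx, hx'⟩ := (h.and h0).exists
  exact hx.ne' hx'

theorem volume_secVol (a : E d) :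
    ∫⁻ u : L.toSubmoduleᗮ, ballInd (a + (u : E d)) =
      volume {u : L.toSubmoduleᗮ | a + (u : E d) ∈ unitVolBall d} := by
  have hm : MeasurableSet {u : L.toSubmoduleᗮ | a + (u : E d) ∈ unitVolBall d} :=
    measurableSet_unitVolBall.preimage (by fun_prop)
  rw [← lintegral_indicator_one hm]
  rfl

/-- Replacing `v` by its projection translates the section by `v - L.proj v`, a vector of the
orthogonal complement, which leaves the volume unchanged. -/
theorem sectionVol_eq (v : E d) : sectionVol (unitVolBall d) L v = (secVol L v).toReal := by
  let a : L.toSubmoduleᗮ := ⟨v - L.proj v, L.toSubmodule.sub_starProjection_mem_orthogonal v⟩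
  unfold sectionVol secVol Measure.real
  have h1 := measure_preimage_add_right (volume : Measure L.toSubmoduleᗮ) a
    {u | L.proj v + (u : E d) ∈ unitVolBall d}
  rw [volume_secVol, ← h1]
  congr 2
  ext u
  have h : L.proj v + ((u : E d) + (v - L.proj v)) = v + u := by abel
  simp [a, h]

theorem secVol_add (y : L.toSubmodule) (u : L.toSubmoduleᗮ) :
    secVol L ((y : E d) + (u : E d)) = secVol L y := by
  unfold secVol
  rw [map_add, proj_orth, add_zero]

/-- The section volume is constant along fibres, and integrating the ball over a fibre gives a third
factor of it. -/
theorem lintegral_secVol_sq :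
    ∫⁻ v, secVol L v ^ 2 ∂(ballMeasure d) = ∫⁻ y : L.toSubmodule, secVol L y ^ 3 := by
  rw [lintegral_ballMeasure]
  have hm : Measurable fun v : E d => ballInd v * secVol L v ^ 2 :=
    measurable_ballInd.mul ((measurable_secVol L).pow_const 2)
  rw [lintegral_eq_plane L hm]
  refine lintegral_congr fun y => ?_
  simp_rw [secVol_add]
  have hm1 : Measurable fun u : L.toSubmoduleᗮ => ballInd ((y : E d) + (u : E d)) :=
    measurable_ballInd.comp (by fun_prop)
  rw [lintegral_mul_const _ hm1]
  have h : ∫⁻ u : L.toSubmoduleᗮ, ballInd ((y : E d) + (u : E d)) = secVol L y := by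
    rw [secVol, proj_coe]
  rw [h]
  ring

theorem secVol_eq_zero {y : L.toSubmodule} (hy : (y : E d) ∉ L.proj '' unitVolBall d) :
    secVol L y = 0 := by
  have h : ∀ u : L.toSubmoduleᗮ, ballInd (L.proj y + (u : E d)) = 0 := fun u => by
    refine Set.indicator_of_notMem (fun hu => hy ⟨_, hu, ?_⟩) _
    rw [map_add, proj_orth, add_zero, proj_proj, proj_coe]
  simp [secVol, h]

theorem I3_eq : I3 (unitVolBall d) L = (∫⁻ v, secVol L v ^ 2 ∂(ballMeasure d)).toReal := by
  unfold I3
  have hS : MeasurableSet {x : L.toSubmodule | (x : E d) ∈ L.proj '' unitVolBall d} := by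
    have h1 : IsCompact (L.proj '' unitVolBall d) :=
      (isCompact_closedBall _ _).image L.proj.continuous
    exact h1.isClosed.measurableSet.preimage measurable_subtype_coe
  have hm : Measurable fun y : L.toSubmodule => secVol L (y : E d) ^ 3 :=
    ((measurable_secVol L).comp measurable_subtype_coe).pow_const 3
  have h : ∀ x : L.toSubmodule, sectionVol (unitVolBall d) L x ^ 3 =
      (secVol L (x : E d) ^ 3).toReal := fun x => by rw [sectionVol_eq, ENNReal.toReal_pow]
  simp_rw [h]
  rw [integral_toReal hm.aemeasurable
    (.of_forall fun x => (ENNReal.pow_ne_top (secVol_ne_top L x)).lt_top), lintegral_secVol_sq]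
  congr 1
  rw [← lintegral_indicator hS]
  refine lintegral_congr fun y => ?_
  by_cases hy : y ∈ {x : L.toSubmodule | (x : E d) ∈ L.proj '' unitVolBall d}
  · rw [Set.indicator_of_mem hy]
  · rw [Set.indicator_of_notMem hy, secVol_eq_zero L hy]
    simp

theorem secVol_pos {v : E d} (hv : ‖v‖ < rad d) : 0 < secVol L v := by
  unfold secVol
  rw [volume_secVol]
  have ho : IsOpen {u : L.toSubmoduleᗮ | ‖L.proj v + (u : E d)‖ < rad d} :=
    isOpen_lt (by fun_prop) continuous_const
  have hne : {u : L.toSubmoduleᗮ | ‖L.proj v + (u : E d)‖ < rad d}.Nonempty :=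
    ⟨0, by simpa using (norm_proj_le L v).trans_lt hv⟩
  refine (ho.measure_pos volume hne).trans_le (measure_mono fun u hu => ?_)
  have hu : ‖L.proj v + (u : E d)‖ < rad d := hu
  simpa [unitVolBall_eq] using hu.le

variable {w : E d → E d → ℝ}

/-- The stress of a pair, with extended nonnegative values. -/
noncomputable def stressFun (w : E d → E d → ℝ) (x : Fin 2 → E d) : ℝ≥0∞ :=
  ENNReal.ofReal (stressKernel w L x)

theorem pairStress_nonneg (hw_pos : ∀ u v, u ≠ v → 0 < w u v) (u v : E d) :
    0 ≤ pairStress w L u v := by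
  unfold pairStress
  rcases eq_or_ne u v with rfl | h
  · simp
  · exact mul_nonneg (hw_pos u v h).le (sq_nonneg _)

theorem pairStress_comm (hw_symm : ∀ u v, w u v = w v u) (u v : E d) :
    pairStress w L u v = pairStress w L v u := by
  simp only [pairStress, hw_symm u v, dist_comm u, dist_comm (L.proj u)]

theorem pairStress_pos (hw_pos : ∀ u v, u ≠ v → 0 < w u v) {u v : E d}
    (h : u - v ∉ L.toSubmodule) : 0 < pairStress w L u v := by
  have h1 : u ≠ v := by
    rintro rfl
    simp at h
  refine mul_pos (hw_pos u v h1) (pow_pos ?_ 2)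
  rw [sub_pos, dist_eq_norm, dist_eq_norm, ← map_sub]
  refine lt_of_le_of_ne (norm_proj_le L _) fun h2 => h ?_
  exact (L.toSubmodule.mem_iff_norm_starProjection _).2 h2

theorem measurable_pairStress (hw_meas : Measurable (Function.uncurry w)) :
    Measurable fun q : E d × E d => pairStress w L q.1 q.2 := by
  have hp : Measurable L.proj := L.proj.measurable
  exact hw_meas.mul (((measurable_fst.dist measurable_snd).sub
    ((hp.comp measurable_fst).dist (hp.comp measurable_snd))).pow_const 2)

/-- The expected stress between a given and a random point. -/
noncomputable def pointStress (w : E d → E d → ℝ) (v : E d) : ℝ≥0∞ :=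
  ∫⁻ v₁, ENNReal.ofReal (pairStress w L v v₁) ∂(ballMeasure d)

theorem measurable_pointStress (hw_meas : Measurable (Function.uncurry w)) :
    Measurable (pointStress L w) :=
  (measurable_pairStress L hw_meas).ennreal_ofReal.lintegral_prod_right'

theorem integral_pairStress (hw_meas : Measurable (Function.uncurry w))
    (hw_pos : ∀ u v, u ≠ v → 0 < w u v) (v : E d) :
    ∫ v₁ in unitVolBall d, pairStress w L v v₁ = (pointStress L w v).toReal := by
  have hm : Measurable fun v₁ => pairStress w L v v₁ :=
    measurable_comp₂ (measurable_pairStress L hw_meas) measurable_const measurable_id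
  rw [integral_eq_lintegral_of_nonneg_ae (.of_forall fun v₁ => pairStress_nonneg L hw_pos v v₁)
    hm.aestronglyMeasurable]
  rfl

theorem S2_eq (hw_meas : Measurable (Function.uncurry w))
    (hw_pos : ∀ u v, u ≠ v → 0 < w u v)
    (hfin : ∫⁻ v, pointStress L w v ^ 2 ∂(ballMeasure d) ≠ ∞) :
    S2 w (unitVolBall d) L = (∫⁻ v, pointStress L w v ^ 2 ∂(ballMeasure d)).toReal := by
  have hm := (measurable_pointStress L hw_meas).pow_const 2
  rw [← integral_toReal hm.aemeasurable (ae_lt_top hm hfin)]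
  unfold S2
  refine integral_congr_ae (.of_forall fun v => ?_)
  simp only [integral_const_mul, integral_mul_const, integral_pairStress L hw_meas hw_pos]
  rw [ENNReal.toReal_pow, sq]

theorem sectionStress_eq (hw_meas : Measurable (Function.uncurry w))
    (hw_pos : ∀ u v, u ≠ v → 0 < w u v)
    (hfin : ∫⁻ v, pointStress L w v ∂(ballMeasure d) ≠ ∞) :
    sectionStress w (unitVolBall d) L =
      (∫⁻ v, secVol L v * pointStress L w v ∂(ballMeasure d)).toReal := by
  have hm1 := measurable_pointStress L hw_meas
  have hm : Measurable fun v => secVol L v * pointStress L w v := (measurable_secVol L).mul hm1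
  rw [← integral_toReal hm.aemeasurable]
  · unfold sectionStress
    refine integral_congr_ae (.of_forall fun v => ?_)
    simp only [integral_const_mul, integral_pairStress L hw_meas hw_pos, sectionVol_eq]
    rw [ENNReal.toReal_mul]
  · filter_upwards [ae_lt_top hm1 hfin] with v hv
    exact ENNReal.mul_lt_top (secVol_ne_top L v).lt_top hv

/-- The stress of a pair can vanish only if the difference lies in `L`, a proper subspace and hence
a null set since `d ≥ 3`. -/
theorem pointStress_pos (hd : 3 ≤ d) (hw_meas : Measurable (Function.uncurry w))
    (hw_pos : ∀ u v, u ≠ v → 0 < w u v) [IsProbabilityMeasure (ballMeasure d)] (v : E d) :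
    0 < pointStress L w v := by
  have hm : Measurable fun v₁ => ENNReal.ofReal (pairStress w L v v₁) :=
    (measurable_comp₂ (measurable_pairStress L hw_meas) measurable_const
      measurable_id).ennreal_ofReal
  refine lintegral_pos_of_ae_pos hm (ae_restrict_of_ae ?_)
  have hL : L.toSubmodule ≠ ⊤ := by
    intro h
    have h1 := L.finrank_eq
    rw [h, finrank_top, finrank_euclideanSpace_fin] at h1
    omega
  have h0 := Measure.addHaar_submodule (volume : Measure (E d)) L.toSubmodule hL
  have hS : MeasurableSet (L.toSubmodule : Set (E d)) :=
    L.toSubmodule.closed_of_finiteDimensional.measurableSet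
  have h2 := (Measure.measurePreserving_sub_left (volume : Measure (E d)) v).measure_preimage
    hS.nullMeasurableSet
  rw [h0] at h2
  filter_upwards [measure_eq_zero_iff_ae_notMem.1 h2] with v₁ h1
  exact ENNReal.ofReal_pos.2 (pairStress_pos L hw_pos h1)

/-- Transversal crossings are stable under small perturbations. This gives `crossSet` positive
volume. -/
theorem exists_isOpen_subset_crossSet :
    ∃ U ⊆ crossSet L, IsOpen U ∧ U.Nonempty := by
  let b := (stdOrthonormalBasis ℝ L.toSubmodule).reindex (finCongr L.finrank_eq)
  let P : E d →L[ℝ] L.toSubmodule := L.toSubmodule.orthogonalProjectionOnto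
  let D : L.toSubmodule → L.toSubmodule → ℝ := fun p q => b.repr p 0 * b.repr q 1 -
    b.repr p 1 * b.repr q 0
  have hD : Continuous fun z : L.toSubmodule × L.toSubmodule => D z.1 z.2 := by
    unfold D
    fun_prop
  have solve : ∀ {y p q : L.toSubmodule} {Δ α β : ℝ}, 0 < Δ → Δ • y = α • p + β • q →
      (α / Δ) • p = y + (-β / Δ) • q := by
    intro y p q Δ α β hΔ h
    refine smul_right_injective _ hΔ.ne' ?_
    simp only [smul_add, h, smul_smul, mul_div_cancel₀ _ hΔ.ne']
    simp
  -- With `p`, `q` the projections of the two displacements, the crossing parameters are `D y q / D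
  -- p q` and `-D p y / D p q`. The last four inequalities say that both lie strictly between 0 and
  -- 1.
  let U : Set (E d × (L.toSubmodule × E d)) := {q | ‖q.1‖ < 1 ∧ ‖q.2.1‖ < 2 ∧ ‖q.2.2‖ < 1 ∧
    0 < D q.2.1 (P q.2.2) ∧ D q.2.1 (P q.2.2) < D (P q.1) (P q.2.2) ∧
    D (P q.1) q.2.1 < 0 ∧ -D (P q.1) (P q.2.2) < D (P q.1) q.2.1}
  have hproj : ∀ x : E d, L.proj x = (P x : E d) := fun x => rfl
  refine ⟨U, ?_, ?_, ?_⟩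
  · rintro ⟨x, y, z⟩ ⟨hx, hy, hz, h1, h2, h3, h4⟩
    simp only at hx hy hz h1 h2 h3 h4
    refine ⟨by simpa using hx.le, by simpa using hy.le, by simpa using hz.le, ?_⟩
    simp only [hproj]
    generalize P x = p at *
    generalize P z = q at *
    have hΔ : 0 < D p q := h1.trans h2
    -- Cramer's rule in the plane, in the orthonormal coordinates of `b`.
    have hc : D p q • y = D y q • p + D p y • q := by
      refine b.repr.injective ?_
      ext i
      simp only [map_smul, map_add, PiLp.smul_apply, PiLp.add_apply, smul_eq_mul, D]
      fin_cases i <;> simp <;> ring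
    have hs := solve hΔ hc
    refine ⟨(((D y q / D p q) • p : L.toSubmodule) : E d), ?_, ?_⟩
    · rw [segment_eq_image']
      exact ⟨D y q / D p q, ⟨by positivity, (div_le_one hΔ).2 h2.le⟩, by simp⟩
    · rw [hs, segment_eq_image']
      exact ⟨-D p y / D p q, ⟨div_nonneg (by linarith) hΔ.le, (div_le_one hΔ).2 (by linarith)⟩,
        by simp⟩
  · have hc : ∀ f g : E d × (L.toSubmodule × E d) → L.toSubmodule, Continuous f → Continuous g →
        Continuous fun q => D (f q) (g q) := fun f g hf hg => hD.comp (hf.prodMk hg)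
    have c1 := hc (fun q => q.2.1) (fun q => P q.2.2) (by fun_prop) (by fun_prop)
    have c2 := hc (fun q => P q.1) (fun q => P q.2.2) (by fun_prop) (by fun_prop)
    have c3 := hc (fun q => P q.1) (fun q => q.2.1) (by fun_prop) (by fun_prop)
    have n1 : Continuous fun q : E d × (L.toSubmodule × E d) => ‖q.1‖ := by fun_prop
    have n2 : Continuous fun q : E d × (L.toSubmodule × E d) => ‖q.2.1‖ := by fun_prop
    have n3 : Continuous fun q : E d × (L.toSubmodule × E d) => ‖q.2.2‖ := by fun_prop
    exact (isOpen_lt n1 continuous_const).inter <| (isOpen_lt n2 continuous_const).inter <|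
      (isOpen_lt n3 continuous_const).inter <|
      (isOpen_lt continuous_const c1).inter <| (isOpen_lt c1 c2).inter <|
      (isOpen_lt c3 continuous_const).inter <| isOpen_lt c2.neg c3
  · have hP : ∀ y : L.toSubmodule, P y = y := fun y =>
      Submodule.orthogonalProjectionOnto_mem_subspace_eq_self y
    have h0 : ‖b 0‖ = 1 := b.orthonormal.norm_eq_one 0
    have h1 : ‖b 1‖ = 1 := b.orthonormal.norm_eq_one 1
    -- Two perpendicular segments of length 1/2 which meet at their common midpoint, one quarter of
    -- `b 0`.
    refine ⟨((((1 / 2 : ℝ) • b 0 : L.toSubmodule) : E d), (1 / 4 : ℝ) • b 0 - (1 / 4 : ℝ) • b 1,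
      (((1 / 2 : ℝ) • b 1 : L.toSubmodule) : E d)), ?_, ?_, ?_, ?_, ?_, ?_, ?_⟩
    · rw [Submodule.norm_coe, norm_smul, h0]
      norm_num
    · refine (norm_sub_le _ _).trans_lt ?_
      rw [norm_smul, norm_smul, h0, h1]
      norm_num
    · rw [Submodule.norm_coe, norm_smul, h1]
      norm_num
    all_goals
      simp only [hP, D, map_sub, map_smul, PiLp.sub_apply, PiLp.smul_apply,
        OrthonormalBasis.repr_self, smul_eq_mul, PiLp.single_apply]
      norm_num

theorem crossVol_pos : 0 < crossVol L := by
  obtain ⟨U, hU, ho, hne⟩ := exists_isOpen_subset_crossSet L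
  rw [crossVol_eq_measure]
  exact (ho.measure_pos _ hne).trans_le (measure_mono hU)

/-- The factor `4 π` is the area of the disc of radius two. -/
theorem maxProfile_eq (hd : 3 ≤ d) : (maxProfile L).toReal = 4 * Real.pi * kappa d := by
  have : Nontrivial L.toSubmodule := Module.nontrivial_of_finrank_pos (R := ℝ)
    (by rw [L.finrank_eq]; norm_num)
  have : Nontrivial (E d) := Module.nontrivial_of_finrank_pos (R := ℝ)
    (by rw [finrank_euclideanSpace_fin]; omega)
  unfold maxProfile
  rw [InnerProductSpace.volume_closedBall_of_dim_even (k := 1) (by rw [L.finrank_eq]),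
    Measure.addHaar_closedBall_eq_addHaar_ball, ENNReal.toReal_mul, ENNReal.toReal_mul,
    L.finrank_eq, ENNReal.toReal_pow, ENNReal.toReal_ofReal (by norm_num),
    ENNReal.toReal_ofReal (by positivity)]
  unfold kappa Measure.real
  norm_num

end Constants

/-! ### The overlap integrals of the crossing indicator -/

section Crossings

variable {d : ℕ} (L : Plane d)

theorem crossing_comp_klein (A : E d →L[ℝ] E d) (δ : ℝ) (a : Fin 4) (x : Fin 4 → E d) :
    Crossing A δ (x ∘ klein a) ↔ Crossing A δ x := by
  fin_cases a
  · exact Iff.rfl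
  · change dist (x 1) (x 0) ≤ δ ∧ dist (x 3) (x 2) ≤ δ ∧
      (segment ℝ (A (x 1)) (A (x 0)) ∩ segment ℝ (A (x 3)) (A (x 2))).Nonempty ↔ _
    rw [dist_comm, dist_comm (x 3), segment_symm, segment_symm ℝ (A (x 3))]
    rfl
  · change dist (x 2) (x 3) ≤ δ ∧ dist (x 0) (x 1) ≤ δ ∧
      (segment ℝ (A (x 2)) (A (x 3)) ∩ segment ℝ (A (x 0)) (A (x 1))).Nonempty ↔ _
    rw [Set.inter_comm, and_left_comm]
    rfl
  · change dist (x 3) (x 2) ≤ δ ∧ dist (x 1) (x 0) ≤ δ ∧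
      (segment ℝ (A (x 3)) (A (x 2)) ∩ segment ℝ (A (x 1)) (A (x 0))).Nonempty ↔ _
    rw [dist_comm, dist_comm (x 1), segment_symm, segment_symm ℝ (A (x 1)), Set.inter_comm,
      and_left_comm]
    rfl

/-- The indicator of the event that two points are close. -/
noncomputable def near (δ : ℝ) (u v : E d) : ℝ≥0∞ :=
  {q : E d × E d | dist q.1 q.2 ≤ δ}.indicator 1 (u, v)

theorem measurable_near (δ : ℝ) : Measurable fun q : E d × E d => near δ q.1 q.2 :=
  measurable_one.indicator (isClosed_le (by fun_prop) continuous_const).measurableSet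

theorem lintegral_near_le (δ : ℝ) (hδ : 0 ≤ δ) (c : E d) :
    ∫⁻ v, near δ c v ∂(ballMeasure d) ≤ ENNReal.ofReal (δ ^ d * kappa d) := by
  have h : ∀ v, near δ c v = (Metric.closedBall c δ).indicator 1 v := fun v => by
    have : (c, v) ∈ {q : E d × E d | dist q.1 q.2 ≤ δ} ↔ v ∈ Metric.closedBall c δ := by
      rw [Metric.mem_closedBall, dist_comm]
      rfl
    by_cases hv : v ∈ Metric.closedBall c δ
    · rw [near, Set.indicator_of_mem hv, Set.indicator_of_mem (this.2 hv)]
      rfl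
    · rw [near, Set.indicator_of_notMem hv, Set.indicator_of_notMem (mt this.1 hv)]
  simp_rw [h]
  rw [lintegral_indicator_one Metric.isClosed_closedBall.measurableSet]
  refine (Measure.restrict_apply_le _ _).trans ?_
  rw [Measure.addHaar_closedBall _ _ hδ, finrank_euclideanSpace_fin,
    ENNReal.ofReal_mul (by positivity), kappa, Measure.real,
    ENNReal.ofReal_toReal measure_ball_lt_top.ne]

variable [IsProbabilityMeasure (ballMeasure d)]

omit [IsProbabilityMeasure (ballMeasure d)] in
theorem isEdgeFun_crossFun {δ : ℝ} (hδ : 0 ≤ δ) : IsEdgeFun (ballMeasure d) (crossFun L δ)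
    (near δ) (ENNReal.ofReal (δ ^ d * kappa d)) where
  measurable := measurable_crossFun L δ
  measurable_kernel := measurable_near δ
  klein a x := by
    classical
    unfold crossFun crossInd
    simp only [crossing_comp_klein]
  symm u v := by
    simp only [near, Set.indicator_apply, Set.mem_ofPred_eq, dist_comm v u, Pi.one_apply]
  le_one u v := by
    simp only [near, Set.indicator_apply]
    split_ifs <;> simp
  le x := by
    classical
    unfold crossFun crossInd
    split_ifs with h
    · have h1 : near δ (x 0) (x 1) = 1 := Set.indicator_of_mem (f := 1) h.1
      have h2 : near δ (x 2) (x 3) = 1 := Set.indicator_of_mem (f := 1) h.2.1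
      rw [h1, h2]
      simp
    · simp
  bound c := lintegral_near_le δ hδ c

theorem pair_crossFun (δ : ℝ) : pair (ballMeasure d) (crossFun L δ) 0 1 = edgeCross L δ := by
  funext u v
  have hF : Measurable fun y => crossFun L δ (Function.update (Function.update y 1 v) 0 u) :=
    measurable_comp_update_update (measurable_crossFun L δ) 0 1 u v
  have h : ∀ (a b : E d) (y : Fin 4 → E d), Function.update (Function.update
      (Function.update (Function.update y 3 b) 2 a) 1 v) 0 u = ![u, v, a, b] := fun a b y => by
    funext i
    fin_cases i <;> simp [Function.update]
  unfold pair
  rw [lintegral_pi_update_update (ballMeasure d) 2 3 hF]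
  unfold pair
  simp only [h, lintegral_const, measure_univ, mul_one]
  rfl

theorem vert_crossFun (δ : ℝ) : vert (ballMeasure d) (crossFun L δ) 0 = vertexCross L δ := by
  funext u
  have hF : Measurable fun y => crossFun L δ (Function.update y 0 u) :=
    (measurable_crossFun L δ).comp ((measurable_update_joint 0).comp measurable_prodMk_left)
  unfold vert vertexCross
  rw [lintegral_pi_update (ballMeasure d) 1 hF, ← pair_crossFun]
  rfl

theorem lintegral_crossFun (δ : ℝ) :
    ∫⁻ x, crossFun L δ x ∂(Measure.pi fun _ => ballMeasure d) =
      ∫⁻ v, vertexCross L δ v ∂(ballMeasure d) := by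
  rw [lintegral_pi_update (ballMeasure d) 0 (measurable_crossFun L δ), ← vert_crossFun]
  rfl

theorem lintegral_crossFun_le {δ : ℝ} (hδ : 0 < δ) :
    ∫⁻ x, crossFun L δ x ∂(Measure.pi fun _ => ballMeasure d) ≤
      ENNReal.ofReal (δ ^ (2 * d + 2)) * (crossVol L * maxSec L) := by
  rw [lintegral_crossFun]
  simp_rw [vertexCross_eq L hδ]
  rw [lintegral_const_mul _ (measurable_localVertex L δ)]
  refine mul_le_mul_right ?_ _
  refine (lintegral_mono fun v => localVertex_le L δ v).trans ?_
  simp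

theorem overlap_crossFun_onePoint {δ : ℝ} (hδ : 0 < δ) (a b : Fin 4) :
    overlap (ballMeasure d) (crossFun L δ) (crossFun L δ) (onePoint a b) =
      ENNReal.ofReal (δ ^ (4 * d + 4)) * ∫⁻ v, localVertex L δ v ^ 2 ∂(ballMeasure d) := by
  rw [(isEdgeFun_crossFun L hδ.le).overlap_onePoint_self, vert_crossFun,
    ← lintegral_const_mul _ ((measurable_localVertex L δ).pow_const 2)]
  refine lintegral_congr fun v => ?_
  rw [vertexCross_eq L hδ, mul_pow, ← ENNReal.ofReal_pow (by positivity), ← pow_mul]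
  congr 3
  ring

theorem overlap_crossFun_oneEdge {δ : ℝ} (hδ : 0 < δ) (a b : Fin 4) :
    overlap (ballMeasure d) (crossFun L δ) (crossFun L δ) (oneEdge a b) =
      ENNReal.ofReal (δ ^ (3 * d + 4)) *
        ∫⁻ v, (∫⁻ x, ballInd (v + δ • x) * localCross L δ v x ^ 2) ∂(ballMeasure d) := by
  rw [(isEdgeFun_crossFun L hδ.le).overlap_oneEdge, pair_crossFun, lintegral_edgeCross_sq L hδ]

/-- A bound for the contribution of the remaining patterns. -/
noncomputable def restBound : ℝ≥0∞ :=
  maxProfile L * maxSec L * ENNReal.ofReal (kappa d ^ 3) +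
    (ENNReal.ofReal (kappa d ^ 2) + ENNReal.ofReal (kappa d) + 1) * (crossVol L * maxSec L)

omit [IsProbabilityMeasure (ballMeasure d)] in
theorem restBound_ne_top : restBound L ≠ ∞ := by
  have h1 := maxProfile_ne_top L
  have h2 := maxSec_ne_top L
  have h3 := crossVol_ne_top L
  unfold restBound
  finiteness

/-- The exponent is chosen so that, divided by `t ^ 7 * δ ^ (4 * d + 4)`, the term is at most a
constant times `(1 / (t * δ ^ d)) ^ (3 - free p) * δ ^ (d - 2)`. -/
theorem overlap_crossFun_rest {δ : ℝ} (hδ : 0 < δ) {p : Fin 4 → Option (Fin 4)}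
    (hp : IsPattern p) (h0 : p ≠ fun _ => none) (h3 : free p ≠ 3)
    (h2 : ¬ (free p = 2 ∧ IsOneEdge p)) :
    free p ≤ 2 ∧ overlap (ballMeasure d) (crossFun L δ) (crossFun L δ) p ≤
      ENNReal.ofReal (δ ^ ((free p + 2) * d + 2)) * restBound L := by
  have h := isEdgeFun_crossFun L hδ.le
  have hk := (kappa_pos d).le
  have hint := lintegral_crossFun_le L hδ
  have hr2 : ENNReal.ofReal (δ ^ d * kappa d) ^ 2 * (ENNReal.ofReal (δ ^ (2 * d + 2)) *
      (crossVol L * maxSec L)) ≤ ENNReal.ofReal (δ ^ ((2 + 2) * d + 2)) * restBound L := by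
    rw [← ENNReal.ofReal_pow (by positivity), ← mul_assoc, ← ENNReal.ofReal_mul (by positivity)]
    have e : (δ ^ d * kappa d) ^ 2 * δ ^ (2 * d + 2) = δ ^ ((2 + 2) * d + 2) * kappa d ^ 2 := by
      ring
    rw [e, ENNReal.ofReal_mul (by positivity), mul_assoc]
    refine mul_le_mul_right ?_ _
    unfold restBound
    refine le_add_left (mul_le_mul_left ?_ _)
    rw [add_assoc]
    exact le_self_add
  rcases pattern_cases hp h0 with ⟨h4, -⟩ | h4 | ⟨h4, a, a', b, h5, h6, h7, h8, h9, h10⟩ |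
    ⟨h4, a, a', b, b', h5, h6, h7, h8, h9, h10⟩ | ⟨h4, a, b, h5, h6⟩ | h4
  · exact absurd h4 h3
  · exact absurd h4 h2
  · refine ⟨h4.le, ?_⟩
    rw [h4]
    have hM : ∀ u v, pair (ballMeasure d) (crossFun L δ) 0 1 u v ≤
        ENNReal.ofReal (δ ^ (d + 2)) * (maxProfile L * maxSec L) * near δ u v := fun u v => by
      rw [pair_crossFun]
      exact edgeCross_le L hδ u v
    refine (h.overlap_le_of_two_edges h5 h6 h7 h8 h9 h10 hM).trans ?_
    have e : δ ^ (d + 2) * (δ ^ d * kappa d) ^ 3 = δ ^ ((2 + 2) * d + 2) * kappa d ^ 3 := by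
      ring
    rw [← ENNReal.ofReal_pow (by positivity), mul_right_comm, ← ENNReal.ofReal_mul (by positivity),
      e, ENNReal.ofReal_mul (by positivity), mul_assoc]
    refine mul_le_mul_right ?_ _
    unfold restBound
    rw [mul_comm (ENNReal.ofReal _) (_ * _)]
    exact le_self_add
  · refine ⟨h4.le, ?_⟩
    rw [h4]
    exact (h.overlap_le_of_free_points h5 h6 h7 h8 h9 h10).trans
      ((mul_le_mul_right hint _).trans hr2)
  · refine ⟨by omega, ?_⟩
    rw [h4]
    refine (h.overlap_le_of_free_point h5 h6).trans ((mul_le_mul_right hint _).trans ?_)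
    rw [← mul_assoc, ← ENNReal.ofReal_mul (by positivity)]
    have e : δ ^ d * kappa d * δ ^ (2 * d + 2) = δ ^ ((1 + 2) * d + 2) * kappa d := by
      ring
    rw [e, ENNReal.ofReal_mul (by positivity), mul_assoc]
    refine mul_le_mul_right ?_ _
    unfold restBound
    refine le_add_left (mul_le_mul_left ?_ _)
    rw [add_comm (ENNReal.ofReal _), add_assoc]
    exact le_self_add
  · refine ⟨by omega, ?_⟩
    rw [h4, zero_add]
    refine (h.overlap_le_of_free_eq_zero p).trans (hint.trans ?_)
    refine mul_le_mul_right ?_ _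
    unfold restBound
    refine le_add_left (le_mul_of_one_le_left' ?_)
    exact le_add_self

end Crossings

/-! ### The overlap integrals of the stress -/

section Stresses

variable {d : ℕ} (L : Plane d) {w : E d → E d → ℝ}

theorem measurable_stressFun (hw_meas : Measurable (Function.uncurry w)) :
    Measurable (stressFun L w) := (measurable_stressKernel hw_meas L).ennreal_ofReal

theorem measurable_ofReal_pairStress (hw_meas : Measurable (Function.uncurry w)) :
    Measurable fun q : E d × E d => ENNReal.ofReal (pairStress w L q.1 q.2) :=
  (measurable_pairStress L hw_meas).ennreal_ofReal

theorem lintegral_pi_two {X : Type*} [MeasurableSpace X] (μ : Measure X) [IsProbabilityMeasure μ]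
    {φ : X → X → ℝ≥0∞} (hφ : Measurable fun q : X × X => φ q.1 q.2) :
    ∫⁻ x : Fin 2 → X, φ (x 0) (x 1) ∂(Measure.pi fun _ => μ) = ∫⁻ u, ∫⁻ v, φ u v ∂μ ∂μ := by
  have h2 := lintegral_mul_eval_eval μ (f := fun _ : Fin 2 → X => 1) measurable_const
    (a := 0) (a' := 1) (by decide) hφ
  simpa [pair] using h2

variable [IsProbabilityMeasure (ballMeasure d)]

theorem lintegral_stressFun_sq_ne_top (hw_meas : Measurable (Function.uncurry w))
    (hw_sq : IntegrableOn (fun p : E d × E d => pairStress w L p.1 p.2 ^ 2)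
      (unitVolBall d ×ˢ unitVolBall d)) :
    ∫⁻ x, stressFun L w x ^ 2 ∂(Measure.pi fun _ => ballMeasure d) ≠ ∞ := by
  have hm := (measurable_ofReal_pairStress L hw_meas).pow_const 2
  have h1 := lintegral_pi_two (ballMeasure d)
    (φ := fun u v => ENNReal.ofReal (pairStress w L u v) ^ 2) hm
  have h2 := hw_sq.lintegral_lt_top
  rw [Measure.volume_eq_prod, ← Measure.prod_restrict, lintegral_prod _
    ((measurable_pairStress L hw_meas).pow_const 2).ennreal_ofReal.aemeasurable] at h2
  change ∫⁻ x : Fin 2 → E d, ENNReal.ofReal (pairStress w L (x 0) (x 1)) ^ 2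
    ∂(Measure.pi fun _ => ballMeasure d) ≠ ∞
  rw [h1]
  refine ne_top_of_le_ne_top h2.ne (lintegral_mono fun u => lintegral_mono fun v => ?_)
  rw [← sq_abs, ENNReal.ofReal_pow (abs_nonneg _)]
  exact pow_le_pow_left' (ENNReal.ofReal_le_ofReal (le_abs_self _)) 2

theorem vert_stressFun (hw_meas : Measurable (Function.uncurry w))
    (hw_symm : ∀ u v, w u v = w v u) (b : Fin 2) :
    vert (ballMeasure d) (stressFun L w) b = pointStress L w := by
  funext u
  have hF : Measurable fun y => stressFun L w (Function.update y b u) :=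
    (measurable_stressFun L hw_meas).comp
      ((measurable_update_joint b).comp measurable_prodMk_left)
  unfold vert pointStress
  -- In `Fin 2`, `b + 1` is the other coordinate.
  rw [lintegral_pi_update (ballMeasure d) (b + 1) hF]
  refine lintegral_congr fun v => ?_
  have h : ∀ y : Fin 2 → E d,
      stressFun L w (Function.update (Function.update y (b + 1) v) b u) =
        ENNReal.ofReal (pairStress w L u v) := fun y => by
    unfold stressFun stressKernel
    fin_cases b
    · simp [Function.update]
    · simp [Function.update, pairStress_comm L hw_symm u v]
  simp [h]

/-- This second moment is itself a one-point overlap integral, so `overlap_le` bounds it. -/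
theorem lintegral_pointStress_sq_ne_top (hw_meas : Measurable (Function.uncurry w))
    (hw_symm : ∀ u v, w u v = w v u)
    (hfin : ∫⁻ x, stressFun L w x ^ 2 ∂(Measure.pi fun _ => ballMeasure d) ≠ ∞) :
    ∫⁻ v, pointStress L w v ^ 2 ∂(ballMeasure d) ≠ ∞ := by
  have hm := measurable_stressFun L hw_meas
  have h := overlap_le (ballMeasure d) hm hm (isPattern_onePoint (0 : Fin 2) (0 : Fin 2)).1
  rw [overlap_onePoint _ hm hm, vert_stressFun L hw_meas hw_symm] at h
  simp_rw [← sq] at h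
  exact ne_top_of_le_ne_top (ENNReal.add_ne_top.2 ⟨hfin, hfin⟩) h

theorem lintegral_pointStress_ne_top
    (hfin : ∫⁻ v, pointStress L w v ^ 2 ∂(ballMeasure d) ≠ ∞) :
    ∫⁻ v, pointStress L w v ∂(ballMeasure d) ≠ ∞ := by
  have h : ∀ a : ℝ≥0∞, a ≤ 1 + a ^ 2 := fun a => by
    rcases le_total a 1 with h | h
    · exact h.trans le_self_add
    · exact (le_self_pow h two_ne_zero).trans le_add_self
  refine ne_top_of_le_ne_top ?_ (lintegral_mono fun v => h (pointStress L w v))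
  rw [lintegral_add_left measurable_const]
  simpa using hfin

theorem overlap_stressFun_onePoint (hw_meas : Measurable (Function.uncurry w))
    (hw_symm : ∀ u v, w u v = w v u) (a b : Fin 2) :
    overlap (ballMeasure d) (stressFun L w) (stressFun L w) (onePoint a b) =
      ∫⁻ v, pointStress L w v ^ 2 ∂(ballMeasure d) := by
  have hm := measurable_stressFun L hw_meas
  rw [overlap_onePoint _ hm hm, vert_stressFun L hw_meas hw_symm,
    vert_stressFun L hw_meas hw_symm]
  simp_rw [sq]

theorem overlap_crossFun_stressFun_onePoint (hw_meas : Measurable (Function.uncurry w))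
    (hw_symm : ∀ u v, w u v = w v u) {δ : ℝ} (hδ : 0 < δ) (a : Fin 4) (b : Fin 2) :
    overlap (ballMeasure d) (crossFun L δ) (stressFun L w) (onePoint a b) =
      ENNReal.ofReal (δ ^ (2 * d + 2)) *
        ∫⁻ v, localVertex L δ v * pointStress L w v ∂(ballMeasure d) := by
  have hm : Measurable fun v => localVertex L δ v * pointStress L w v :=
    (measurable_localVertex L δ).mul (measurable_pointStress L hw_meas)
  rw [overlap_onePoint _ (measurable_crossFun L δ) (measurable_stressFun L hw_meas),
    vert_stressFun L hw_meas hw_symm, (isEdgeFun_crossFun L hδ.le).vert_eq, vert_crossFun,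
    ← lintegral_const_mul _ hm]
  refine lintegral_congr fun v => ?_
  rw [vertexCross_eq L hδ, mul_assoc]

/-- A bound for the contribution of the patterns in which two points are shared. -/
noncomputable def mixedBound (w : E d → E d → ℝ) (δ : ℝ) : ℝ≥0∞ :=
  maxProfile L * maxSec L * ∫⁻ u, ∫⁻ v, near δ u v * ENNReal.ofReal (pairStress w L u v)
    ∂(ballMeasure d) ∂(ballMeasure d) +
  ENNReal.ofReal (δ ^ (d - 2) * kappa d ^ 2) * ∫⁻ v, pointStress L w v ∂(ballMeasure d)

theorem overlap_crossFun_stressFun_rest (hd : 3 ≤ d) (hw_meas : Measurable (Function.uncurry w))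
    {δ : ℝ} (hδ : 0 < δ) {p : Fin 2 → Option (Fin 4)} (hp : IsPattern p) (h0 : free p = 0) :
    overlap (ballMeasure d) (crossFun L δ) (stressFun L w) p ≤
      ENNReal.ofReal (δ ^ (d + 2)) * mixedBound L w δ := by
  have hk := (kappa_pos d).le
  have hE := isEdgeFun_crossFun L hδ.le
  have hφ := measurable_ofReal_pairStress L hw_meas
  have hs : ∀ b, ∃ a, p b = some a := fun b => by
    refine isSome_of ?_
    rw [free, Finset.card_eq_zero, Finset.filter_eq_empty_iff] at h0
    exact Bool.eq_false_iff.2 (h0 (Finset.mem_univ b))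
  obtain ⟨a, ha⟩ := hs 0
  obtain ⟨a', ha'⟩ := hs 1
  have hne : a' ≠ a := by
    rintro rfl
    exact zero_ne_one (hp _ _ _ ha ha')
  have h1 : overlap (ballMeasure d) (crossFun L δ) (stressFun L w) p =
      ∫⁻ x, crossFun L δ x * ENNReal.ofReal (pairStress w L (x a) (x a'))
        ∂(Measure.pi fun _ => ballMeasure d) := by
    rw [overlap_eq_lintegral _ _ (measurable_stressFun L hw_meas)]
    refine lintegral_congr fun x => ?_
    simp [stressFun, stressKernel, mix, ha, ha']
  rw [h1]
  unfold mixedBound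
  -- Either the stressed pair is an edge of the crossing, hence close together, or it joins the two
  -- edges. In the latter case the two partners cost `δ ^ (2 * d)`, a surplus of `δ ^ (d - 2)` over
  -- `δ ^ (d + 2)`.
  by_cases h2 : a' = a ^^^ 1
  · subst h2
    rw [lintegral_mul_eval_eval _ (measurable_crossFun L δ) hne
      (φ := fun u v => ENNReal.ofReal (pairStress w L u v)) hφ, hE.pair_eq, pair_crossFun]
    rw [mul_add]
    refine le_add_right ?_
    have hm : Measurable fun q : E d × E d =>
        near δ q.1 q.2 * ENNReal.ofReal (pairStress w L q.1 q.2) := (measurable_near δ).mul hφ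
    have hm2 : Measurable fun u => ∫⁻ v, near δ u v * ENNReal.ofReal (pairStress w L u v)
        ∂(ballMeasure d) := hm.lintegral_prod_right'
    rw [← mul_assoc, ← lintegral_const_mul _ hm2]
    refine lintegral_mono fun u => ?_
    have hm' : Measurable fun v => near δ u v * ENNReal.ofReal (pairStress w L u v) :=
      measurable_comp₂ (F := fun u v => near δ u v * ENNReal.ofReal (pairStress w L u v)) hm
        measurable_const measurable_id
    rw [← lintegral_const_mul _ hm']
    refine lintegral_mono fun v => ?_
    rw [← mul_assoc]
    exact mul_le_mul_left (edgeCross_le L hδ u v) _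
  · refine (hE.lintegral_mul_le hne h2
      (φ := fun u v => ENNReal.ofReal (pairStress w L u v)) hφ).trans ?_
    rw [IsEdgeFun.lintegral_pi_eval_eval hne
      (φ := fun u v => ENNReal.ofReal (pairStress w L u v)) hφ, mul_add]
    refine le_add_left (le_of_eq ?_)
    rw [← mul_assoc, ← ENNReal.ofReal_mul (by positivity), ← ENNReal.ofReal_pow (by positivity)]
    unfold pointStress
    congr 2
    obtain ⟨k, rfl⟩ : ∃ k, d = k + 2 := ⟨d - 2, by omega⟩
    rw [Nat.add_sub_cancel]
    ring

omit [IsProbabilityMeasure (ballMeasure d)] in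
-- The near pairs shrink to the diagonal, where the stress vanishes, with the integrable stress as
-- dominating function; the other term carries `δ ^ (d - 2)` with `d > 2`.
theorem tendsto_mixedBound (hd : 3 ≤ d) (hw_meas : Measurable (Function.uncurry w))
    (hfin : ∫⁻ v, pointStress L w v ∂(ballMeasure d) ≠ ∞) :
    Tendsto (mixedBound L w) (𝓝[>] 0) (𝓝 0) := by
  have hφ := measurable_ofReal_pairStress L hw_meas
  have hm : ∀ δ : ℝ, Measurable fun q : E d × E d =>
      near δ q.1 q.2 * ENNReal.ofReal (pairStress w L q.1 q.2) := fun δ => (measurable_near δ).mul hφ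
  have hle : ∀ (δ : ℝ) (q : E d × E d),
      near δ q.1 q.2 * ENNReal.ofReal (pairStress w L q.1 q.2) ≤
        ENNReal.ofReal (pairStress w L q.1 q.2) := fun δ q => by
    refine mul_le_of_le_one_left' ?_
    simp only [near, Set.indicator_apply]
    split_ifs <;> simp
  have h1 : Tendsto (fun δ : ℝ => ∫⁻ u, ∫⁻ v, near δ u v * ENNReal.ofReal (pairStress w L u v)
      ∂(ballMeasure d) ∂(ballMeasure d)) (𝓝[>] 0) (𝓝 0) := by
    have h2 : ∀ δ : ℝ, ∫⁻ u, ∫⁻ v, near δ u v * ENNReal.ofReal (pairStress w L u v)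
        ∂(ballMeasure d) ∂(ballMeasure d) =
        ∫⁻ q, near δ q.1 q.2 * ENNReal.ofReal (pairStress w L q.1 q.2)
          ∂((ballMeasure d).prod (ballMeasure d)) := fun δ =>
      (lintegral_prod _ (hm δ).aemeasurable).symm
    simp_rw [h2]
    rw [← lintegral_zero (μ := (ballMeasure d).prod (ballMeasure d))]
    refine tendsto_lintegral_filter_of_dominated_convergence
      (fun q => ENNReal.ofReal (pairStress w L q.1 q.2)) ?_ ?_ ?_ ?_
    · exact .of_forall hm
    · exact .of_forall fun δ => .of_forall (hle δ)
    · rwa [lintegral_prod _ hφ.aemeasurable]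
    · refine .of_forall fun q => tendsto_const_nhds.congr' ?_
      rcases eq_or_ne q.1 q.2 with h3 | h3
      · refine .of_forall fun δ => ?_
        simp [pairStress, h3]
      · have h4 : ∀ᶠ δ in 𝓝[>] (0 : ℝ), δ < dist q.1 q.2 :=
          nhdsWithin_le_nhds (Iio_mem_nhds (dist_pos.2 h3))
        filter_upwards [h4] with δ h5
        have h6 : near δ q.1 q.2 = 0 :=
          Set.indicator_of_notMem (fun h : dist q.1 q.2 ≤ δ => h5.not_ge h) 1
        rw [h6, zero_mul]
  have h2 : Tendsto (fun δ : ℝ => ENNReal.ofReal (δ ^ (d - 2) * kappa d ^ 2)) (𝓝[>] 0)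
      (𝓝 0) := by
    have h3 : Continuous fun δ : ℝ => ENNReal.ofReal (δ ^ (d - 2) * kappa d ^ 2) :=
      ENNReal.continuous_ofReal.comp (by fun_prop)
    have h4 := h3.tendsto 0
    rw [zero_pow (by omega), zero_mul, ENNReal.ofReal_zero] at h4
    exact h4.mono_left nhdsWithin_le_nhds
  have h3 := (ENNReal.Tendsto.const_mul h1
    (.inr (ENNReal.mul_ne_top (maxProfile_ne_top L) (maxSec_ne_top L)))).add
    (ENNReal.Tendsto.mul_const h2 (.inr hfin))
  rw [mul_zero, zero_mul, add_zero] at h3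
  exact h3

end Stresses

/-! ### Limits of the variances and of the covariance -/

section Asymptotics

variable {d : ℕ} (L : Plane d) {w : E d → E d → ℝ}
variable [IsProbabilityMeasure (ballMeasure d)]

omit [IsProbabilityMeasure (ballMeasure d)] in
theorem crossInd_nonneg (δ : ℝ) : 0 ≤ crossInd δ L := fun x => by
  classical
  unfold crossInd
  split_ifs <;> simp

omit [IsProbabilityMeasure (ballMeasure d)] in
theorem stressKernel_nonneg (hw_pos : ∀ u v, u ≠ v → 0 < w u v) : 0 ≤ stressKernel w L :=
  fun _ => pairStress_nonneg L hw_pos _ _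

theorem lintegral_crossFun_sq_ne_top (δ : ℝ) :
    ∫⁻ x, crossFun L δ x ^ 2 ∂(Measure.pi fun _ => ballMeasure d) ≠ ∞ := by
  classical
  refine ne_top_of_le_ne_top ENNReal.one_ne_top ?_
  have h : ∀ x, crossFun L δ x ^ 2 ≤ 1 := fun x => by
    unfold crossFun crossInd
    split_ifs <;> simp
  exact (lintegral_mono h).trans (by simp)

theorem lintegral_secVol_sq_ne_top : ∫⁻ v, secVol L v ^ 2 ∂(ballMeasure d) ≠ ∞ := by
  refine ne_top_of_le_ne_top (ENNReal.pow_ne_top (n := 2) (maxSec_ne_top L)) ?_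
  refine (lintegral_mono fun v => pow_le_pow_left' (secVol_le L v) 2).trans ?_
  simp

omit [IsProbabilityMeasure (ballMeasure d)] in
theorem lintegral_secVol_mul_ne_top (hw_meas : Measurable (Function.uncurry w))
    (hfin : ∫⁻ v, pointStress L w v ∂(ballMeasure d) ≠ ∞) :
    ∫⁻ v, secVol L v * pointStress L w v ∂(ballMeasure d) ≠ ∞ := by
  refine ne_top_of_le_ne_top (ENNReal.mul_ne_top (maxSec_ne_top L) hfin) ?_
  rw [← lintegral_const_mul _ (measurable_pointStress L hw_meas)]
  exact lintegral_mono fun v => mul_le_mul_left (secVol_le L v) _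

theorem free_eq_zero_of {ι : Type*} {p : Fin 2 → Option ι} (h0 : p ≠ fun _ => none)
    (h1 : free p + 1 ≠ 2) : free p = 0 := by
  have h2 : free p ≤ 2 := (Finset.card_le_univ _).trans_eq (by simp)
  have h3 : free p ≠ 2 := fun h => h0 <| funext fun b => isNone_of <| by
    have h4 : (Finset.univ.filter fun b => (p b).isNone) = Finset.univ :=
      Finset.eq_univ_of_card _ (h.trans (by simp))
    simpa using Finset.ext_iff.1 h4 b
  omega

omit [IsProbabilityMeasure (ballMeasure d)] in
theorem tendsto_of_rest {x δ : ℝ → ℝ} {ℓ : ℝ} (hx : Tendsto x atTop (𝓝 ℓ))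
    (hδ : Tendsto δ atTop (𝓝 0)) (C : ℝ) (k m : ℕ) (hm : m ≠ 0) :
    Tendsto (fun t => x t ^ k * δ t ^ m * C) atTop (𝓝 0) := by
  have h := ((hx.pow k).mul (hδ.pow m)).mul_const C
  rwa [zero_pow hm, mul_zero, zero_mul] at h

variable {δ : ℝ → ℝ} {ℓ : ℝ} (hd : 3 ≤ d) (hδ_pos : ∀ t, 0 < t → 0 < δ t)
  (hδ : Tendsto δ atTop (𝓝 0)) (hℓ : Tendsto (fun t => 1 / (t * δ t ^ d)) atTop (𝓝 ℓ))
include hd hδ_pos hδ hℓ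

omit [IsProbabilityMeasure (ballMeasure d)] hd hℓ in
theorem tendsto_nhdsGT : Tendsto δ atTop (𝓝[>] 0) :=
  tendsto_nhdsWithin_iff.2 ⟨hδ, (eventually_gt_atTop 0).mono hδ_pos⟩

theorem tendsto_overlap_crossFun {p : Fin 4 → Option (Fin 4)} (hp : IsPattern p)
    (h0 : p ≠ fun _ => none) :
    Tendsto (fun t => t ^ (4 + free p) *
        (overlap (ballMeasure d) (crossFun L (δ t)) (crossFun L (δ t)) p).toReal /
          (t ^ 7 * δ t ^ (4 * d + 4))) atTop
      (𝓝 ((if free p + 1 = 4 then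
          ((crossVol L).toReal ^ 2 * (∫⁻ v, secVol L v ^ 2 ∂(ballMeasure d)).toReal) else 0) +
        (if free p = 2 ∧ IsOneEdge p then
          (ℓ * ((crossSq L).toReal * (∫⁻ v, secVol L v ^ 2 ∂(ballMeasure d)).toReal)) else 0))) := by
  have hδ' := tendsto_nhdsGT hδ_pos hδ
  have hI := lintegral_secVol_sq_ne_top L
  by_cases h3 : free p = 3
  · rw [if_pos (by omega), if_neg (by omega), add_zero]
    obtain ⟨a, b, rfl⟩ : ∃ a b, p = onePoint a b := free_onePoint_iff.1 (by simp [h3])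
    have h1 := (ENNReal.tendsto_toReal (ENNReal.mul_ne_top
      (ENNReal.pow_ne_top (crossVol_ne_top L)) hI)).comp
      ((tendsto_lintegral_localVertex_sq L hd).comp hδ')
    rw [ENNReal.toReal_mul, ENNReal.toReal_pow] at h1
    refine h1.congr' ?_
    filter_upwards [eventually_gt_atTop 0] with t ht
    have hp := hδ_pos t ht
    rw [overlap_crossFun_onePoint L hp, h3, ENNReal.toReal_mul,
      ENNReal.toReal_ofReal (by positivity)]
    simp only [Function.comp]
    field_simp
  by_cases h2 : free p = 2 ∧ IsOneEdge p
  · rw [if_neg (by omega), if_pos h2, zero_add]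
    obtain ⟨h2, a, b, rfl⟩ := h2
    have h1 := (ENNReal.tendsto_toReal (ENNReal.mul_ne_top (crossSq_ne_top L) hI)).comp
      ((tendsto_lintegral_localCross_sq L hd).comp hδ')
    rw [ENNReal.toReal_mul] at h1
    refine (hℓ.mul h1).congr' ?_
    filter_upwards [eventually_gt_atTop 0] with t ht
    have hp := hδ_pos t ht
    rw [overlap_crossFun_oneEdge L hp, h2, ENNReal.toReal_mul,
      ENNReal.toReal_ofReal (by positivity)]
    simp only [Function.comp]
    -- Compared with the one-point terms, a shared edge loses one `t` and gains `δ ^ (-d)`: the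
    -- quotient is `1 / (t * δ ^ d)`, which tends to `ℓ`.
    rw [show 4 * d + 4 = (3 * d + 4) + d by ring, pow_add (δ t) (3 * d + 4)]
    field_simp
    ring
  · rw [if_neg (by omega), if_neg h2, add_zero]
    -- The powers of `1 / (t * δ ^ d)` stay bounded and `δ ^ (d - 2)` tends to zero.
    have h1 := tendsto_of_rest hℓ hδ (restBound L).toReal (3 - free p) (d - 2) (by omega)
    refine squeeze_zero' ?_ ?_ h1
    · filter_upwards [eventually_gt_atTop 0] with t ht
      have := hδ_pos t ht
      positivity
    · filter_upwards [eventually_gt_atTop 0] with t ht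
      have hp' := hδ_pos t ht
      obtain ⟨hle, hov⟩ := overlap_crossFun_rest L hp' hp h0 h3 h2
      have hov' := ENNReal.toReal_mono
        (ENNReal.mul_ne_top ENNReal.ofReal_ne_top (restBound_ne_top L)) hov
      rw [ENNReal.toReal_mul, ENNReal.toReal_ofReal (by positivity)] at hov'
      rw [div_le_iff₀ (by positivity)]
      refine (mul_le_mul_of_nonneg_left hov' (by positivity)).trans_eq ?_
      obtain ⟨k, rfl⟩ : ∃ k, d = k + 2 := ⟨d - 2, by omega⟩
      rw [Nat.add_sub_cancel]
      generalize free p = f at hle ⊢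
      interval_cases f <;> simp only [one_div, inv_pow] <;> field_simp <;> ring

theorem tendsto_variance_cross :
    Tendsto (fun t => covariance (ustat (crossInd (δ t) L)) (ustat (crossInd (δ t) L))
        (sample (ballMeasure d) t.toNNReal) / (t ^ 7 * δ t ^ (4 * d + 4))) atTop
      (𝓝 (16 * ((crossVol L).toReal ^ 2 * (∫⁻ v, secVol L v ^ 2 ∂(ballMeasure d)).toReal) +
        8 * (ℓ * ((crossSq L).toReal * (∫⁻ v, secVol L v ^ 2 ∂(ballMeasure d)).toReal)))) := by
  have h := tendsto_finsetSum
    (Finset.univ.filter fun p : Fin 4 → Option (Fin 4) => IsPattern p ∧ p ≠ fun _ => none)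
    fun p hp => tendsto_overlap_crossFun L hd hδ_pos hδ hℓ (Finset.mem_filter.1 hp).2.1
      (Finset.mem_filter.1 hp).2.2
  rw [Finset.sum_add_distrib, ← Finset.sum_filter, ← Finset.sum_filter, Finset.sum_const,
    Finset.sum_const, Finset.filter_filter, Finset.filter_filter, card_oneEdge] at h
  have hc := card_onePoint (ι := Fin 4) (κ := Fin 4)
  rw [Fintype.card_fin] at hc
  rw [hc, nsmul_eq_mul, nsmul_eq_mul] at h
  refine Tendsto.congr' ?_ (by simpa using h)
  filter_upwards [eventually_gt_atTop 0] with t ht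
  rw [covariance_ustat _ _ (measurable_crossInd _ L) (measurable_crossInd _ L)
    (crossInd_nonneg L _) (crossInd_nonneg L _) (lintegral_crossFun_sq_ne_top L _)
    (lintegral_crossFun_sq_ne_top L _), Real.coe_toNNReal _ ht.le, Finset.sum_div,
    Fintype.card_fin]
  rfl

theorem tendsto_overlap_crossFun_stressFun (hw_meas : Measurable (Function.uncurry w))
    (hw_symm : ∀ u v, w u v = w v u) (hfin : ∫⁻ v, pointStress L w v ∂(ballMeasure d) ≠ ∞)
    {p : Fin 2 → Option (Fin 4)} (hp : IsPattern p) (h0 : p ≠ fun _ => none) :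
    Tendsto (fun t => t ^ (4 + free p) *
        (overlap (ballMeasure d) (crossFun L (δ t)) (stressFun L w) p).toReal /
          (t ^ 5 * δ t ^ (2 * d + 2))) atTop
      (𝓝 (if free p + 1 = 2 then ((crossVol L).toReal *
        (∫⁻ v, secVol L v * pointStress L w v ∂(ballMeasure d)).toReal) else 0)) := by
  have hδ' := tendsto_nhdsGT hδ_pos hδ
  by_cases h1 : free p + 1 = 2
  · rw [if_pos h1]
    obtain ⟨a, b, rfl⟩ : ∃ a b, p = onePoint a b := free_onePoint_iff.1 (by simp [h1])
    have h2 := (ENNReal.tendsto_toReal (ENNReal.mul_ne_top (crossVol_ne_top L)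
      (lintegral_secVol_mul_ne_top L hw_meas hfin))).comp
      ((tendsto_lintegral_localVertex_mul L hd (measurable_pointStress L hw_meas) hfin).comp hδ')
    rw [ENNReal.toReal_mul] at h2
    refine h2.congr' ?_
    filter_upwards [eventually_gt_atTop 0] with t ht
    have hp := hδ_pos t ht
    rw [overlap_crossFun_stressFun_onePoint L hw_meas hw_symm hp,
      show free (onePoint a b) = 1 by omega, ENNReal.toReal_mul,
      ENNReal.toReal_ofReal (by positivity)]
    simp only [Function.comp]
    field_simp
  · rw [if_neg h1]
    have hfree := free_eq_zero_of h0 h1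
    have h2 := tendsto_mixedBound L hd hw_meas hfin
    have h3 := (ENNReal.tendsto_toReal ENNReal.zero_ne_top).comp (h2.comp hδ')
    -- Here `t ^ 4 * δ ^ (d + 2)` over `t ^ 5 * δ ^ (2 * d + 2)` is again `1 / (t * δ ^ d)`, which
    -- is bounded, and `mixedBound` tends to zero.
    have h4 := hℓ.mul h3
    rw [ENNReal.toReal_zero, mul_zero] at h4
    refine squeeze_zero' ?_ ?_ h4
    · filter_upwards [eventually_gt_atTop 0] with t ht
      have := hδ_pos t ht
      positivity
    · filter_upwards [eventually_gt_atTop 0,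
        (h2.comp hδ').eventually (gt_mem_nhds ENNReal.zero_lt_top)] with t ht htop
      have hp' := hδ_pos t ht
      have hov := ENNReal.toReal_mono (ENNReal.mul_ne_top ENNReal.ofReal_ne_top htop.ne)
        (overlap_crossFun_stressFun_rest L hd hw_meas hp' hp hfree)
      rw [ENNReal.toReal_mul, ENNReal.toReal_ofReal (by positivity)] at hov
      rw [div_le_iff₀ (by positivity), hfree]
      refine (mul_le_mul_of_nonneg_left hov (by positivity)).trans_eq ?_
      simp only [Function.comp]
      rw [show 2 * d + 2 = d + (d + 2) by ring, pow_add (δ t) d (d + 2)]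
      field_simp
      ring

theorem tendsto_covariance (hw_meas : Measurable (Function.uncurry w))
    (hw_symm : ∀ u v, w u v = w v u) (hw_pos : ∀ u v, u ≠ v → 0 < w u v)
    (hsq : ∫⁻ x, stressFun L w x ^ 2 ∂(Measure.pi fun _ => ballMeasure d) ≠ ∞) :
    Tendsto (fun t => covariance (ustat (crossInd (δ t) L)) (ustat (stressKernel w L))
        (sample (ballMeasure d) t.toNNReal) / (t ^ 5 * δ t ^ (2 * d + 2))) atTop
      (𝓝 (8 * ((crossVol L).toReal *
        (∫⁻ v, secVol L v * pointStress L w v ∂(ballMeasure d)).toReal))) := by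
  have hfin := lintegral_pointStress_ne_top L
    (lintegral_pointStress_sq_ne_top L hw_meas hw_symm hsq)
  have h := tendsto_finsetSum
    (Finset.univ.filter fun p : Fin 2 → Option (Fin 4) => IsPattern p ∧ p ≠ fun _ => none)
    fun p hp => tendsto_overlap_crossFun_stressFun L hd hδ_pos hδ hℓ hw_meas hw_symm hfin
      (Finset.mem_filter.1 hp).2.1 (Finset.mem_filter.1 hp).2.2
  have hc := card_onePoint (ι := Fin 4) (κ := Fin 2)
  simp only [Fintype.card_fin] at hc
  rw [← Finset.sum_filter, Finset.sum_const, Finset.filter_filter, hc, nsmul_eq_mul] at h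
  refine Tendsto.congr' ?_ (by convert h using 3; norm_num)
  filter_upwards [eventually_gt_atTop 0] with t ht
  rw [covariance_ustat _ _ (measurable_crossInd _ L) (measurable_stressKernel hw_meas L)
    (crossInd_nonneg L _) (stressKernel_nonneg L hw_pos) (lintegral_crossFun_sq_ne_top L _)
    hsq, Real.coe_toNNReal _ ht.le, Finset.sum_div, Fintype.card_fin]
  rfl

omit hd hδ_pos hδ hℓ in
theorem tendsto_variance_stress (hw_meas : Measurable (Function.uncurry w))
    (hw_symm : ∀ u v, w u v = w v u) (hw_pos : ∀ u v, u ≠ v → 0 < w u v)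
    (hsq : ∫⁻ x, stressFun L w x ^ 2 ∂(Measure.pi fun _ => ballMeasure d) ≠ ∞) :
    Tendsto (fun t : ℝ => covariance (ustat (stressKernel w L)) (ustat (stressKernel w L))
        (sample (ballMeasure d) t.toNNReal) / t ^ 3) atTop
      (𝓝 (4 * (∫⁻ v, pointStress L w v ^ 2 ∂(ballMeasure d)).toReal)) := by
  have h := tendsto_finsetSum (x := atTop)
    (Finset.univ.filter fun p : Fin 2 → Option (Fin 2) => IsPattern p ∧ p ≠ fun _ => none)
    (f := fun p t => t ^ (2 + free p) *
      (overlap (ballMeasure d) (stressFun L w) (stressFun L w) p).toReal / t ^ 3)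
    (a := fun p => if free p + 1 = 2 then
      (∫⁻ v, pointStress L w v ^ 2 ∂(ballMeasure d)).toReal else 0) fun p hp => by
    by_cases h1 : free p + 1 = 2
    · rw [if_pos h1]
      obtain ⟨a, b, rfl⟩ : ∃ a b, p = onePoint a b := free_onePoint_iff.1 (by simp [h1])
      refine tendsto_const_nhds.congr' ?_
      filter_upwards [eventually_gt_atTop 0] with t ht
      rw [overlap_stressFun_onePoint L hw_meas hw_symm, show free (onePoint a b) = 1 by omega]
      field_simp
    · rw [if_neg h1, free_eq_zero_of (Finset.mem_filter.1 hp).2.2 h1]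
      -- If both points are shared, the power is `t ^ 2`, one less than the normalisation.
      have h2 := tendsto_inv_atTop_zero.mul_const
        (overlap (ballMeasure d) (stressFun L w) (stressFun L w) p).toReal
      rw [zero_mul] at h2
      refine h2.congr' ?_
      filter_upwards [eventually_gt_atTop 0] with t ht
      field_simp
      ring
  have hc := card_onePoint (ι := Fin 2) (κ := Fin 2)
  simp only [Fintype.card_fin] at hc
  rw [← Finset.sum_filter, Finset.sum_const, Finset.filter_filter, hc, nsmul_eq_mul] at h
  refine Tendsto.congr' ?_ (by convert h using 3; norm_num)
  filter_upwards [eventually_gt_atTop 0] with t ht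
  rw [covariance_ustat _ _ (measurable_stressKernel hw_meas L) (measurable_stressKernel hw_meas L)
    (stressKernel_nonneg L hw_pos) (stressKernel_nonneg L hw_pos) hsq hsq,
    Real.coe_toNNReal _ ht.le, Finset.sum_div, Fintype.card_fin]
  rfl

end Asymptotics

/-! ### Positivity and limit of the correlation -/

section Correlation

theorem covariance_eq_zero_of_variance_eq_zero {Ω : Type*} [MeasurableSpace Ω] {P : Measure Ω}
    [IsProbabilityMeasure P] {X : Ω → ℝ} (Y : Ω → ℝ) (hX : MemLp X 2 P)
    (h : variance X P = 0) : covariance X Y P = 0 := by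
  refine integral_eq_zero_of_ae ?_
  filter_upwards [ae_eq_integral_of_variance_eq_zero hX h] with ω hω
  simp [hω]

/-- A positive covariance forces both variances to be positive, so the quotient is not one with the
default value zero. -/
theorem corr_pos {Ω : Type*} [MeasurableSpace Ω] {P : Measure Ω} [IsProbabilityMeasure P]
    {X Y : Ω → ℝ} (hX : MemLp X 2 P) (hY : MemLp Y 2 P) (h : 0 < covariance X Y P) :
    0 < corr X Y P := by
  have h1 : 0 < variance X P := (variance_nonneg X P).lt_of_ne' fun h0 =>
    h.ne' (covariance_eq_zero_of_variance_eq_zero Y hX h0)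
  have h2 : 0 < variance Y P := (variance_nonneg Y P).lt_of_ne' fun h0 =>
    h.ne' (covariance_comm X Y ▸ covariance_eq_zero_of_variance_eq_zero X hY h0)
  unfold corr
  positivity

variable {d : ℕ} (L : Plane d) {w : E d → E d → ℝ}

theorem crossFun_mono {δ δ' : ℝ} (h : δ' ≤ δ) (x : Fin 4 → E d) :
    crossFun L δ' x ≤ crossFun L δ x := by
  classical
  refine ENNReal.ofReal_le_ofReal ?_
  unfold crossInd
  split_ifs with h1 h2
  · exact le_rfl
  · exact absurd ⟨h1.1.trans h, h1.2.1.trans h, h1.2.2⟩ h2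
  · exact zero_le_one
  · exact le_rfl

variable [IsProbabilityMeasure (ballMeasure d)]

theorem lintegral_secVol_sq_pos : 0 < ∫⁻ v, secVol L v ^ 2 ∂(ballMeasure d) := by
  refine lintegral_pos_of_ae_pos ((measurable_secVol L).pow_const 2) ?_
  filter_upwards [ae_norm_lt_rad] with v hv
  exact ENNReal.pow_pos (secVol_pos L hv) 2

theorem lintegral_secVol_mul_pos (hd : 3 ≤ d) (hw_meas : Measurable (Function.uncurry w))
    (hw_pos : ∀ u v, u ≠ v → 0 < w u v) :
    0 < ∫⁻ v, secVol L v * pointStress L w v ∂(ballMeasure d) := by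
  refine lintegral_pos_of_ae_pos ((measurable_secVol L).mul (measurable_pointStress L hw_meas)) ?_
  filter_upwards [ae_norm_lt_rad] with v hv
  exact ENNReal.mul_pos (secVol_pos L hv).ne' (pointStress_pos L hd hw_meas hw_pos v).ne'

theorem lintegral_pointStress_sq_pos (hd : 3 ≤ d) (hw_meas : Measurable (Function.uncurry w))
    (hw_pos : ∀ u v, u ≠ v → 0 < w u v) :
    0 < ∫⁻ v, pointStress L w v ^ 2 ∂(ballMeasure d) :=
  lintegral_pos_of_ae_pos ((measurable_pointStress L hw_meas).pow_const 2)
    (.of_forall fun v => ENNReal.pow_pos (pointStress_pos L hd hw_meas hw_pos v) 2)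

/-- Crossings become more frequent as `δ` grows, so it suffices to find one smaller distance with
positive probability; the positive limit of the rescaled second moments provides it. -/
theorem lintegral_crossFun_pos (hd : 3 ≤ d) {δ : ℝ} (hδ : 0 < δ) :
    0 < ∫⁻ x, crossFun L δ x ∂(Measure.pi fun _ => ballMeasure d) := by
  have h1 : 0 < crossVol L ^ 2 * ∫⁻ v, secVol L v ^ 2 ∂(ballMeasure d) :=
    ENNReal.mul_pos (ENNReal.pow_pos (crossVol_pos L) 2).ne' (lintegral_secVol_sq_pos L).ne'
  have h2 : ∀ᶠ δ' in 𝓝[>] (0 : ℝ), δ' < δ := nhdsWithin_le_nhds (Iio_mem_nhds hδ)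
  obtain ⟨δ', ⟨h3, h4⟩, h5⟩ := (((tendsto_lintegral_localVertex_sq L hd).eventually
    (lt_mem_nhds h1)).and h2 |>.and self_mem_nhdsWithin).exists
  have h5 : 0 < δ' := h5
  refine lt_of_lt_of_le ?_ (lintegral_mono fun x => crossFun_mono L h4.le x)
  rw [lintegral_crossFun, pos_iff_ne_zero, Ne, lintegral_eq_zero_iff (measurable_vertexCross L δ')]
  intro h0
  refine h3.ne' ((lintegral_eq_zero_iff ((measurable_localVertex L δ').pow_const 2)).2 ?_)
  filter_upwards [h0] with v hv
  rw [vertexCross_eq L h5] at hv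
  have h6 := (mul_eq_zero.1 hv).resolve_left (ENNReal.ofReal_pos.2 (by positivity)).ne'
  simp [h6]

/-- All terms of the covariance formula are nonnegative, and the one for a single shared point is
positive because the point stress is positive everywhere and crossings have positive probability. -/
theorem covariance_pos (hd : 3 ≤ d) (hw_meas : Measurable (Function.uncurry w))
    (hw_symm : ∀ u v, w u v = w v u) (hw_pos : ∀ u v, u ≠ v → 0 < w u v)
    (hsq : ∫⁻ x, stressFun L w x ^ 2 ∂(Measure.pi fun _ => ballMeasure d) ≠ ∞)
    {δ : ℝ} (hδ : 0 < δ) {r : ℝ≥0} (hr : 0 < r) :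
    0 < covariance (ustat (crossInd δ L)) (ustat (stressKernel w L)) (sample (ballMeasure d) r) := by
  have hf := measurable_crossFun L δ
  have hg := measurable_stressFun L hw_meas
  rw [covariance_ustat _ _ (measurable_crossInd _ L) (measurable_stressKernel hw_meas L)
    (crossInd_nonneg L _) (stressKernel_nonneg L hw_pos) (lintegral_crossFun_sq_ne_top L _) hsq]
  refine Finset.sum_pos' (fun p _ => by positivity) ⟨onePoint 0 0,
    Finset.mem_filter.2 ⟨Finset.mem_univ _, isPattern_onePoint 0 0⟩, ?_⟩
  refine mul_pos (by positivity) (ENNReal.toReal_pos ?_ ?_)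
  · change overlap (ballMeasure d) (crossFun L δ) (stressFun L w) (onePoint 0 0) ≠ 0
    rw [overlap_onePoint _ hf hg, vert_stressFun L hw_meas hw_symm,
      ← lintegral_mul_eval _ hf 0 (measurable_pointStress L hw_meas)]
    have hm : Measurable fun x : Fin 4 → E d => crossFun L δ x * pointStress L w (x 0) :=
      hf.mul ((measurable_pointStress L hw_meas).comp (measurable_pi_apply 0))
    rw [Ne, lintegral_eq_zero_iff hm]
    intro h0
    refine (lintegral_crossFun_pos L hd hδ).ne' ((lintegral_eq_zero_iff hf).2 ?_)
    filter_upwards [h0] with x hx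
    exact (mul_eq_zero.1 hx).resolve_right (pointStress_pos L hd hw_meas hw_pos _).ne'
  · exact ne_top_of_le_ne_top (ENNReal.add_ne_top.2 ⟨lintegral_crossFun_sq_ne_top L δ, hsq⟩)
      (overlap_le _ hf hg (isPattern_onePoint 0 0).1)

/-- The limit of the correlation of crossing number and stress. -/
noncomputable def corrLimit (w : E d → E d → ℝ) (ℓ : ℝ) : ℝ :=
  8 * ((crossVol L).toReal *
    (∫⁻ v, secVol L v * pointStress L w v ∂(ballMeasure d)).toReal) /
  (√(16 * ((crossVol L).toReal ^ 2 * (∫⁻ v, secVol L v ^ 2 ∂(ballMeasure d)).toReal) +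
      8 * (ℓ * ((crossSq L).toReal * (∫⁻ v, secVol L v ^ 2 ∂(ballMeasure d)).toReal))) *
    √(4 * (∫⁻ v, pointStress L w v ^ 2 ∂(ballMeasure d)).toReal))

theorem tendsto_corr {δ : ℝ → ℝ} {ℓ : ℝ} (hd : 3 ≤ d) (hδ_pos : ∀ t, 0 < t → 0 < δ t)
    (hδ : Tendsto δ atTop (𝓝 0)) (hℓ : Tendsto (fun t => 1 / (t * δ t ^ d)) atTop (𝓝 ℓ))
    (hℓ0 : 0 ≤ ℓ) (hw_meas : Measurable (Function.uncurry w))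
    (hw_symm : ∀ u v, w u v = w v u) (hw_pos : ∀ u v, u ≠ v → 0 < w u v)
    (hsq : ∫⁻ x, stressFun L w x ^ 2 ∂(Measure.pi fun _ => ballMeasure d) ≠ ∞) :
    Tendsto (fun t => corr (ustat (crossInd (δ t) L)) (ustat (stressKernel w L))
      (sample (ballMeasure d) t.toNNReal)) atTop (𝓝 (corrLimit L w ℓ)) := by
  have hc := ENNReal.toReal_pos (crossVol_pos L).ne' (crossVol_ne_top L)
  have hI := ENNReal.toReal_pos (lintegral_secVol_sq_pos L).ne' (lintegral_secVol_sq_ne_top L)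
  have hS := ENNReal.toReal_pos (lintegral_pointStress_sq_pos L hd hw_meas hw_pos).ne'
    (lintegral_pointStress_sq_ne_top L hw_meas hw_symm hsq)
  have h := (tendsto_covariance L hd hδ_pos hδ hℓ hw_meas hw_symm hw_pos hsq).div
    ((tendsto_variance_cross L hd hδ_pos hδ hℓ).sqrt.mul
      (tendsto_variance_stress L hw_meas hw_symm hw_pos hsq).sqrt) (by positivity)
  refine h.congr' ?_
  filter_upwards [eventually_gt_atTop 0] with t ht
  have hp := hδ_pos t ht
  simp only [Pi.div_apply]
  rw [covariance_self (measurable_ustat (measurable_crossInd _ L)).aemeasurable,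
    covariance_self (measurable_ustat (measurable_stressKernel hw_meas L)).aemeasurable,
    Real.sqrt_div' _ (by positivity), Real.sqrt_div' _ (by positivity), div_mul_div_comm,
    ← Real.sqrt_mul (by positivity) (t ^ 3)]
  -- The scale of the covariance is the geometric mean of the two variance scales, so all
  -- normalisations cancel.
  have h1 : t ^ 7 * δ t ^ (4 * d + 4) * t ^ 3 = (t ^ 5 * δ t ^ (2 * d + 2)) ^ 2 := by ring
  rw [h1, Real.sqrt_sq (by positivity), div_div_div_cancel_right₀ (by positivity)]
  rfl

theorem corrBound_pos {ℓ : ℝ} (hd : 3 ≤ d) (hℓ0 : 0 ≤ ℓ)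
    (hw_meas : Measurable (Function.uncurry w))
    (hw_symm : ∀ u v, w u v = w v u) (hw_pos : ∀ u v, u ≠ v → 0 < w u v)
    (hsq : ∫⁻ x, stressFun L w x ^ 2 ∂(Measure.pi fun _ => ballMeasure d) ≠ ∞) :
    0 < corrBound w (unitVolBall d) ℓ L ∧
      corrBound w (unitVolBall d) ℓ L ≤ corrLimit L w ℓ := by
  have hS2 := lintegral_pointStress_sq_ne_top L hw_meas hw_symm hsq
  have hfin := lintegral_pointStress_ne_top L hS2
  unfold corrBound corrLimit
  rw [I3_eq, S2_eq L hw_meas hw_pos hS2, sectionStress_eq L hw_meas hw_pos hfin, crossVol_toReal]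
  have hc := ENNReal.toReal_pos (crossVol_pos L).ne' (crossVol_ne_top L)
  have hI := ENNReal.toReal_pos (lintegral_secVol_sq_pos L).ne' (lintegral_secVol_sq_ne_top L)
  have hS := ENNReal.toReal_pos (lintegral_pointStress_sq_pos L hd hw_meas hw_pos).ne' hS2
  have hN := ENNReal.toReal_pos (lintegral_secVol_mul_pos L hd hw_meas hw_pos).ne'
    (lintegral_secVol_mul_ne_top L hw_meas hfin)
  have hq : (crossSq L).toReal ≤ 4 * Real.pi * kappa d * (crossVol L).toReal := by
    rw [← maxProfile_eq L hd, ← ENNReal.toReal_mul]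
    exact ENNReal.toReal_mono (ENNReal.mul_ne_top (maxProfile_ne_top L) (crossVol_ne_top L))
      (crossSq_le L)
  have hk := kappa_pos d
  generalize (crossVol L).toReal = c at *
  generalize (∫⁻ v, secVol L v ^ 2 ∂(ballMeasure d)).toReal = I at *
  generalize (∫⁻ v, pointStress L w v ^ 2 ∂(ballMeasure d)).toReal = S at *
  generalize (∫⁻ v, secVol L v * pointStress L w v ∂(ballMeasure d)).toReal = N at *
  have hq0 : 0 ≤ (crossSq L).toReal := ENNReal.toReal_nonneg
  generalize (crossSq L).toReal = q at *
  have hA : 0 ≤ 2 * Real.pi * kappa d / c * ℓ := by positivity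
  refine ⟨by positivity, ?_⟩
  -- Inserting `q ≤ 4 π κ_d c` makes the left radicand at most `16 c² I (1 + 2 π κ_d ℓ / c)`.
  have h1 : √(16 * (c ^ 2 * I) + 8 * (ℓ * (q * I))) ≤
      4 * c * (√(1 + 2 * Real.pi * kappa d / c * ℓ) * √I) := by
    refine Real.sqrt_le_iff.2 ⟨by positivity, ?_⟩
    rw [mul_pow (4 * c), mul_pow (√_), Real.sq_sqrt (by positivity), Real.sq_sqrt hI.le]
    have h2 : (4 * c) ^ 2 * ((1 + 2 * Real.pi * kappa d / c * ℓ) * I) =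
        16 * (c ^ 2 * I) + 8 * (ℓ * (4 * Real.pi * kappa d * c * I)) := by
      field_simp
      ring
    rw [h2]
    gcongr
  have h2 : √(4 * S) = 2 * √S := by
    rw [Real.sqrt_mul (by norm_num), show (4 : ℝ) = 2 ^ 2 by norm_num, Real.sqrt_sq (by norm_num)]
  rw [h2, div_le_div_iff₀ (by positivity) (by positivity)]
  calc N * (√(16 * (c ^ 2 * I) + 8 * (ℓ * (q * I))) * (2 * √S))
      ≤ N * (4 * c * (√(1 + 2 * Real.pi * kappa d / c * ℓ) * √I) * (2 * √S)) := by gcongr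
    _ = _ := by ring

theorem corr_stats (Q : Measure (Plane d)) [IsProbabilityMeasure Q]
    (hw_meas : Measurable (Function.uncurry w))
    (hw : ∀ (g : E d ≃ₗᵢ[ℝ] E d) (u v), w (g u) (g v) = w u v) (δ t : ℝ) :
    corr (fun ω : Plane d × (ℕ × (ℕ → E d)) => crossingNumber δ ω.1 (vertices ω.2))
      (fun ω => stress w ω.1 (vertices ω.2)) (Q.prod (poissonSample (unitVolBall d) t)) =
    corr (ustat (crossInd δ L)) (ustat (stressKernel w L))
      (sample (ballMeasure d) t.toNNReal) := by
  simp only [crossingNumber_eq, stress_eq]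
  rw [corr_const_mul _ _ _ (by norm_num) (by norm_num)]
  change corr _ _ (Q.prod (sample (ballMeasure d) t.toNNReal)) = _
  rw [corr_map (measurable_ustat_joint (measurable_crossInd_joint δ))
      (measurable_ustat_joint (measurable_stressKernel_joint hw_meas)),
    map_stats_prod L Q hw_meas hw, ← corr_map (measurable_ustat (measurable_crossInd δ L))
      (measurable_ustat (measurable_stressKernel hw_meas L))]

theorem memLp_stats (Q : Measure (Plane d)) [IsProbabilityMeasure Q]
    (hw_meas : Measurable (Function.uncurry w)) (hw_pos : ∀ u v, u ≠ v → 0 < w u v)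
    (hw : ∀ (g : E d ≃ₗᵢ[ℝ] E d) (u v), w (g u) (g v) = w u v)
    (hsq : ∫⁻ x, stressFun L w x ^ 2 ∂(Measure.pi fun _ => ballMeasure d) ≠ ∞) (δ t : ℝ) :
    MemLp (fun ω : Plane d × (ℕ × (ℕ → E d)) => crossingNumber δ ω.1 (vertices ω.2)) 2
      (Q.prod (poissonSample (unitVolBall d) t)) ∧
    MemLp (fun ω : Plane d × (ℕ × (ℕ → E d)) => stress w ω.1 (vertices ω.2)) 2
      (Q.prod (poissonSample (unitVolBall d) t)) := by
  simp only [crossingNumber_eq, stress_eq]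
  have hmap := map_stats_prod L Q hw_meas hw δ t.toNNReal
  have hm1 := (measurable_ustat_joint (measurable_crossInd_joint (d := d) δ)).prodMk
    (measurable_ustat_joint (measurable_stressKernel_joint hw_meas))
  have hm2 := (measurable_ustat (measurable_crossInd δ L)).prodMk
    (measurable_ustat (measurable_stressKernel hw_meas L))
  constructor
  · exact MemLp.const_mul (memLp_of_map_eq hm1 hm2 hmap measurable_fst
      (memLp_ustat (ballMeasure d) t.toNNReal (measurable_crossInd δ L) (crossInd_nonneg L δ)
        (lintegral_crossFun_sq_ne_top L δ))) _
  · exact MemLp.const_mul (memLp_of_map_eq hm1 hm2 hmap measurable_snd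
      (memLp_ustat (ballMeasure d) t.toNNReal (measurable_stressKernel hw_meas L)
        (stressKernel_nonneg L hw_pos) hsq)) _

end Correlation

end RGG

theorem mainTheorem9 (d : ℕ) (hd : 3 ≤ d)
    -- the weight function: measurable, symmetric, positive, invariant under rotations
    (w : RGG.E d → RGG.E d → ℝ) (hw_meas : Measurable (Function.uncurry w))
    (hw_symm : ∀ u v, w u v = w v u)
    (hw_pos : ∀ u v, u ≠ v → 0 < w u v)
    (hw_rot : ∀ (g : RGG.E d ≃ₗᵢ[ℝ] RGG.E d) (u v), w (g u) (g v) = w u v)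
    -- the stress has finite second moment
    (hw_sq : ∀ L : RGG.Plane d,
      IntegrableOn (fun p : RGG.E d × RGG.E d => RGG.pairStress w L p.1 p.2 ^ 2)
        (RGG.unitVolBall d ×ˢ RGG.unitVolBall d))
    -- the distance parameters
    (δ : ℝ → ℝ) (hδ_pos : ∀ t, 0 < t → 0 < δ t) (hδ : Tendsto δ atTop (𝓝 0))
    (ℓ : ℝ) (hℓ : Tendsto (fun t => 1 / (t * δ t ^ d)) atTop (𝓝 ℓ)) :
    let P : ℝ → Measure (RGG.Plane d × (ℕ × (ℕ → RGG.E d))) := fun t =>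
      (RGG.uniformPlane d (le_trans (by norm_num) hd)).prod
        (RGG.poissonSample (RGG.unitVolBall d) t)
    let cr : ℝ → RGG.Plane d × (ℕ × (ℕ → RGG.E d)) → ℝ := fun t ω =>
      RGG.crossingNumber (δ t) ω.1 (RGG.vertices ω.2)
    let st : RGG.Plane d × (ℕ × (ℕ → RGG.E d)) → ℝ := fun ω =>
      RGG.stress w ω.1 (RGG.vertices ω.2)
    (∀ t, 0 < t → MemLp (cr t) 2 (P t) ∧ MemLp st 2 (P t) ∧ 0 < RGG.corr (cr t) st (P t)) ∧
    ∃ ρ : ℝ, Tendsto (fun t => RGG.corr (cr t) st (P t)) atTop (𝓝 ρ) ∧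
      ∀ L : RGG.Plane d,
        0 < RGG.corrBound w (RGG.unitVolBall d) ℓ L ∧
        RGG.corrBound w (RGG.unitVolBall d) ℓ L ≤ ρ := by
  have hd0 : d ≠ 0 := by omega
  have := RGG.isProbabilityMeasure_ballMeasure hd0
  have hsq := fun L => RGG.lintegral_stressFun_sq_ne_top L hw_meas (hw_sq L)
  have hℓ0 : 0 ≤ ℓ := ge_of_tendsto hℓ <| (eventually_gt_atTop 0).mono fun t ht => by
    have := hδ_pos t ht
    positivity
  intro P cr st
  have hcorr : ∀ L t, RGG.corr (cr t) st (P t) = RGG.corr (RGG.ustat (RGG.crossInd (δ t) L))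
      (RGG.ustat (RGG.stressKernel w L)) (RGG.sample (RGG.ballMeasure d) t.toNNReal) := fun L t =>
    RGG.corr_stats L _ hw_meas hw_rot (δ t) t
  have hlim : ∀ L, Tendsto (fun t => RGG.corr (cr t) st (P t)) atTop
      (𝓝 (RGG.corrLimit L w ℓ)) := fun L => by
    simp_rw [hcorr L]
    exact RGG.tendsto_corr L hd hδ_pos hδ hℓ hℓ0 hw_meas hw_symm hw_pos (hsq L)
  let L₀ := RGG.basePlane d (le_trans (by norm_num) hd)
  refine ⟨fun t ht => ?_, RGG.corrLimit L₀ w ℓ, hlim L₀, fun L => ?_⟩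
  · obtain ⟨h1, h2⟩ := RGG.memLp_stats L₀ (RGG.uniformPlane d (le_trans (by norm_num) hd))
      hw_meas hw_pos hw_rot (hsq L₀) (δ t) t
    refine ⟨h1, h2, ?_⟩
    rw [hcorr L₀]
    exact RGG.corr_pos
      (RGG.memLp_ustat _ _ (RGG.measurable_crossInd _ _) (RGG.crossInd_nonneg _ _)
        (RGG.lintegral_crossFun_sq_ne_top _ _))
      (RGG.memLp_ustat _ _ (RGG.measurable_stressKernel hw_meas _)
        (RGG.stressKernel_nonneg _ hw_pos) (hsq L₀))
      (RGG.covariance_pos L₀ hd hw_meas hw_symm hw_pos (hsq L₀) (hδ_pos t ht)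
        (Real.toNNReal_pos.2 ht))
  -- The same correlation converges to `corrLimit` of every plane, so these limits coincide and the
  -- bound for `L` applies to the limit found with `L₀`.
  · rw [tendsto_nhds_unique (hlim L₀) (hlim L)]
    exact RGG.corrBound_pos L hd hℓ0 hw_meas hw_symm hw_pos (hsq L)
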